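/- Let $\mathcal S$ be a countably infinite state space, $\mathcal A$ a finite action space, $\mathbb P(\cdot|s,a)$ a transition kernel, $R:\mathcal S\times\mathcal A\to[0,R_{\max}]$ a reward, $\gamma\in(0,1)$, $\zeta$ an initial state distribution, and $\{\pi_\theta:\theta\in\mathbb R^d\}$ a class of policies. Put $$J(\theta)=(1-\gamma)\,\mathbb E\Big[\sum_{t\ge1}\gamma^tR(s_t,a_t)\Big],\qquad \mu_\theta(s)=(1-\gamma)\sum_{t\ge1}\gamma^{t-1}P(s_t=s)$$ (with $s_1\sim\zeta$, $a_t\sim\pi_\theta(\cdot|s_t)$, $s_{t+1}\sim\mathbb P(\cdot|s_t,a_t)$), and $Q^{\pi_\theta}(s,a)=\mathbb E[\sum_{t\ge1}\gamma^tR(s_t,a_t)\mid s_1=s,a_1=a]$. Assume: (1) each $\pi_\theta(a|s)$ is positive and differentiable in $\theta$; $\theta\mapsto\pi_\theta(a|s)$ is $L_\pi$-Lipschitz, the score $\nabla_\theta\log\pi_\theta(a|s)$ is $L$-Lipschitz in $\theta$, and its norm is at most $c_\Theta$, for all $s,a$. (2) There are $\sigma>0$, $\rho\in(0,1)$ such that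 for all $\theta$ and $t\ge1$, $\sup_s\|P(s_t\in\cdot\mid s_1=s)-\mu_\theta\|_{TV}\le\sigma\rho^t$ for the chain with policy $\pi_\theta$ and transition kernel $\hat P=\gamma\mathbb P+(1-\gamma)\zeta$ ($TV$ is the total variation distance, half the $\ell_1$ distance). PG-SGD starts with $\theta_1$, $s_1\sim\zeta$, $a_1\sim\pi_{\theta_1}(\cdot|s_1)$. At time $t$ it draws, independently given $(\theta_t,s_t,a_t)$, the unbiased estimate $\hat Q_t=\sum_{k=1}^{N}\gamma^{k/2}R(s^q_k,a^q_k)$ of $Q^{\pi_{\theta_t}}(s_t,a_t)$, where $(s^q_1,a^q_1)=(s_t,a_t)$, the trajectory follows $\mathbb P$ and $\pi_{\theta_t}$, and $N$ is an independent geometric time with $P(N=k)=(1-\gamma^{1/2})\gamma^{k/2}$, $k\ge0$. It sets $g_t=\hat Q_t\nabla_\theta\log\pi_{\theta_t}(a_t|s_t)$, $\theta_{t+1}=\theta_t-\alpha_tg_t$, and draws $s_{t+1}\sim\hat P(\cdot|s_t,a_t)$, $a_{t+1}\sim\pi_{\theta_{t+1}}(\cdot|s_{t+1})$. Let $G_\infty=\frac{c_\Theta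 R_{\max}}{1-\gamma}$, $X=1+\lceil\log_\rho\sigma^{-1}\rceil+\frac1{1-\rho}$ (where $\lceil x\rceil$ is the integer with $\lceil x\rceil-1\le x<\lceil x\rceil$), $c_J=\frac{R_{\max}L}{1-\gamma}+\frac{(1+c_\Theta)R_{\max}}{1-\gamma}|\mathcal A|L_\pi X$, $c_{\tilde J}=\frac{R_{\max}L}{1-\gamma}+c_\Theta|\mathcal A|L_\pi X$. Then $J$ is differentiable, $\nabla J(\theta)=\mathbb E_{s\sim\mu_\theta,\,a\sim\pi_\theta(\cdot|s)}[Q^{\pi_\theta}(s,a)\nabla_\theta\log\pi_\theta(a|s)]$, and for every $T\ge1$: (a) With a constant stepsize $\alpha_t=\alpha>0$ and $\tau^*=\min\{\tau\ge0:\sigma\rho^\tau\le\alpha\}$, $$\min_{1\le t\le T}\mathbb E\|\nabla J(\theta_t)\|^2\le\frac{J(\theta_1)/\alpha+2G_\infty^2\tau^*}{T}+\alpha C_1,$$ $$C_1=G_\infty^2\Big[\tfrac{c_J}2+(3c_J+c_{\tilde J})\tau^*+1+\tfrac{L_\pi G_\infty(2\tau^*+(\tau^*)^2)}2\Big].$$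 (b) With $\alpha_t=\frac{1-\gamma}{\sqrt t}$ and $\tau^*=\min\{\tau\ge0:\sigma\rho^\tau\le\frac{1-\gamma}{\sqrt T}\}$, $$\min_{1\le t\le T}\mathbb E\|\nabla J(\theta_t)\|^2\le\frac{J(\theta_1)+2(1-\gamma)^2G_\infty^2\tau^*}{(1-\gamma)T}+\frac{C_2}{(1-\gamma)^2\sqrt T},$$ $$C_2=R_{\max}+(1-\gamma)^3G_\infty^2\big[c_J+2(3c_J+c_{\tilde J})\tau^*+1+L_\pi G_\infty(\tau^*+(\tau^*)^2)\big].$$ In particular the minimum in (b) is $O\Big(\frac{\log^2(\sqrt T/(1-\gamma))}{(1-\gamma)^2\sqrt T}\Big)$: it is at most $C$ times this quantity for all $T\ge2$, with $C$ depending only on $R_{\max},L_\pi,L,c_\Theta,\sigma,\rho,|\mathcal A|$. -/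

import Mathlib

noncomputable section

namespace PGSGD

/-- The expectation of a real function under a discrete distribution. -/
def expect {X : Type*} (p : PMF X) (f : X → ℝ) : ℝ := ∑' x, (p x).toReal * f x

/-- The total variation distance `(1/2) ∑ |f - g|` of two (discrete) probability densities. -/
def tvDist {X : Type*} (f g : X → ℝ) : ℝ := (1 / 2) * ∑' x, |f x - g x|

/-- A discounted Markov decision process: transition kernel `P`, reward `R`, discount factor `γ`
and initial state distribution `ζ`. -/
structure MDP (S : Type*) (A : Type*) where
  P : S → A → PMF S
  R : S → A → ℝ
  γ : ℝ
  γ_pos : 0 < γ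
  γ_lt_one : γ < 1
  ζ : PMF S

variable {S A : Type*} {d : ℕ}

/-- A state drawn from `ν`, followed by an action drawn from the policy `pol`. -/
def withAction (pol : S → PMF A) (ν : PMF S) : PMF (S × A) :=
  ν.bind fun s => (pol s).map (Prod.mk s)

/-- The law of the state-action pair after `n` steps of the chain with transition kernel `tr`
and policy `pol`, when the first pair has law `p`. -/
def pairLaw (tr : S → A → PMF S) (pol : S → PMF A) (p : PMF (S × A)) : ℕ → PMF (S × A)
  | 0 => p
  | n + 1 => (pairLaw tr pol p n).bind fun x => withAction pol (tr x.1 x.2)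

/-- The restart kernel `γ P(· | s, a) + (1 - γ) ζ`. -/
def MDP.restart (M : MDP S A) (s : S) (a : A) : PMF S :=
  ⟨fun s' => ENNReal.ofReal M.γ * M.P s a s' + ENNReal.ofReal (1 - M.γ) * M.ζ s', by
    have h : ∑' s', (ENNReal.ofReal M.γ * M.P s a s' + ENNReal.ofReal (1 - M.γ) * M.ζ s') = 1 := by
      rw [ENNReal.tsum_add, ENNReal.tsum_mul_left, ENNReal.tsum_mul_left, PMF.tsum_coe,
        PMF.tsum_coe, mul_one, mul_one, ← ENNReal.ofReal_add M.γ_pos.le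
        (sub_nonneg.2 M.γ_lt_one.le)]
      simp
    exact h ▸ ENNReal.summable.hasSum⟩

/-- The geometric distribution with success probability `1 - √γ` (number of failures):
`T = k` has probability `(1 - √γ) √γ ^ k`, `k = 0, 1, 2, …`. -/
def MDP.horizon (M : MDP S A) : PMF ℕ :=
  ⟨fun k => ENNReal.ofReal ((1 - √M.γ) * √M.γ ^ k), by
    have h1 : √M.γ < 1 := by
      rw [Real.sqrt_lt' one_pos]; simpa using M.γ_lt_one
    have h := (hasSum_geometric_of_lt_one (Real.sqrt_nonneg M.γ) h1).mul_left (1 - √M.γ)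
    rw [mul_inv_cancel₀ (sub_pos.2 h1).ne'] at h
    have h0 : ∀ k, 0 ≤ (1 - √M.γ) * √M.γ ^ k := fun k =>
      mul_nonneg (sub_nonneg.2 h1.le) (pow_nonneg (Real.sqrt_nonneg _) k)
    have h2 := ENNReal.ofReal_tsum_of_nonneg h0 h.summable
    rw [h.tsum_eq, ENNReal.ofReal_one] at h2
    exact h2 ▸ ENNReal.summable.hasSum⟩

/-- The objective: the normalized expected discounted reward
`(1 - γ) E[∑_{t ≥ 1} γ ^ t R(s_t, a_t)]`, where `s_1 ~ ζ`, `a_t ~ π_θ(· | s_t)` and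
`s_{t+1} ~ P(· | s_t, a_t)` (the summation index below is `t - 1`). -/
def objective (M : MDP S A) (π : EuclideanSpace ℝ (Fin d) → S → PMF A)
    (θ : EuclideanSpace ℝ (Fin d)) : ℝ :=
  (1 - M.γ) * ∑' n : ℕ, M.γ ^ (n + 1) *
    expect (pairLaw M.P (π θ) (withAction (π θ) M.ζ) n) fun x => M.R x.1 x.2

/-- The state-action value function `E[∑_{t ≥ 1} γ ^ t R(s_t, a_t) | s_1 = s, a_1 = a]`. -/
def qValue (M : MDP S A) (pol : S → PMF A) (s : S) (a : A) : ℝ :=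
  ∑' n : ℕ, M.γ ^ (n + 1) * expect (pairLaw M.P pol (PMF.pure (s, a)) n) fun x => M.R x.1 x.2

/-- The normalized discounted state visitation distribution
`(1 - γ) ∑_{t ≥ 1} γ ^ (t - 1) P(s_t = s)`, with `s_1 ~ ζ`. -/
def visitation (M : MDP S A) (pol : S → PMF A) (s : S) : ℝ :=
  (1 - M.γ) * ∑' n : ℕ, M.γ ^ n *
    (((pairLaw M.P pol (withAction pol M.ζ) n).map Prod.fst) s).toReal

/-- The score function `∇_θ log π_θ(a | s)`. -/
def score (π : EuclideanSpace ℝ (Fin d) → S → PMF A) (θ : EuclideanSpace ℝ (Fin d))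
    (s : S) (a : A) : EuclideanSpace ℝ (Fin d) :=
  gradient (fun θ' => Real.log (π θ' s a).toReal) θ

/-- The policy gradient
`E[Q^{π_θ}(s, a) ∇_θ log π_θ(a | s)]` over the discounted state-action visitation distribution. -/
def policyGradient (M : MDP S A) (π : EuclideanSpace ℝ (Fin d) → S → PMF A)
    (θ : EuclideanSpace ℝ (Fin d)) : EuclideanSpace ℝ (Fin d) :=
  ∑' x : S × A, (visitation M (π θ) x.1 * (π θ x.1 x.2).toReal) •
    (qValue M (π θ) x.1 x.2 • score π θ x.1 x.2)

/-- The law of `∑_{i < k} γ ^ ((t + i) / 2) R(x_i)` along the chain with kernel `P` and policy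
`pol` started at the pair `x_0 = x`. -/
def rollout (M : MDP S A) (pol : S → PMF A) : ℕ → ℕ → S × A → PMF ℝ
  | 0, _, _ => PMF.pure 0
  | k + 1, t, x => (withAction pol (M.P x.1 x.2)).bind fun y =>
      (rollout M pol k (t + 1) y).map fun q => √M.γ ^ t * M.R x.1 x.2 + q

/-- The law of the output of the estimator EstQ at `(s, a)`: draw a geometric horizon `T`
and return `∑_{t = 1}^T γ ^ (t / 2) R(s_t, a_t)` along a fresh trajectory from `(s, a)`. -/
def estQ (M : MDP S A) (pol : S → PMF A) (s : S) (a : A) : PMF ℝ :=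
  M.horizon.bind fun T => rollout M pol T 1 (s, a)

/-- The joint law of `(θ_{n+1}, s_{n+1}, a_{n+1})` along PG-SGD with stepsizes `α` and
deterministic initial parameter `θ₁`. In each step a value `q` of EstQ is drawn, the parameter
moves by `-α_t q ∇ log π`, the next state is drawn from the restart kernel, and the next action
from the updated policy. -/
def pgsgdLaw (M : MDP S A) (π : EuclideanSpace ℝ (Fin d) → S → PMF A) (α : ℕ → ℝ)
    (θ₁ : EuclideanSpace ℝ (Fin d)) : ℕ → PMF (EuclideanSpace ℝ (Fin d) × S × A)
  | 0 => (withAction (π θ₁) M.ζ).map (Prod.mk θ₁)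
  | n + 1 => (pgsgdLaw M π α θ₁ n).bind fun x =>
      (estQ M (π x.1) x.2.1 x.2.2).bind fun q =>
        (withAction (π (x.1 - α (n + 1) • (q • score π x.1 x.2.1 x.2.2)))
          (M.restart x.2.1 x.2.2)).map
            (Prod.mk (x.1 - α (n + 1) • (q • score π x.1 x.2.1 x.2.2)))

/-- `E‖∇J(θ_t)‖²` along PG-SGD, for `t ≥ 1`. -/
def gradSq (M : MDP S A) (π : EuclideanSpace ℝ (Fin d) → S → PMF A) (α : ℕ → ℝ)
    (θ₁ : EuclideanSpace ℝ (Fin d)) (t : ℕ) : ℝ :=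
  expect (pgsgdLaw M π α θ₁ (t - 1)) fun x => ‖gradient (objective M π) x.1‖ ^ 2

/-- The assumption on the policy class: positive, differentiable, `Lπ`-Lipschitz policies with
an `L`-Lipschitz score function that is bounded by `cΘ`. -/
structure PolicyAssumption (π : EuclideanSpace ℝ (Fin d) → S → PMF A) (Lπ L cΘ : ℝ) : Prop where
  pos : ∀ θ s a, 0 < (π θ s a).toReal
  differentiable : ∀ s a, Differentiable ℝ fun θ => (π θ s a).toReal
  policy_lipschitz : ∀ θ₁ θ₂ s a,
    |(π θ₁ s a).toReal - (π θ₂ s a).toReal| ≤ Lπ * ‖θ₁ - θ₂‖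
  score_lipschitz : ∀ θ₁ θ₂ s a, ‖score π θ₁ s a - score π θ₂ s a‖ ≤ L * ‖θ₁ - θ₂‖
  score_bound : ∀ θ s a, ‖score π θ s a‖ ≤ cΘ

/-- The mixing assumption: under the restart kernel and any policy of the class, the law of `s_t`
given `s_1 = s` is within `σ ρ ^ t` of the visitation distribution, for all `t ≥ 1`. -/
def MixingAssumption (M : MDP S A) (π : EuclideanSpace ℝ (Fin d) → S → PMF A) (σ ρ : ℝ) : Prop :=
  ∀ θ s, ∀ t : ℕ, 1 ≤ t →
    tvDist
      (fun s' => (((pairLaw M.restart (π θ) (withAction (π θ) (PMF.pure s)) (t - 1)).map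
        Prod.fst) s').toReal)
      (visitation M (π θ)) ≤ σ * ρ ^ t

/-- `1 + ⌈log_ρ σ⁻¹⌉ + 1 / (1 - ρ)`, where `⌈x⌉` is the integer with `⌈x⌉ - 1 ≤ x < ⌈x⌉`. -/
def mixConst (σ ρ : ℝ) : ℝ := 1 + ((⌊Real.logb ρ σ⁻¹⌋ + 1 : ℤ) : ℝ) + 1 / (1 - ρ)

/-- The constant `c_J`; `nA` is the number of actions. -/
def cJ (γ Rmax Lπ L cΘ σ ρ : ℝ) (nA : ℕ) : ℝ :=
  Rmax * L / (1 - γ) + (1 + cΘ) * Rmax / (1 - γ) * (nA * Lπ * mixConst σ ρ)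

/-- The constant `c_{J̃}`. -/
def cJtilde (γ Rmax Lπ L cΘ σ ρ : ℝ) (nA : ℕ) : ℝ :=
  Rmax * L / (1 - γ) + cΘ * nA * Lπ * mixConst σ ρ

/-- The constant `G_∞`. -/
def Ginf (γ Rmax cΘ : ℝ) : ℝ := cΘ * Rmax / (1 - γ)

/-- The mixing time `τ* = min {τ : σ ρ ^ τ ≤ ε}`. -/
def mixTime (σ ρ ε : ℝ) : ℕ := sInf {τ : ℕ | σ * ρ ^ τ ≤ ε}

/-- The constant `C₁` for a constant stepsize, with `τ = τ*`. -/
def C1 (γ Rmax Lπ L cΘ σ ρ : ℝ) (nA : ℕ) (τ : ℝ) : ℝ :=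
  Ginf γ Rmax cΘ ^ 2 * (cJ γ Rmax Lπ L cΘ σ ρ nA / 2
    + (3 * cJ γ Rmax Lπ L cΘ σ ρ nA + cJtilde γ Rmax Lπ L cΘ σ ρ nA) * τ + 1
    + Lπ * Ginf γ Rmax cΘ * (2 * τ + τ ^ 2) / 2)

/-- The constant `C₂` for a diminishing stepsize, with `τ = τ*`. -/
def C2 (γ Rmax Lπ L cΘ σ ρ : ℝ) (nA : ℕ) (τ : ℝ) : ℝ :=
  Rmax + (1 - γ) ^ 3 * Ginf γ Rmax cΘ ^ 2 * (cJ γ Rmax Lπ L cΘ σ ρ nA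
    + 2 * (3 * cJ γ Rmax Lπ L cΘ σ ρ nA + cJtilde γ Rmax Lπ L cΘ σ ρ nA) * τ + 1
    + Lπ * Ginf γ Rmax cΘ * (τ + τ ^ 2))

end PGSGD

end

noncomputable section

namespace PGSGD

open scoped RealInnerProductSpace

/-! The argument has three layers: smoothness of J, a bias estimate for the Markovian noise, and a
summation.

Smoothness. Adding restarts to the kernel makes μ_θ its invariant law, and as operators on functions
of the state the restart kernel and γP differ by a functional with constant values. Constants are
invisible to oscillation, so mixing replaces discounting: k steps contract oscillations by min(1,
2σρ^(k+1)), and these factors sum to at most 2(X - 2) (`sum_mixCoeff_le`). This makes μ_θ Lipschitz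
in θ (`MixingAssumption.abs_expect_visitPMF_sub_le`) and bounds the oscillation of V_θ - V_θ', which
solves a Poisson equation (`MixingAssumption.oscLE_of_sub_kop`). The performance difference identity
`objective_sub_objective` writes J(θ) - J(θ') as the μ_θ-mean of an advantage of size O(‖θ - θ'‖).
Replacing μ_θ by μ_θ' and linearizing the policy both cost second order, which gives
differentiability and the gradient formula (`hasGradientAt_objective`). Since ∑_a ∇π(a|s) = 0,
values may be centred freely; this saves the factors of two that the constants need.

Bias. The estimator is unbiased given (θ_t, s_t), so one step lowers E J by α E⟨∇J(θ_t), h(θ_t,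
s_t)⟩ up to O(α²), where h is the mean over the action. The state is not distributed as μ_θ. Looking
τ steps ahead from θ_n, the chain is compared with the chain whose parameter is frozen at θ_n, which
has mixed up to σρ^(τ+1); the error is proportional to the drift G∑α (`abs_expect_sgdFrom_sub_le`,
`le_expect_sgdFrom_gradCorr`).

Summation. The bias bound relates ‖∇J(θ_n)‖² to the descent at time n + τ, so the two sums are
shifted by τ; the unmatched ends cost 2τm², with m a bound on the gradient norms
(`sum_le_of_descent_of_bias`). J ≥ 0 closes the telescoping sum, and the minimum is at most the
average. An infinite state space forces σρ ≥ 1 (`MixingAssumption.one_le`), hence X ≥ 4, and τ* ≥ 2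
for tolerances below 1; the stated constants rely on this. For α_t = (1 - γ)/√t the end cost does
not fit directly into the stated bound, and `amgm_initial_cost` trades it against the trivial bound
at t = 1. -/

/-- A real function that is bounded on the support of a discrete distribution. -/
def BddOn {X : Type*} (p : PMF X) (f : X → ℝ) : Prop := ∃ C, ∀ x ∈ p.support, |f x| ≤ C

/-- A bounded real function. -/
def Bdd {X : Type*} (f : X → ℝ) : Prop := ∃ C, ∀ x, |f x| ≤ C

/-! ### Expectations under discrete laws, and oscillation. -/

section Expect

variable {X Y : Type*} {p : PMF X} {f g : X → ℝ}

theorem Bdd.on (h : Bdd f) (p : PMF X) : BddOn p f := h.imp fun _ hC x _ => hC x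

theorem bdd_const (c : ℝ) : Bdd fun _ : X => c := ⟨|c|, fun _ => le_rfl⟩

theorem Bdd.add (hf : Bdd f) (hg : Bdd g) : Bdd fun x => f x + g x := by
  obtain ⟨C, hC⟩ := hf
  obtain ⟨D, hD⟩ := hg
  exact ⟨C + D, fun x => (abs_add_le _ _).trans (add_le_add (hC x) (hD x))⟩

theorem Bdd.neg (hf : Bdd f) : Bdd fun x => -f x := by
  obtain ⟨C, hC⟩ := hf
  exact ⟨C, fun x => by rw [abs_neg]; exact hC x⟩

theorem Bdd.sub (hf : Bdd f) (hg : Bdd g) : Bdd fun x => f x - g x := by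
  simpa only [sub_eq_add_neg] using hf.add hg.neg

theorem Bdd.mul (hf : Bdd f) (hg : Bdd g) : Bdd fun x => f x * g x := by
  obtain ⟨C, hC⟩ := hf
  obtain ⟨D, hD⟩ := hg
  refine ⟨C * D, fun x => ?_⟩
  rw [abs_mul]
  exact mul_le_mul (hC x) (hD x) (abs_nonneg _) ((abs_nonneg _).trans (hC x))

theorem Bdd.const_mul (hf : Bdd f) (c : ℝ) : Bdd fun x => c * f x := (bdd_const c).mul hf

theorem Bdd.sum {ι : Type*} {s : Finset ι} {f : ι → X → ℝ} (h : ∀ i ∈ s, Bdd (f i)) :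
    Bdd fun x => ∑ i ∈ s, f i x := by
  classical
  induction s using Finset.induction_on with
  | empty => simpa using bdd_const (X := X) 0
  | insert i s hi ih =>
    simp only [Finset.sum_insert hi]
    exact (h i (Finset.mem_insert_self _ _)).add
      (ih fun j hj => h j (Finset.mem_insert_of_mem hj))

theorem bdd_of_mem_Icc {a b : ℝ} (h : ∀ x, a ≤ f x ∧ f x ≤ b) : Bdd f :=
  ⟨max |a| |b|, fun x => abs_le_max_abs_abs (h x).1 (h x).2⟩

theorem summable_toReal (p : PMF X) : Summable fun x => (p x).toReal :=
  ENNReal.summable_toReal (by rw [p.tsum_coe]; exact ENNReal.one_ne_top)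

theorem tsum_toReal (p : PMF X) : ∑' x, (p x).toReal = 1 := by
  rw [← ENNReal.tsum_toReal_eq fun x => p.apply_ne_top x, p.tsum_coe, ENNReal.toReal_one]

theorem toReal_le_one (p : PMF X) (x : X) : (p x).toReal ≤ 1 :=
  ENNReal.toReal_le_of_le_ofReal zero_le_one (by simpa using p.coe_le_one x)

theorem toReal_eq_zero_of_notMem {x : X} (h : x ∉ p.support) : (p x).toReal = 0 := by
  rw [(p.apply_eq_zero_iff x).2 h, ENNReal.toReal_zero]

theorem abs_toReal_mul_le {C : ℝ} (h : ∀ x ∈ p.support, |f x| ≤ C) (x : X) :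
    |(p x).toReal * f x| ≤ (p x).toReal * C := by
  by_cases hx : x ∈ p.support
  · rw [abs_mul, abs_of_nonneg ENNReal.toReal_nonneg]
    exact mul_le_mul_of_nonneg_left (h x hx) ENNReal.toReal_nonneg
  · simp [toReal_eq_zero_of_notMem hx]

theorem BddOn.summable (h : BddOn p f) : Summable fun x => (p x).toReal * f x := by
  obtain ⟨C, hC⟩ := h
  exact Summable.of_norm_bounded ((summable_toReal p).mul_right C) (abs_toReal_mul_le hC)

theorem expect_const (p : PMF X) (c : ℝ) : expect p (fun _ => c) = c := by
  rw [expect, tsum_mul_right, tsum_toReal, one_mul]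

theorem expect_congr (h : ∀ x ∈ p.support, f x = g x) : expect p f = expect p g := by
  refine tsum_congr fun x => ?_
  by_cases hx : x ∈ p.support
  · rw [h x hx]
  · simp [toReal_eq_zero_of_notMem hx]

theorem expect_mono (hf : BddOn p f) (hg : BddOn p g) (h : ∀ x ∈ p.support, f x ≤ g x) :
    expect p f ≤ expect p g := by
  refine hf.summable.tsum_le_tsum (fun x => ?_) hg.summable
  by_cases hx : x ∈ p.support
  · exact mul_le_mul_of_nonneg_left (h x hx) ENNReal.toReal_nonneg
  · simp [toReal_eq_zero_of_notMem hx]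

theorem BddOn.const (p : PMF X) (c : ℝ) : BddOn p fun _ => c := (bdd_const c).on p

theorem expect_le {c : ℝ} (hf : BddOn p f) (h : ∀ x ∈ p.support, f x ≤ c) : expect p f ≤ c := by
  simpa [expect_const] using expect_mono hf (BddOn.const p c) h

theorem le_expect {c : ℝ} (hf : BddOn p f) (h : ∀ x ∈ p.support, c ≤ f x) : c ≤ expect p f := by
  simpa [expect_const] using expect_mono (BddOn.const p c) hf h

theorem abs_expect_le {c : ℝ} (h : ∀ x ∈ p.support, |f x| ≤ c) : |expect p f| ≤ c :=
  abs_le.2 ⟨le_expect ⟨c, h⟩ fun x hx => (abs_le.1 (h x hx)).1,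
    expect_le ⟨c, h⟩ fun x hx => (abs_le.1 (h x hx)).2⟩

theorem BddOn.add (hf : BddOn p f) (hg : BddOn p g) : BddOn p fun x => f x + g x := by
  obtain ⟨C, hC⟩ := hf
  obtain ⟨D, hD⟩ := hg
  exact ⟨C + D, fun x hx => (abs_add_le _ _).trans (add_le_add (hC x hx) (hD x hx))⟩

theorem BddOn.const_mul (hf : BddOn p f) (c : ℝ) : BddOn p fun x => c * f x := by
  obtain ⟨C, hC⟩ := hf
  refine ⟨|c| * C, fun x hx => ?_⟩
  rw [abs_mul]
  exact mul_le_mul_of_nonneg_left (hC x hx) (abs_nonneg c)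

theorem BddOn.of_abs_le (hg : BddOn p g) (h : ∀ x ∈ p.support, |f x| ≤ g x) : BddOn p f :=
  hg.imp fun _ hC x hx => (h x hx).trans ((le_abs_self _).trans (hC x hx))

theorem expect_add (hf : BddOn p f) (hg : BddOn p g) :
    expect p (fun x => f x + g x) = expect p f + expect p g := by
  simp only [expect, mul_add]
  exact hf.summable.tsum_add hg.summable

theorem expect_sub (hf : BddOn p f) (hg : BddOn p g) :
    expect p (fun x => f x - g x) = expect p f - expect p g := by
  simp only [expect, mul_sub]
  exact hf.summable.tsum_sub hg.summable

theorem expect_const_mul (p : PMF X) (c : ℝ) (f : X → ℝ) :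
    expect p (fun x => c * f x) = c * expect p f := by
  simp only [expect, ← tsum_mul_left]
  exact tsum_congr fun x => by ring

theorem expect_nonneg (h : ∀ x, 0 ≤ f x) : 0 ≤ expect p f :=
  tsum_nonneg fun x => mul_nonneg ENNReal.toReal_nonneg (h x)

theorem abs_expect_le_expect (hg : BddOn p g) (h : ∀ x ∈ p.support, |f x| ≤ g x) :
    |expect p f| ≤ expect p g := by
  have hf := hg.of_abs_le h
  refine abs_le'.2 ⟨expect_mono hf hg fun x hx => (le_abs_self _).trans (h x hx), ?_⟩
  rw [← neg_one_mul, ← expect_const_mul]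
  exact expect_mono (hf.const_mul _) hg fun x hx => by
    rw [neg_one_mul]; exact (neg_le_abs _).trans (h x hx)

theorem expect_finset_sum {ι : Type*} (s : Finset ι) {f : ι → X → ℝ}
    (h : ∀ i ∈ s, BddOn p (f i)) :
    expect p (fun x => ∑ i ∈ s, f i x) = ∑ i ∈ s, expect p (f i) := by
  simp only [expect, Finset.mul_sum]
  exact Summable.tsum_finsetSum fun i hi => (h i hi).summable

theorem expect_fintype [Fintype X] (p : PMF X) (f : X → ℝ) :
    expect p f = ∑ x, (p x).toReal * f x := tsum_fintype _

theorem sum_toReal [Fintype X] (p : PMF X) : ∑ x, (p x).toReal = 1 := by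
  rw [← tsum_toReal p, tsum_fintype]

theorem expect_pure (x : X) (f : X → ℝ) : expect (PMF.pure x) f = f x := by
  classical
  rw [expect, tsum_eq_single x fun y hy => by simp [PMF.pure_apply, hy]]
  simp

/-- Fubini for the double series. Boundedness is asked only on the support because the estimator's
output and the parameter's displacement are unbounded as functions but bounded on the values
actually reached. -/
theorem expect_bind {q : X → PMF Y} {f : Y → ℝ} (h : BddOn (p.bind q) f) :
    expect (p.bind q) f = expect p fun x => expect (q x) f := by
  obtain ⟨C, hC⟩ := h
  have hpq : ∀ x y, (p x * q x y).toReal = (p x).toReal * (q x y).toReal := fun _ _ =>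
    ENNReal.toReal_mul
  have hs0 : Summable fun z : X × Y => (p z.1 * q z.1 z.2).toReal := by
    refine ENNReal.summable_toReal ?_
    rw [ENNReal.tsum_prod (f := fun x y => p x * q x y)]
    simp [ENNReal.tsum_mul_left, PMF.tsum_coe]
  have hs : Summable fun z : X × Y => (p z.1 * q z.1 z.2).toReal * f z.2 := by
    refine Summable.of_norm_bounded (hs0.mul_right C) fun z => ?_
    rw [Real.norm_eq_abs, abs_mul, abs_of_nonneg ENNReal.toReal_nonneg]
    by_cases hz : z.2 ∈ (p.bind q).support
    · exact mul_le_mul_of_nonneg_left (hC _ hz) ENNReal.toReal_nonneg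
    · have h0 : p z.1 * q z.1 z.2 = 0 := by
        have := (PMF.apply_eq_zero_iff _ _).2 hz
        rw [PMF.bind_apply, ENNReal.tsum_eq_zero] at this
        exact this z.1
      simp [h0]
  have hl : ∀ y, ((p.bind q) y).toReal * f y = ∑' x, (p x * q x y).toReal * f y := fun y => by
    rw [tsum_mul_right, PMF.bind_apply, ENNReal.tsum_toReal_eq fun x =>
      ENNReal.mul_ne_top (p.apply_ne_top x) ((q x).apply_ne_top y)]
  have hr : ∀ x, (p x).toReal * ∑' y, (q x y).toReal * f y
      = ∑' y, (p x * q x y).toReal * f y := fun x => by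
    rw [← tsum_mul_left]
    exact tsum_congr fun y => by rw [hpq]; ring
  simp only [expect, hl, hr]
  exact hs.tsum_comm' (fun x => hs.prod_factor x) fun y =>
    hs.comp_injective (i := fun x : X => (x, y)) fun _ _ h => congrArg Prod.fst h

theorem expect_map {q : X → Y} {f : Y → ℝ} (h : BddOn (p.map q) f) :
    expect (p.map q) f = expect p fun x => f (q x) := by
  rw [PMF.map] at h ⊢
  rw [expect_bind h]
  simp [expect_pure]

theorem BddOn.of_bind {q : X → PMF Y} {f : Y → ℝ} (h : BddOn (p.bind q) f) {x : X}
    (hx : x ∈ p.support) : BddOn (q x) f :=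
  h.imp fun _ hC y hy => hC y ((PMF.mem_support_bind_iff _ _ _).2 ⟨x, hx, hy⟩)

theorem BddOn.expect {q : X → PMF Y} {f : Y → ℝ} (h : BddOn (p.bind q) f) :
    BddOn p fun x => expect (q x) f :=
  h.imp fun _ hC x hx => abs_expect_le fun y hy =>
    hC y ((PMF.mem_support_bind_iff _ _ _).2 ⟨x, hx, hy⟩)

theorem Bdd.expect {f : Y → ℝ} (h : Bdd f) (q : X → PMF Y) : Bdd fun x => expect (q x) f :=
  h.imp fun _ hC _ => abs_expect_le fun y _ => hC y

theorem expect_tsum {c : ℕ → ℝ} {f : ℕ → X → ℝ} {C : ℝ} (hc : Summable c) (hc0 : ∀ n, 0 ≤ c n)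
    (hf : ∀ n x, |f n x| ≤ C) :
    expect p (fun x => ∑' n, c n * f n x) = ∑' n, c n * expect p (f n) := by
  have hs : Summable fun z : X × ℕ => (p z.1).toReal * (c z.2 * f z.2 z.1) := by
    refine Summable.of_norm_bounded (((summable_toReal p).mul_of_nonneg hc
      (fun _ => ENNReal.toReal_nonneg) hc0).mul_right C) fun z => ?_
    rw [Real.norm_eq_abs, abs_mul, abs_mul, abs_of_nonneg ENNReal.toReal_nonneg,
      abs_of_nonneg (hc0 _), mul_assoc]
    exact mul_le_mul_of_nonneg_left (mul_le_mul_of_nonneg_left (hf _ _) (hc0 _))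
      ENNReal.toReal_nonneg
  have hl : ∀ n, c n * expect p (f n) = ∑' x, (p x).toReal * (c n * f n x) := fun n =>
    (expect_const_mul p (c n) (f n)).symm
  simp only [hl]
  simp only [expect, ← tsum_mul_left]
  exact (hs.tsum_comm).symm

/-- A function whose oscillation is at most `c`. -/
def OscLE (f : X → ℝ) (c : ℝ) : Prop := ∀ x y, f x - f y ≤ c

theorem oscLE_of_abs_le {c : ℝ} (h : ∀ x, |f x| ≤ c) : OscLE f (2 * c) := fun x y => by
  linarith [(abs_le.1 (h x)).2, (abs_le.1 (h y)).1]

theorem oscLE_of_abs_sub_le {c m : ℝ} (h : ∀ x, |f x - m| ≤ c) : OscLE f (2 * c) := fun x y => by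
  linarith [(abs_le.1 (h x)).2, (abs_le.1 (h y)).1]

theorem OscLE.nonneg [Nonempty X] {c : ℝ} (h : OscLE f c) : 0 ≤ c := by
  obtain ⟨x⟩ := ‹Nonempty X›
  simpa using h x x

theorem OscLE.exists_center [Nonempty X] {c : ℝ} (h : OscLE f c) : ∃ m, ∀ x, |f x - m| ≤ c / 2 := by
  obtain ⟨x₀⟩ := ‹Nonempty X›
  have hb : BddBelow (Set.range f) := ⟨f x₀ - c, by
    rintro _ ⟨x, rfl⟩; linarith [h x₀ x]⟩
  have hne : Nonempty X := ⟨x₀⟩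
  refine ⟨(⨅ x, f x) + c / 2, fun x => abs_le.2 ⟨?_, ?_⟩⟩
  · linarith [ciInf_le hb x]
  · have : f x - c ≤ ⨅ y, f y := le_ciInf fun y => by linarith [h x y]
    linarith

theorem OscLE.bdd [Nonempty X] {c : ℝ} (h : OscLE f c) : Bdd f := by
  obtain ⟨m, hm⟩ := h.exists_center
  refine ⟨c / 2 + |m|, fun x => ?_⟩
  have := abs_add_le (f x - m) m
  rw [sub_add_cancel] at this
  linarith [hm x]

/-- The two laws have equal mass, so f may be centred at the midpoint of its range. The sup norm
then is c/2, and the half in `tvDist` leaves exactly the factor c. -/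
theorem abs_expect_sub_expect_le [Nonempty X] {c : ℝ} (h : OscLE f c) (p q : PMF X) :
    |expect p f - expect q f| ≤ c * tvDist (fun x => (p x).toReal) fun x => (q x).toReal := by
  obtain ⟨m, hm⟩ := h.exists_center
  have hb := h.bdd
  have e : ∀ r : PMF X, expect r f = expect r (fun x => f x - m) + m := fun r => by
    rw [expect_sub (hb.on r) (BddOn.const r m), expect_const]; ring
  have hbm : Bdd fun x => f x - m := ⟨_, hm⟩
  have hd : Summable fun x => |(p x).toReal - (q x).toReal| :=
    ((summable_toReal p).sub (summable_toReal q)).abs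
  rw [e p, e q, add_sub_add_right_eq_sub, expect, expect,
    ← (hbm.on p).summable.tsum_sub (hbm.on q).summable, tvDist, ← mul_assoc, ← tsum_mul_left]
  rw [← Real.norm_eq_abs]
  refine tsum_of_norm_bounded (hd.mul_left (c * (1 / 2))).hasSum fun x => ?_
  rw [← sub_mul, Real.norm_eq_abs, abs_mul, mul_comm]
  exact mul_le_mul_of_nonneg_right ((hm x).trans_eq (by ring)) (abs_nonneg _)

theorem OscLE.expect_sub_expect_le {c : ℝ} [Nonempty X] (h : OscLE f c) (p q : PMF X) :
    expect p f - expect q f ≤ c := by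
  have hb := h.bdd
  have : ∀ y, expect p f ≤ c + f y := fun y =>
    expect_le (hb.on p) fun x _ => by linarith [h x y]
  have h2 : expect p f - c ≤ expect q f := le_expect (hb.on q) fun y _ => by linarith [this y]
  linarith

theorem OscLE.expect {c : ℝ} [Nonempty X] (h : OscLE f c) (q : Y → PMF X) :
    OscLE (fun y => expect (q y) f) c := fun _ _ => h.expect_sub_expect_le _ _

end Expect

/-! ### Transition operators on functions of the state. -/

section Kernel

variable {S A : Type*}

/-- The transition operator on functions of the state of the chain with kernel `tr` and
policy `pol`. -/
def kop (tr : S → A → PMF S) (pol : S → PMF A) (f : S → ℝ) (s : S) : ℝ :=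
  expect (pol s) fun a => expect (tr s a) f

variable {tr : S → A → PMF S} {pol : S → PMF A} {f : S → ℝ}

theorem kop_abs_le {C : ℝ} (h : ∀ s, |f s| ≤ C) (s : S) : |kop tr pol f s| ≤ C :=
  abs_expect_le fun _ _ => abs_expect_le fun _ _ => h _

theorem kop_iterate_abs_le {C : ℝ} (h : ∀ s, |f s| ≤ C) (n : ℕ) (s : S) :
    |(kop tr pol)^[n] f s| ≤ C := by
  induction n generalizing s with
  | zero => exact h s
  | succ n ih => rw [Function.iterate_succ_apply']; exact kop_abs_le ih s

theorem Bdd.kop (h : Bdd f) : Bdd (kop tr pol f) := h.imp fun _ hC => kop_abs_le hC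

theorem Bdd.kop_iterate (h : Bdd f) (n : ℕ) : Bdd ((PGSGD.kop tr pol)^[n] f) :=
  h.imp fun _ hC => kop_iterate_abs_le hC n

theorem kop_eq_expect_bind (h : Bdd f) (s : S) : kop tr pol f s = expect ((pol s).bind (tr s)) f :=
  (expect_bind (h.on _)).symm

theorem OscLE.kop [Nonempty S] {c : ℝ} (h : OscLE f c) : OscLE (kop tr pol f) c := fun s t => by
  rw [kop_eq_expect_bind h.bdd, kop_eq_expect_bind h.bdd]
  exact h.expect_sub_expect_le _ _

theorem OscLE.kop_iterate [Nonempty S] {c : ℝ} (h : OscLE f c) (n : ℕ) :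
    OscLE ((PGSGD.kop tr pol)^[n] f) c := by
  induction n with
  | zero => exact h
  | succ n ih => rw [Function.iterate_succ_apply']; exact ih.kop

theorem kop_sub {g : S → ℝ} (hf : Bdd f) (hg : Bdd g) (s : S) :
    kop tr pol (fun s => f s - g s) s = kop tr pol f s - kop tr pol g s := by
  rw [kop, kop, kop, ← expect_sub ((hf.expect _).on _) ((hg.expect _).on _)]
  exact expect_congr fun a _ => expect_sub (hf.on _) (hg.on _)

theorem expect_withAction {ν : PMF S} {F : S × A → ℝ} (h : Bdd F) :
    expect (withAction pol ν) F = expect ν fun s => expect (pol s) fun a => F (s, a) := by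
  rw [withAction, expect_bind (h.on _)]
  exact expect_congr fun s _ => expect_map (h.on _)

theorem Bdd.avg {F : S × A → ℝ} (h : Bdd F) : Bdd fun s => PGSGD.expect (pol s) fun a => F (s, a) :=
  h.imp fun _ hC _ => abs_expect_le fun _ _ => hC _

/-- Duality between laws and operators: it lets the rest of the proof work with iterates of `kop` on
functions of the state alone. -/
theorem expect_pairLaw {ν : PMF S} {F : S × A → ℝ} (h : Bdd F) (n : ℕ) :
    expect (pairLaw tr pol (withAction pol ν) n) F
      = expect ν ((kop tr pol)^[n] fun s => expect (pol s) fun a => F (s, a)) := by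
  induction n generalizing F with
  | zero => exact expect_withAction h
  | succ n ih =>
    rw [pairLaw, expect_bind (h.on _)]
    simp only [expect_withAction h]
    rw [ih (F := fun x => expect (tr x.1 x.2) fun s => expect (pol s) fun a => F (s, a))
      (h.avg.expect _), Function.iterate_succ_apply]
    rfl

theorem pairLaw_succ' (p : PMF (S × A)) (n : ℕ) :
    pairLaw tr pol p (n + 1)
      = pairLaw tr pol (p.bind fun x => withAction pol (tr x.1 x.2)) n := by
  induction n with
  | zero => rfl
  | succ n ih => rw [pairLaw, ih]; rfl

theorem expect_pairLaw_fst {ν : PMF S} (h : Bdd f) (n : ℕ) :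
    expect ((pairLaw tr pol (withAction pol ν) n).map Prod.fst) f
      = expect ν ((kop tr pol)^[n] f) := by
  have h' : Bdd fun x : S × A => f x.1 := h.imp fun _ hC x => hC x.1
  rw [expect_map (h.on _), expect_pairLaw h']
  simp only [expect_const]

theorem expect_pairLaw_pure_succ {F : S × A → ℝ} (h : Bdd F) (s : S) (a : A) (n : ℕ) :
    expect (pairLaw tr pol (PMF.pure (s, a)) (n + 1)) F
      = expect (tr s a) ((kop tr pol)^[n] fun s => expect (pol s) fun a => F (s, a)) := by
  rw [pairLaw_succ', PMF.pure_bind, expect_pairLaw h]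

end Kernel

/-! ### Value functions and Bellman equations. -/

section Value

variable {S A : Type*} (M : MDP S A) (pol : S → PMF A) {Rmax : ℝ} {f : S → ℝ}

theorem MDP.sub_pos : 0 < 1 - M.γ := _root_.sub_pos.2 M.γ_lt_one

theorem MDP.tsum_geometric : ∑' n : ℕ, M.γ ^ n = (1 - M.γ)⁻¹ :=
  tsum_geometric_of_lt_one M.γ_pos.le M.γ_lt_one

theorem MDP.summable_geometric : Summable fun n : ℕ => M.γ ^ n :=
  summable_geometric_of_lt_one M.γ_pos.le M.γ_lt_one

theorem MDP.summable_geometric_succ : Summable fun n : ℕ => M.γ ^ (n + 1) :=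
  (summable_nat_add_iff 1).2 M.summable_geometric

theorem MDP.summable_geometric_succ_mul {f : ℕ → ℝ} {C : ℝ} (h : ∀ n, |f n| ≤ C) :
    Summable fun n : ℕ => M.γ ^ (n + 1) * f n := by
  refine Summable.of_norm_bounded (M.summable_geometric_succ.mul_right C) fun n => ?_
  rw [Real.norm_eq_abs, abs_mul, abs_of_nonneg (pow_nonneg M.γ_pos.le _)]
  exact mul_le_mul_of_nonneg_left (h n) (pow_nonneg M.γ_pos.le _)

theorem MDP.summable_geometric_mul {f : ℕ → ℝ} {C : ℝ} (h : ∀ n, |f n| ≤ C) :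
    Summable fun n : ℕ => M.γ ^ n * f n := by
  refine Summable.of_norm_bounded (M.summable_geometric.mul_right C) fun n => ?_
  rw [Real.norm_eq_abs, abs_mul, abs_of_nonneg (pow_nonneg M.γ_pos.le _)]
  exact mul_le_mul_of_nonneg_left (h n) (pow_nonneg M.γ_pos.le _)

/-- The expected one-step reward of a state. -/
def meanReward (s : S) : ℝ := expect (pol s) (M.R s)

/-- The state value function `E[∑_{t ≥ 1} γ ^ t R(s_t, a_t) | s_1 = s]`. -/
def value (s : S) : ℝ := ∑' n : ℕ, M.γ ^ (n + 1) * (kop M.P pol)^[n] (meanReward M pol) s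

variable {M pol}

theorem MDP.bdd_reward (hR : ∀ s a, 0 ≤ M.R s a ∧ M.R s a ≤ Rmax) :
    Bdd fun x : S × A => M.R x.1 x.2 := bdd_of_mem_Icc fun x => hR x.1 x.2

theorem abs_meanReward_le (hR : ∀ s a, 0 ≤ M.R s a ∧ M.R s a ≤ Rmax) (s : S) :
    |meanReward M pol s| ≤ Rmax :=
  abs_expect_le fun a _ => abs_le.2 ⟨by linarith [hR s a], (hR s a).2⟩

theorem expect_value (hR : ∀ s a, 0 ≤ M.R s a ∧ M.R s a ≤ Rmax) (ν : PMF S) :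
    expect ν (value M pol)
      = ∑' n : ℕ, M.γ ^ (n + 1) * expect ν ((kop M.P pol)^[n] (meanReward M pol)) :=
  expect_tsum M.summable_geometric_succ (fun _ => pow_nonneg M.γ_pos.le _)
    fun n => kop_iterate_abs_le (abs_meanReward_le hR) n

/-- First-step decomposition. The discounting starts at γ¹, so the immediate reward also carries a
factor γ. -/
theorem qValue_eq (hR : ∀ s a, 0 ≤ M.R s a ∧ M.R s a ≤ Rmax) (s : S) (a : A) :
    qValue M pol s a = M.γ * M.R s a + M.γ * expect (M.P s a) (value M pol) := by
  have hb := MDP.bdd_reward hR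
  have hs : Summable fun n : ℕ => M.γ ^ (n + 1) *
      expect (pairLaw M.P pol (PMF.pure (s, a)) n) fun x => M.R x.1 x.2 := by
    refine M.summable_geometric_succ_mul (C := Rmax) fun n => abs_expect_le fun x _ => ?_
    exact abs_le.2 ⟨by linarith [hR x.1 x.2], (hR x.1 x.2).2⟩
  rw [qValue, hs.tsum_eq_zero_add, expect_value hR, ← tsum_mul_left]
  congr 1
  · simp [pairLaw, expect_pure]
  · refine tsum_congr fun n => ?_
    rw [expect_pairLaw_pure_succ hb, pow_succ' _ (n + 1), mul_assoc]
    rfl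

theorem objective_eq {d : ℕ} {π : EuclideanSpace ℝ (Fin d) → S → PMF A}
    (hR : ∀ s a, 0 ≤ M.R s a ∧ M.R s a ≤ Rmax) (θ : EuclideanSpace ℝ (Fin d)) :
    objective M π θ = (1 - M.γ) * expect M.ζ (value M (π θ)) := by
  rw [objective, expect_value hR]
  congr 1
  exact tsum_congr fun n => by rw [expect_pairLaw (MDP.bdd_reward hR)]; rfl

theorem value_mem (hR : ∀ s a, 0 ≤ M.R s a ∧ M.R s a ≤ Rmax) (s : S) :
    0 ≤ value M pol s ∧ value M pol s ≤ M.γ * Rmax / (1 - M.γ) := by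
  have hk : ∀ n s, 0 ≤ (kop M.P pol)^[n] (meanReward M pol) s := fun n => by
    induction n with
    | zero => exact fun s => tsum_nonneg fun a => mul_nonneg ENNReal.toReal_nonneg (hR s a).1
    | succ n ih =>
      intro s
      rw [Function.iterate_succ_apply']
      exact tsum_nonneg fun a => mul_nonneg ENNReal.toReal_nonneg
        (tsum_nonneg fun s' => mul_nonneg ENNReal.toReal_nonneg (ih s'))
  have hle := fun n => kop_iterate_abs_le (tr := M.P) (pol := pol) (abs_meanReward_le (pol := pol) hR) n s
  have hs := M.summable_geometric_succ_mul hle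
  refine ⟨tsum_nonneg fun n => mul_nonneg (pow_nonneg M.γ_pos.le _) (hk n s), ?_⟩
  refine (hs.tsum_le_tsum (fun n => mul_le_mul_of_nonneg_left ((le_abs_self _).trans (hle n))
    (pow_nonneg M.γ_pos.le _)) (M.summable_geometric_succ.mul_right Rmax)).trans_eq ?_
  rw [tsum_mul_right]
  simp only [pow_succ']
  rw [tsum_mul_left, M.tsum_geometric]
  ring

theorem bdd_value (hR : ∀ s a, 0 ≤ M.R s a ∧ M.R s a ≤ Rmax) : Bdd (value M pol) :=
  bdd_of_mem_Icc (value_mem hR)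

theorem value_eq (hR : ∀ s a, 0 ≤ M.R s a ∧ M.R s a ≤ Rmax) (s : S) :
    value M pol s = M.γ * meanReward M pol s + M.γ * kop M.P pol (value M pol) s := by
  have hb := fun n => kop_iterate_abs_le (tr := M.P) (pol := pol) (abs_meanReward_le (pol := pol) hR) n
  have h : kop M.P pol (value M pol) s
      = ∑' n : ℕ, M.γ ^ (n + 1) * (kop M.P pol)^[n + 1] (meanReward M pol) s := by
    rw [kop_eq_expect_bind (bdd_value hR), expect_value hR]
    refine tsum_congr fun n => ?_
    rw [Function.iterate_succ_apply', kop_eq_expect_bind ⟨_, hb n⟩]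
  have hs := M.summable_geometric_succ_mul fun n => hb n s
  rw [value, hs.tsum_eq_zero_add, h, ← tsum_mul_left]
  congr 1
  · simp
  · exact tsum_congr fun n => by ring

theorem value_eq_expect_qValue (hR : ∀ s a, 0 ≤ M.R s a ∧ M.R s a ≤ Rmax) (s : S) :
    value M pol s = expect (pol s) (qValue M pol s) := by
  have h1 : Bdd (M.R s) := bdd_of_mem_Icc (hR s)
  have h2 : Bdd fun a => expect (M.P s a) (value M pol) := (bdd_value hR).expect _
  rw [value_eq hR, meanReward, kop, ← expect_const_mul, ← expect_const_mul,
    ← expect_add ((h1.const_mul _).on _) ((h2.const_mul _).on _)]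
  exact expect_congr fun a _ => (qValue_eq hR s a).symm

theorem qValue_mem (hR : ∀ s a, 0 ≤ M.R s a ∧ M.R s a ≤ Rmax) (s : S) (a : A) :
    0 ≤ qValue M pol s a ∧ qValue M pol s a ≤ M.γ * Rmax / (1 - M.γ) := by
  have hb := (bdd_value (pol := pol) hR).on (M.P s a)
  have h0 := le_expect hb fun s' _ => (value_mem hR s').1
  have h1 := expect_le hb fun s' _ => (value_mem hR s').2
  rw [qValue_eq hR]
  have := M.sub_pos
  refine ⟨add_nonneg (mul_nonneg M.γ_pos.le (hR s a).1) (mul_nonneg M.γ_pos.le h0), ?_⟩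
  calc M.γ * M.R s a + M.γ * expect (M.P s a) (value M pol)
      ≤ M.γ * Rmax + M.γ * (M.γ * Rmax / (1 - M.γ)) :=
        add_le_add (mul_le_mul_of_nonneg_left (hR s a).2 M.γ_pos.le)
          (mul_le_mul_of_nonneg_left h1 M.γ_pos.le)
    _ = _ := by field_simp; ring

theorem objective_mem {d : ℕ} {π : EuclideanSpace ℝ (Fin d) → S → PMF A}
    (hR : ∀ s a, 0 ≤ M.R s a ∧ M.R s a ≤ Rmax) (θ : EuclideanSpace ℝ (Fin d)) :
    0 ≤ objective M π θ ∧ objective M π θ ≤ M.γ * Rmax := by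
  have hb := (bdd_value (pol := π θ) hR).on M.ζ
  have h0 := le_expect hb fun s' _ => (value_mem hR s').1
  have h1 := expect_le hb fun s' _ => (value_mem hR s').2
  rw [objective_eq hR]
  have hp := M.sub_pos
  refine ⟨mul_nonneg hp.le h0, ?_⟩
  calc _ ≤ (1 - M.γ) * (M.γ * Rmax / (1 - M.γ)) := mul_le_mul_of_nonneg_left h1 hp.le
    _ = _ := by field_simp

end Value

/-! ### The visitation distribution as the invariant law of the restart chain. -/

section Visitation

variable {S A : Type*}

/-- The geometric distribution `(1 - r) r ^ k` on the natural numbers. -/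
def geometricPMF (r : ℝ) (h0 : 0 ≤ r) (h1 : r < 1) : PMF ℕ :=
  ⟨fun k => ENNReal.ofReal ((1 - r) * r ^ k), by
    have h := (hasSum_geometric_of_lt_one h0 h1).mul_left (1 - r)
    rw [mul_inv_cancel₀ (sub_pos.2 h1).ne'] at h
    have h2 := ENNReal.ofReal_tsum_of_nonneg
      (fun k => mul_nonneg (sub_nonneg.2 h1.le) (pow_nonneg h0 k)) h.summable
    rw [h.tsum_eq, ENNReal.ofReal_one] at h2
    exact h2 ▸ ENNReal.summable.hasSum⟩

theorem geometricPMF_toReal (r : ℝ) (h0 : 0 ≤ r) (h1 : r < 1) (k : ℕ) :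
    (geometricPMF r h0 h1 k).toReal = (1 - r) * r ^ k :=
  ENNReal.toReal_ofReal (mul_nonneg (sub_nonneg.2 h1.le) (pow_nonneg h0 k))

/-- The discounted state visitation distribution as a `PMF`. -/
def visitPMF (M : MDP S A) (pol : S → PMF A) : PMF S :=
  (geometricPMF M.γ M.γ_pos.le M.γ_lt_one).bind fun n =>
    (pairLaw M.P pol (withAction pol M.ζ) n).map Prod.fst

variable {M : MDP S A} {pol : S → PMF A} {f : S → ℝ}

theorem visitPMF_toReal (s : S) : (visitPMF M pol s).toReal = visitation M pol s := by
  rw [visitPMF, PMF.bind_apply, ENNReal.tsum_toReal_eq fun n =>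
    ENNReal.mul_ne_top (PMF.apply_ne_top _ _) (PMF.apply_ne_top _ _), visitation, ← tsum_mul_left]
  refine tsum_congr fun n => ?_
  rw [ENNReal.toReal_mul, geometricPMF_toReal, mul_assoc]

theorem expect_visitPMF (h : Bdd f) :
    expect (visitPMF M pol) f
      = (1 - M.γ) * ∑' n : ℕ, M.γ ^ n * expect M.ζ ((kop M.P pol)^[n] f) := by
  rw [visitPMF, expect_bind (h.on _), expect, ← tsum_mul_left]
  refine tsum_congr fun n => ?_
  rw [geometricPMF_toReal, expect_pairLaw_fst h, mul_assoc]

/-- Splitting off the n = 0 term of the discounted series gives the flow equation μ = (1 - γ)ζ +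
γμP. It yields invariance under the restart kernel and also the performance difference identity. -/
theorem expect_visitPMF_eq (h : Bdd f) :
    expect (visitPMF M pol) f
      = (1 - M.γ) * expect M.ζ f + M.γ * expect (visitPMF M pol) (kop M.P pol f) := by
  obtain ⟨C, hC⟩ := h
  have hs := M.summable_geometric_mul fun n =>
    abs_expect_le (p := M.ζ) fun s _ => kop_iterate_abs_le (tr := M.P) (pol := pol) hC n s
  rw [expect_visitPMF ⟨C, hC⟩, expect_visitPMF (Bdd.kop ⟨C, hC⟩), hs.tsum_eq_zero_add]
  simp only [← Function.iterate_succ_apply, pow_succ', mul_assoc, tsum_mul_left]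
  simp
  ring

theorem restart_toReal (s : S) (a : A) (s' : S) :
    (M.restart s a s').toReal = M.γ * (M.P s a s').toReal + (1 - M.γ) * (M.ζ s').toReal := by
  change (ENNReal.ofReal M.γ * M.P s a s' + ENNReal.ofReal (1 - M.γ) * M.ζ s').toReal = _
  rw [ENNReal.toReal_add (ENNReal.mul_ne_top ENNReal.ofReal_ne_top (PMF.apply_ne_top _ _))
    (ENNReal.mul_ne_top ENNReal.ofReal_ne_top (PMF.apply_ne_top _ _)), ENNReal.toReal_mul,
    ENNReal.toReal_mul, ENNReal.toReal_ofReal M.γ_pos.le, ENNReal.toReal_ofReal M.sub_pos.le]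

theorem expect_restart (h : Bdd f) (s : S) (a : A) :
    expect (M.restart s a) f = M.γ * expect (M.P s a) f + (1 - M.γ) * expect M.ζ f := by
  simp only [expect, restart_toReal]
  rw [← tsum_mul_left, ← tsum_mul_left,
    ← ((h.on (M.P s a)).summable.mul_left _).tsum_add ((h.on M.ζ).summable.mul_left _)]
  exact tsum_congr fun s' => by ring

theorem kop_restart (h : Bdd f) (s : S) :
    kop M.restart pol f s = M.γ * kop M.P pol f s + (1 - M.γ) * expect M.ζ f := by
  have hb : Bdd fun a => expect (M.P s a) f := h.expect _
  simp only [kop, expect_restart h]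
  rw [expect_add ((hb.const_mul _).on _) (BddOn.const _ _), expect_const, expect_const_mul]

theorem expect_visitPMF_kop_restart (h : Bdd f) :
    expect (visitPMF M pol) (kop M.restart pol f) = expect (visitPMF M pol) f := by
  rw [expect_visitPMF_eq h, show kop M.restart pol f = _ from funext (kop_restart h), expect_add ((h.kop.const_mul _).on _) (BddOn.const _ _), expect_const, expect_const_mul]
  ring

end Visitation

/-! ### Consequences of uniform mixing: contraction, Poisson equation, perturbation of μ. -/

section Mixing

variable {S A : Type*} {d : ℕ} {M : MDP S A} {π : EuclideanSpace ℝ (Fin d) → S → PMF A}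
  {σ ρ c : ℝ} {f : S → ℝ} {θ : EuclideanSpace ℝ (Fin d)}

theorem MixingAssumption.abs_iterate_sub_le [Nonempty S] (hmix : MixingAssumption M π σ ρ)
    (h : OscLE f c) (θ : EuclideanSpace ℝ (Fin d)) (k : ℕ) (s : S) :
    |(kop M.restart (π θ))^[k] f s - expect (visitPMF M (π θ)) f| ≤ c * (σ * ρ ^ (k + 1)) := by
  have hne : Nonempty S := ⟨s⟩
  -- The assumption counts s_1 as time t = 1, so k transitions correspond to t = k + 1.
  have h1 := hmix θ s (k + 1) (Nat.le_add_left 1 k)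
  rw [Nat.add_sub_cancel, show visitation M (π θ) = fun s => (visitPMF M (π θ) s).toReal from
    funext fun s => visitPMF_toReal s |>.symm] at h1
  have h2 := abs_expect_sub_expect_le h
    ((pairLaw M.restart (π θ) (withAction (π θ) (PMF.pure s)) k).map Prod.fst) (visitPMF M (π θ))
  rw [expect_pairLaw_fst h.bdd, expect_pure] at h2
  exact h2.trans (mul_le_mul_of_nonneg_left h1 h.nonneg)

/-- At t = 1 the chain is still the point mass at s, so mixing gives μ(s) ≥ 1 - σρ for every s. A
probability on an infinite set has no positive lower bound on its atoms. -/
theorem MixingAssumption.one_le [Infinite S] (hmix : MixingAssumption M π σ ρ) : 1 ≤ σ * ρ := by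
  classical
  by_contra! hlt
  have hs : ∀ s, 1 - σ * ρ ≤ (visitPMF M (π 0) s).toReal := fun s => by
    have ho : OscLE (fun s' : S => if s' = s then (1 : ℝ) else 0) 1 := fun x y => by
      dsimp only
      split_ifs <;> norm_num
    have h1 := hmix.abs_iterate_sub_le ho 0 0 s
    have h2 : expect (visitPMF M (π 0)) (fun s' : S => if s' = s then (1 : ℝ) else 0)
        = (visitPMF M (π 0) s).toReal := by
      rw [expect, tsum_eq_single s fun y hy => by simp [hy]]
      simp
    rw [h2] at h1
    simp only [Function.iterate_zero, id_eq, if_true, zero_add, pow_one, one_mul] at h1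
    linarith [(abs_le.1 h1).2]
  have ht := (summable_toReal (visitPMF M (π 0))).tendsto_cofinite_zero
  have := ge_of_tendsto' ht hs
  linarith

/-- A bound for the contraction coefficient of `k` steps of a uniformly mixing chain. -/
def mixCoeff (σ ρ : ℝ) (k : ℕ) : ℝ := min 1 (2 * (σ * ρ ^ (k + 1)))

theorem MixingAssumption.oscLE_iterate [Nonempty S] (hmix : MixingAssumption M π σ ρ)
    (h : OscLE f c) (θ : EuclideanSpace ℝ (Fin d)) (k : ℕ) :
    OscLE ((kop M.restart (π θ))^[k] f) (c * mixCoeff σ ρ k) := by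
  intro x y
  rw [mixCoeff, mul_min_of_nonneg _ _ h.nonneg, mul_one]
  refine le_min (h.kop_iterate k x y) ?_
  have hx := (abs_le.1 (hmix.abs_iterate_sub_le h θ k x)).2
  have hy := (abs_le.1 (hmix.abs_iterate_sub_le h θ k y)).1
  linarith

/-- With N = ⌊log_ρ σ⁻¹⌋, the first N terms are at most 1. Since σρ^(N+1) ≤ 1, the later ones are at
most 2ρ^k. The total N + 2/(1 - ρ) is below 2(N + 1/(1 - ρ)) = 2(X - 2). -/
theorem sum_mixCoeff_le (hρ0 : 0 < ρ) (hρ1 : ρ < 1) (hσρ : 1 ≤ σ * ρ) (n : ℕ) :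
    ∑ k ∈ Finset.range n, mixCoeff σ ρ k ≤ 2 * (mixConst σ ρ - 2) := by
  have hσ : 0 < σ := pos_of_mul_pos_left (one_pos.trans_le hσρ) hρ0.le
  have hlog : Real.log ρ < 0 := Real.log_neg hρ0 hρ1
  have hK : 0 ≤ Real.logb ρ σ⁻¹ := by
    rw [Real.logb, Real.log_inv]
    refine div_nonneg_of_nonpos (neg_nonpos.2 (Real.log_nonneg ?_)) hlog.le
    nlinarith
  set N := ⌊Real.logb ρ σ⁻¹⌋₊ with hN
  have hfl : ((⌊Real.logb ρ σ⁻¹⌋ : ℤ) : ℝ) = N := by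
    rw [hN, ← Int.floor_toNat]
    exact_mod_cast (Int.toNat_of_nonneg (Int.floor_nonneg.2 hK)).symm
  have hN1 : σ * ρ ^ (N + 1) ≤ 1 := by
    have h1 : Real.logb ρ σ⁻¹ ≤ ((N + 1 : ℕ) : ℝ) := by
      push_cast; exact (Nat.lt_floor_add_one _).le
    have h2 := Real.rpow_le_rpow_of_exponent_ge hρ0 hρ1.le h1
    rw [Real.rpow_natCast, Real.rpow_logb hρ0 hρ1.ne (inv_pos.2 hσ)] at h2
    calc σ * ρ ^ (N + 1) ≤ σ * σ⁻¹ := mul_le_mul_of_nonneg_left h2 hσ.le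
      _ = 1 := mul_inv_cancel₀ hσ.ne'
  have hpos : ∀ k, 0 ≤ mixCoeff σ ρ k := fun k => le_min zero_le_one (by positivity)
  have h1 : ∑ k ∈ Finset.range N, mixCoeff σ ρ k ≤ N := by
    refine (Finset.sum_le_card_nsmul _ _ 1 fun k _ => min_le_left _ _).trans_eq ?_
    simp
  have h2 : ∑ k ∈ Finset.range n, mixCoeff σ ρ (N + k) ≤ 2 * (1 / (1 - ρ)) := by
    calc _ ≤ ∑ k ∈ Finset.range n, 2 * ρ ^ k := Finset.sum_le_sum fun k _ => by
            refine (min_le_right _ _).trans (mul_le_mul_of_nonneg_left ?_ zero_le_two)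
            rw [show N + k + 1 = N + 1 + k by ring, pow_add, ← mul_assoc]
            exact mul_le_of_le_one_left (pow_nonneg hρ0.le k) hN1
      _ = 2 * ∑ k ∈ Finset.range n, ρ ^ k := (Finset.mul_sum _ _ _).symm
      _ ≤ 2 * (1 / (1 - ρ)) := by
            refine mul_le_mul_of_nonneg_left ?_ zero_le_two
            rw [one_div, ← tsum_geometric_of_lt_one hρ0.le hρ1]
            exact (summable_geometric_of_lt_one hρ0.le hρ1).sum_le_tsum _
              fun k _ => pow_nonneg hρ0.le k
  have h3 : ∑ k ∈ Finset.range n, mixCoeff σ ρ k ≤ ∑ k ∈ Finset.range (N + n), mixCoeff σ ρ k :=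
    Finset.sum_le_sum_of_subset_of_nonneg (Finset.range_mono (Nat.le_add_left n N))
      fun k _ _ => hpos k
  rw [Finset.sum_range_add] at h3
  have hN0 : (0 : ℝ) ≤ N := N.cast_nonneg
  rw [mixConst, Int.cast_add, hfl, Int.cast_one]
  linarith

theorem four_le_mixConst (hρ0 : 0 < ρ) (hρ1 : ρ < 1) (hσρ : 1 ≤ σ * ρ) : 4 ≤ mixConst σ ρ := by
  have hσ : 0 < σ := pos_of_mul_pos_left (one_pos.trans_le hσρ) hρ0.le
  have hK : 1 ≤ Real.logb ρ σ⁻¹ := by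
    rw [Real.le_logb_iff_rpow_le_of_base_lt_one hρ0 hρ1 (inv_pos.2 hσ), Real.rpow_one,
      inv_le_iff_one_le_mul₀ hσ, mul_comm]
    exact hσρ
  have h1 : (1 : ℝ) ≤ (⌊Real.logb ρ σ⁻¹⌋ : ℤ) := by exact_mod_cast Int.le_floor.2 (by simpa using hK)
  have h2 : 1 ≤ 1 / (1 - ρ) := by rw [one_le_div (by linarith)]; linarith
  rw [mixConst, Int.cast_add, Int.cast_one]
  linarith

theorem tendsto_geometric_tail (hρ0 : 0 < ρ) (hρ1 : ρ < 1) (c σ : ℝ) :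
    Filter.Tendsto (fun n : ℕ => c * (σ * ρ ^ (n + 1))) Filter.atTop (nhds 0) := by
  have h := (tendsto_pow_atTop_nhds_zero_of_lt_one hρ0.le hρ1).comp (Filter.tendsto_add_atTop_nat 1)
  simpa using (h.const_mul σ).const_mul c

theorem kop_iterate_sub {tr : S → A → PMF S} {pol : S → PMF A} {g : S → ℝ} (hf : Bdd f)
    (hg : Bdd g) (n : ℕ) (s : S) :
    (kop tr pol)^[n] (fun s => f s - g s) s = (kop tr pol)^[n] f s - (kop tr pol)^[n] g s := by
  induction n generalizing f g with
  | zero => rfl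
  | succ n ih =>
    simp only [Function.iterate_succ_apply]
    rw [← ih hf.kop hg.kop]
    exact congrArg (fun F => (kop tr pol)^[n] F s) (funext (kop_sub hf hg))

/-- Solutions of the Poisson equation of a uniformly mixing chain have controlled oscillation. -/
theorem MixingAssumption.oscLE_of_sub_kop [Infinite S] (hmix : MixingAssumption M π σ ρ)
    (hρ0 : 0 < ρ) (hρ1 : ρ < 1) (hf : Bdd f)
    (h : OscLE (fun s => f s - kop M.restart (π θ) f s) c) :
    OscLE f (c * (2 * (mixConst σ ρ - 2))) := by
  intro x y
  obtain ⟨C, hC⟩ := hf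
  have ho := oscLE_of_abs_le hC
  set e := fun s => f s - kop M.restart (π θ) f s
  -- Telescoping inverts I - K: the summands K^k e contract by `mixCoeff`, and the remainder K^n f
  -- becomes constant as n → ∞, so it drops out of the oscillation.
  have htel : ∀ n z, f z - (kop M.restart (π θ))^[n] f z
      = ∑ k ∈ Finset.range n, (kop M.restart (π θ))^[k] e z := fun n z => by
    refine (Finset.sum_range_sub' (fun k => (kop M.restart (π θ))^[k] f z) n).symm.trans ?_
    exact Finset.sum_congr rfl fun k _ => (kop_iterate_sub ⟨C, hC⟩ (Bdd.kop ⟨C, hC⟩) k z).symm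
  have hn : ∀ n : ℕ, f x - f y - c * (2 * (mixConst σ ρ - 2))
      ≤ 2 * (2 * C) * (σ * ρ ^ (n + 1)) := fun n => by
    have h1 : ∑ k ∈ Finset.range n, (kop M.restart (π θ))^[k] e x
        - ∑ k ∈ Finset.range n, (kop M.restart (π θ))^[k] e y
        ≤ c * (2 * (mixConst σ ρ - 2)) := by
      rw [← Finset.sum_sub_distrib]
      refine (Finset.sum_le_sum fun k _ => hmix.oscLE_iterate h θ k x y).trans ?_
      rw [← Finset.mul_sum]
      exact mul_le_mul_of_nonneg_left (sum_mixCoeff_le hρ0 hρ1 hmix.one_le n) h.nonneg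
    have hx := (abs_le.1 (hmix.abs_iterate_sub_le ho θ n x)).2
    have hy := (abs_le.1 (hmix.abs_iterate_sub_le ho θ n y)).1
    have hfx := htel n x
    have hfy := htel n y
    linarith
  have := ge_of_tendsto' (tendsto_geometric_tail hρ0 hρ1 (2 * (2 * C)) σ) hn
  linarith

/-- The visitation distribution of a uniformly mixing chain depends continuously on the policy. -/
theorem MixingAssumption.abs_expect_visitPMF_sub_le [Infinite S] (hmix : MixingAssumption M π σ ρ)
    (hρ0 : 0 < ρ) (hρ1 : ρ < 1) {θ₁ θ₂ : EuclideanSpace ℝ (Fin d)} {b : ℝ} (hb0 : 0 ≤ b)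
    (hb : ∀ (F : S → ℝ) (c' : ℝ), OscLE F c' → ∀ s,
      |kop M.restart (π θ₁) F s - kop M.restart (π θ₂) F s| ≤ b * c')
    (h : OscLE f c) :
    |expect (visitPMF M (π θ₁)) f - expect (visitPMF M (π θ₂)) f|
      ≤ b * c * (2 * (mixConst σ ρ - 2)) := by
  have hf := h.bdd
  set μ := visitPMF M (π θ₂)
  set K := kop M.restart (π θ₁)
  -- μ is invariant for the kernel of θ₂, so applying K once more, with K the kernel of θ₁, changes
  -- the μ-mean only through the difference of the kernels, tested on the already contracted K^k f.
  -- As n → ∞, K^n f tends to its mean under the visitation law of θ₁.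
  have hstep : ∀ k, |expect μ (K^[k + 1] f) - expect μ (K^[k] f)| ≤ b * (c * mixCoeff σ ρ k) :=
    fun k => by
    have hk : Bdd (K^[k] f) := hf.kop_iterate k
    rw [Function.iterate_succ_apply', ← expect_visitPMF_kop_restart hk,
      ← expect_sub (hk.kop.on _) (hk.kop.on _)]
    exact abs_expect_le fun s _ => hb _ _ (hmix.oscLE_iterate h θ₁ k) s
  have hn : ∀ n : ℕ, |expect (visitPMF M (π θ₁)) f - expect μ f| - b * c * (2 * (mixConst σ ρ - 2))
      ≤ c * (σ * ρ ^ (n + 1)) := fun n => by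
    have h1 : |expect μ (K^[n] f) - expect μ f| ≤ b * c * (2 * (mixConst σ ρ - 2)) := by
      have := Finset.sum_range_sub (fun k => expect μ (K^[k] f)) n
      simp only [Function.iterate_zero, id_eq] at this
      rw [← this]
      refine (Finset.abs_sum_le_sum_abs _ _).trans
        ((Finset.sum_le_sum fun k _ => hstep k).trans ?_)
      rw [← Finset.mul_sum, ← Finset.mul_sum, ← mul_assoc]
      exact mul_le_mul_of_nonneg_left (sum_mixCoeff_le hρ0 hρ1 hmix.one_le n)
        (mul_nonneg hb0 h.nonneg)
    have h2 : |expect μ (K^[n] f) - expect (visitPMF M (π θ₁)) f| ≤ c * (σ * ρ ^ (n + 1)) := by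
      have hk : Bdd (K^[n] f) := hf.kop_iterate n
      have := expect_sub (p := μ) (hk.on _) (BddOn.const _ (expect (visitPMF M (π θ₁)) f))
      rw [expect_const] at this
      rw [← this]
      exact abs_expect_le fun s _ => hmix.abs_iterate_sub_le h θ₁ n s
    have h3 := abs_sub_le (expect (visitPMF M (π θ₁)) f) (expect μ (K^[n] f)) (expect μ f)
    rw [abs_sub_comm] at h2
    linarith
  have := ge_of_tendsto' (tendsto_geometric_tail hρ0 hρ1 c σ) hn
  linarith

end Mixing

/-! ### Gradients and Lipschitz bounds of the policy. -/

section Policy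

variable {S A : Type*} {d : ℕ} {π : EuclideanSpace ℝ (Fin d) → S → PMF A}
  {Lπ L cΘ : ℝ} {θ θ' : EuclideanSpace ℝ (Fin d)} {s : S} {a : A}

/-- The gradient `π_θ(a | s) ∇_θ log π_θ(a | s)` of the policy. -/
def gradPolicy (π : EuclideanSpace ℝ (Fin d) → S → PMF A) (θ : EuclideanSpace ℝ (Fin d))
    (s : S) (a : A) : EuclideanSpace ℝ (Fin d) := (π θ s a).toReal • score π θ s a

namespace PolicyAssumption

theorem cΘ_nonneg [Nonempty S] (hπ : PolicyAssumption π Lπ L cΘ) : 0 ≤ cΘ := by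
  obtain ⟨s⟩ := ‹Nonempty S›
  obtain ⟨a, -⟩ := (π 0 s).support_nonempty
  exact (norm_nonneg _).trans (hπ.score_bound 0 s a)

theorem hasGradientAt (hπ : PolicyAssumption π Lπ L cΘ) (θ : EuclideanSpace ℝ (Fin d)) (s : S)
    (a : A) : HasGradientAt (fun θ => (π θ s a).toReal) (gradPolicy π θ s a) θ := by
  have h1 := (hπ.differentiable s a θ).hasGradientAt
  have h0 := hπ.pos θ s a
  have h2 : HasGradientAt (fun θ => Real.log (π θ s a).toReal)
      ((π θ s a).toReal⁻¹ • gradient (fun θ => (π θ s a).toReal) θ) θ := by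
    rw [hasGradientAt_iff_hasFDerivAt] at h1 ⊢
    simpa using h1.log h0.ne'
  rw [gradPolicy, score, h2.gradient, smul_inv_smul₀ h0.ne']
  exact h1

theorem hasFDerivAt (hπ : PolicyAssumption π Lπ L cΘ) (θ : EuclideanSpace ℝ (Fin d)) (s : S)
    (a : A) : HasFDerivAt (fun θ => (π θ s a).toReal) (innerSL ℝ (gradPolicy π θ s a)) θ :=
  (hπ.hasGradientAt θ s a).hasFDerivAt

theorem norm_gradPolicy_le (hπ : PolicyAssumption π Lπ L cΘ) (hLπ : 0 ≤ Lπ)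
    (θ : EuclideanSpace ℝ (Fin d)) (s : S) (a : A) : ‖gradPolicy π θ s a‖ ≤ Lπ := by
  have hl : LipschitzWith ⟨Lπ, hLπ⟩ fun θ => (π θ s a).toReal :=
    LipschitzWith.of_dist_le_mul fun x y => by
      rw [Real.dist_eq, dist_eq_norm]
      exact hπ.policy_lipschitz x y s a
  have := (hπ.hasFDerivAt θ s a).le_of_lipschitz hl
  rwa [innerSL_apply_norm] at this

theorem norm_gradPolicy_le_mul (hπ : PolicyAssumption π Lπ L cΘ) (θ : EuclideanSpace ℝ (Fin d))
    (s : S) (a : A) : ‖gradPolicy π θ s a‖ ≤ (π θ s a).toReal * cΘ := by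
  rw [gradPolicy, norm_smul, Real.norm_eq_abs, abs_of_nonneg ENNReal.toReal_nonneg]
  exact mul_le_mul_of_nonneg_left (hπ.score_bound θ s a) ENNReal.toReal_nonneg

theorem norm_gradPolicy_sub_le (hπ : PolicyAssumption π Lπ L cΘ)
    (θ θ' : EuclideanSpace ℝ (Fin d)) (s : S) (a : A) :
    ‖gradPolicy π θ s a - gradPolicy π θ' s a‖
      ≤ |(π θ s a).toReal - (π θ' s a).toReal| * cΘ + (π θ' s a).toReal * (L * ‖θ - θ'‖) := by
  have h : gradPolicy π θ s a - gradPolicy π θ' s a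
      = ((π θ s a).toReal - (π θ' s a).toReal) • score π θ s a
        + (π θ' s a).toReal • (score π θ s a - score π θ' s a) := by
    simp only [gradPolicy, sub_smul, smul_sub]; abel
  rw [h]
  refine (norm_add_le _ _).trans (add_le_add ?_ ?_)
  · rw [norm_smul, Real.norm_eq_abs]
    exact mul_le_mul_of_nonneg_left (hπ.score_bound θ s a) (abs_nonneg _)
  · rw [norm_smul, Real.norm_eq_abs, abs_of_nonneg ENNReal.toReal_nonneg]
    exact mul_le_mul_of_nonneg_left (hπ.score_lipschitz θ θ' s a) ENNReal.toReal_nonneg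

theorem norm_gradPolicy_sub_le' [Nonempty S] (hπ : PolicyAssumption π Lπ L cΘ) (hL : 0 ≤ L)
    (θ θ' : EuclideanSpace ℝ (Fin d)) (s : S) (a : A) :
    ‖gradPolicy π θ s a - gradPolicy π θ' s a‖ ≤ (Lπ * cΘ + L) * ‖θ - θ'‖ := by
  refine (hπ.norm_gradPolicy_sub_le θ θ' s a).trans ?_
  have h1 := mul_le_mul_of_nonneg_right (hπ.policy_lipschitz θ θ' s a) hπ.cΘ_nonneg
  have h2 := mul_le_of_le_one_left (mul_nonneg hL (norm_nonneg (θ - θ'))) (toReal_le_one (π θ' s) a)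
  linarith

/-- The derivative is Lipschitz, so on the closed ball of radius ‖θ' - θ‖ about θ it stays within a
multiple of that radius of its value at θ; the mean value inequality on this convex set gives the
remainder. -/
theorem abs_taylor_le [Nonempty S] (hπ : PolicyAssumption π Lπ L cΘ) (hLπ : 0 ≤ Lπ) (hL : 0 ≤ L)
    (θ θ' : EuclideanSpace ℝ (Fin d)) (s : S) (a : A) :
    |(π θ' s a).toReal - (π θ s a).toReal - ⟪gradPolicy π θ s a, θ' - θ⟫|
      ≤ (Lπ * cΘ + L) * ‖θ' - θ‖ ^ 2 := by
  have h0 : 0 ≤ Lπ * cΘ + L := add_nonneg (mul_nonneg hLπ hπ.cΘ_nonneg) hL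
  have h := (convex_closedBall θ ‖θ' - θ‖).norm_image_sub_le_of_norm_hasFDerivWithin_le' (𝕜 := ℝ)
    (f := fun θ => (π θ s a).toReal) (f' := fun θ => innerSL ℝ (gradPolicy π θ s a))
    (φ := innerSL ℝ (gradPolicy π θ s a)) (C := (Lπ * cΘ + L) * ‖θ' - θ‖) (x := θ) (y := θ')
    (fun x _ => (hπ.hasFDerivAt x s a).hasFDerivWithinAt) (fun x hx => by
      rw [← map_sub, innerSL_apply_norm]
      refine (hπ.norm_gradPolicy_sub_le' hL x θ s a).trans (mul_le_mul_of_nonneg_left ?_ h0)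
      rwa [mem_closedBall_iff_norm] at hx)
    (Metric.mem_closedBall_self (norm_nonneg _)) (by simp [dist_eq_norm])
  rw [Real.norm_eq_abs, innerSL_apply_apply] at h
  exact h.trans_eq (by ring)

variable [Fintype A]

theorem sum_gradPolicy (hπ : PolicyAssumption π Lπ L cΘ) (θ : EuclideanSpace ℝ (Fin d)) (s : S) :
    ∑ a, gradPolicy π θ s a = 0 := by
  have h1 := HasFDerivAt.fun_sum fun a (_ : a ∈ Finset.univ) => hπ.hasFDerivAt θ s a
  simp only [sum_toReal] at h1
  have h2 := h1.unique (hasFDerivAt_const (1 : ℝ) θ)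
  rw [← map_sum] at h2
  rw [← norm_eq_zero, ← innerSL_apply_norm (𝕜 := ℝ), h2, norm_zero]

theorem abs_sum_sub_mul_le_card (hπ : PolicyAssumption π Lπ L cΘ) {f : A → ℝ} {c : ℝ}
    (hf : ∀ a, |f a| ≤ c) (θ θ' : EuclideanSpace ℝ (Fin d)) (s : S) :
    ∑ a, |(π θ s a).toReal - (π θ' s a).toReal| * |f a|
      ≤ Fintype.card A * Lπ * ‖θ - θ'‖ * c := by
  refine (Finset.sum_le_sum fun a _ => mul_le_mul (hπ.policy_lipschitz θ θ' s a) (hf a)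
    (abs_nonneg _) ((abs_nonneg _).trans (hπ.policy_lipschitz θ θ' s a))).trans_eq ?_
  rw [Finset.sum_const, Finset.card_univ, nsmul_eq_mul]
  ring

/-- The mean value inequality is applied to θ ↦ ∑ π_θ(a|s) f(a), whose gradient is the π_θ-mean of f
times the score. Averaging avoids the factor |A| that the termwise bound has. -/
theorem abs_sum_sub_mul_le (hπ : PolicyAssumption π Lπ L cΘ) {f : A → ℝ} {c : ℝ}
    (hf : ∀ a, |f a| ≤ c) (θ θ' : EuclideanSpace ℝ (Fin d)) (s : S) :
    |∑ a, ((π θ s a).toReal - (π θ' s a).toReal) * f a| ≤ cΘ * c * ‖θ - θ'‖ := by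
  have h := convex_univ.norm_image_sub_le_of_norm_hasFDerivWithin_le (𝕜 := ℝ)
    (f := fun θ => ∑ a, (π θ s a).toReal * f a)
    (f' := fun θ => ∑ a, f a • innerSL ℝ (gradPolicy π θ s a)) (C := cΘ * c) (x := θ') (y := θ)
    (fun x _ => (HasFDerivAt.fun_sum fun a (_ : a ∈ Finset.univ) =>
      (hπ.hasFDerivAt x s a).mul_const (f a)).hasFDerivWithinAt) (fun x _ => by
        refine (norm_sum_le _ _).trans ?_
        calc _ ≤ ∑ a, (π x s a).toReal * (cΘ * c) := Finset.sum_le_sum fun a _ => by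
                rw [norm_smul, innerSL_apply_norm, Real.norm_eq_abs]
                calc _ ≤ c * ((π x s a).toReal * cΘ) := mul_le_mul (hf a)
                        (hπ.norm_gradPolicy_le_mul x s a) (norm_nonneg _)
                        ((abs_nonneg _).trans (hf a))
                  _ = _ := by ring
          _ = cΘ * c := by rw [← Finset.sum_mul, sum_toReal, one_mul])
    (Set.mem_univ _) (Set.mem_univ _)
  rw [Real.norm_eq_abs, ← Finset.sum_sub_distrib] at h
  simpa only [sub_mul] using h

theorem sum_sub_mul_sub_const (f : A → ℝ) (m : ℝ) (θ θ' : EuclideanSpace ℝ (Fin d)) (s : S) :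
    ∑ a, ((π θ s a).toReal - (π θ' s a).toReal) * (f a - m)
      = ∑ a, ((π θ s a).toReal - (π θ' s a).toReal) * f a := by
  simp only [mul_sub, Finset.sum_sub_distrib, ← Finset.sum_mul, sum_toReal]
  ring

/-- Differences of two probability vectors sum to zero, so f can be centred, which gains the factor
1/2. -/
theorem abs_sum_sub_mul_le_osc (hπ : PolicyAssumption π Lπ L cΘ) {f : A → ℝ} {c : ℝ}
    (hf : OscLE f c) (θ θ' : EuclideanSpace ℝ (Fin d)) (s : S) :
    |∑ a, ((π θ s a).toReal - (π θ' s a).toReal) * f a|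
      ≤ Fintype.card A * Lπ / 2 * ‖θ - θ'‖ * c := by
  have hne : Nonempty A := ⟨(π θ s).support_nonempty.choose⟩
  obtain ⟨m, hm⟩ := hf.exists_center
  rw [← sum_sub_mul_sub_const f m]
  refine (Finset.abs_sum_le_sum_abs _ _).trans ?_
  simp only [abs_mul]
  exact (hπ.abs_sum_sub_mul_le_card hm θ θ' s).trans_eq (by ring)

theorem abs_kop_sub_kop_le (hπ : PolicyAssumption π Lπ L cΘ) {tr : S → A → PMF S} {F : S → ℝ}
    {c : ℝ} (hF : OscLE F c) (θ θ' : EuclideanSpace ℝ (Fin d)) (s : S) :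
    |kop tr (π θ) F s - kop tr (π θ') F s| ≤ Fintype.card A * Lπ / 2 * ‖θ - θ'‖ * c := by
  have hne : Nonempty S := ⟨s⟩
  rw [kop, kop, expect_fintype, expect_fintype, ← Finset.sum_sub_distrib]
  simp only [← sub_mul]
  exact hπ.abs_sum_sub_mul_le_osc (hF.expect _) θ θ' s

end PolicyAssumption

end Policy

/-- Tested at u = x. It reduces vector bounds to scalar expectations, since `expect` is real-valued.
-/
theorem norm_le_of_inner_le {E : Type*} [NormedAddCommGroup E] [InnerProductSpace ℝ E] {x : E}
    {C : ℝ} (hC : 0 ≤ C) (h : ∀ u, ⟪x, u⟫ ≤ C * ‖u‖) : ‖x‖ ≤ C := by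
  rcases eq_or_ne x 0 with rfl | hx
  · simpa using hC
  · have := h x
    rw [real_inner_self_eq_norm_sq, sq] at this
    exact le_of_mul_le_mul_right this (norm_pos_iff.2 hx)

/-! ### Performance difference, Lipschitz gradient, differentiability of the objective. -/

section Gradient

variable {S A : Type*} [Fintype A] {d : ℕ} {M : MDP S A}
  {π : EuclideanSpace ℝ (Fin d) → S → PMF A} {Rmax Lπ L cΘ σ ρ : ℝ}
  {θ θ' : EuclideanSpace ℝ (Fin d)} {s : S}

/-- The bound `γ Rmax / (1 - γ)` of the value functions. -/
def valueBound (M : MDP S A) (Rmax : ℝ) : ℝ := M.γ * Rmax / (1 - M.γ)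

/-- The conditional mean `∑_a π_θ(a | s) Q^{π_θ}(s, a) ∇_θ log π_θ(a | s)` of the policy gradient
estimator at the state `s`. -/
def stateGrad (M : MDP S A) (π : EuclideanSpace ℝ (Fin d) → S → PMF A)
    (θ : EuclideanSpace ℝ (Fin d)) (s : S) : EuclideanSpace ℝ (Fin d) :=
  ∑ a, qValue M (π θ) s a • gradPolicy π θ s a

omit [Fintype A] in
theorem reward_bound_nonneg [Nonempty S] (π : EuclideanSpace ℝ (Fin d) → S → PMF A)
    (hR : ∀ s a, 0 ≤ M.R s a ∧ M.R s a ≤ Rmax) : 0 ≤ Rmax := by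
  obtain ⟨s⟩ := ‹Nonempty S›
  obtain ⟨a, -⟩ := (π 0 s).support_nonempty
  exact (hR s a).1.trans (hR s a).2

omit [Fintype A] in
theorem valueBound_nonneg [Nonempty S] (π : EuclideanSpace ℝ (Fin d) → S → PMF A)
    (hR : ∀ s a, 0 ≤ M.R s a ∧ M.R s a ≤ Rmax) : 0 ≤ valueBound M Rmax :=
  div_nonneg (mul_nonneg M.γ_pos.le (reward_bound_nonneg π hR)) M.sub_pos.le

omit [Fintype A] in
theorem abs_qValue_sub_le (hR : ∀ s a, 0 ≤ M.R s a ∧ M.R s a ≤ Rmax) (pol : S → PMF A) (s : S)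
    (a : A) : |qValue M pol s a - valueBound M Rmax / 2| ≤ valueBound M Rmax / 2 := by
  have := qValue_mem (pol := pol) hR s a
  rw [valueBound, abs_le]
  constructor <;> linarith [this.1, this.2]

variable (hπ : PolicyAssumption π Lπ L cΘ)

-- Baselines are free because the policy gradients sum to zero over the actions. Centring Q ∈ [0, B]
-- at B/2 then halves all bounds below.
include hπ in
theorem sum_sub_const_smul_gradPolicy (f : A → ℝ) (m : ℝ) (θ : EuclideanSpace ℝ (Fin d)) (s : S) :
    ∑ a, (f a - m) • gradPolicy π θ s a = ∑ a, f a • gradPolicy π θ s a := by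
  simp only [sub_smul, Finset.sum_sub_distrib, ← Finset.smul_sum, hπ.sum_gradPolicy, smul_zero,
    sub_zero]

include hπ in
theorem norm_sum_smul_gradPolicy_le {f : A → ℝ} {c : ℝ} (hf : ∀ a, |f a| ≤ c)
    (θ : EuclideanSpace ℝ (Fin d)) (s : S) :
    ‖∑ a, f a • gradPolicy π θ s a‖ ≤ cΘ * c := by
  refine (norm_sum_le _ _).trans ?_
  calc _ ≤ ∑ a, (π θ s a).toReal * (cΘ * c) := Finset.sum_le_sum fun a _ => by
          rw [norm_smul, Real.norm_eq_abs]
          calc _ ≤ c * ((π θ s a).toReal * cΘ) := mul_le_mul (hf a)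
                  (hπ.norm_gradPolicy_le_mul θ s a) (norm_nonneg _) ((abs_nonneg _).trans (hf a))
            _ = _ := by ring
    _ = cΘ * c := by rw [← Finset.sum_mul, sum_toReal, one_mul]

include hπ in
theorem norm_sum_smul_gradPolicy_le_card (hLπ : 0 ≤ Lπ) {f : A → ℝ} {c : ℝ}
    (hf : ∀ a, |f a| ≤ c) (θ : EuclideanSpace ℝ (Fin d)) (s : S) :
    ‖∑ a, f a • gradPolicy π θ s a‖ ≤ Fintype.card A * Lπ * c := by
  refine (norm_sum_le _ _).trans ((Finset.sum_le_card_nsmul _ _ (c * Lπ) fun a _ => ?_).trans_eq ?_)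
  · rw [norm_smul, Real.norm_eq_abs]
    exact mul_le_mul (hf a) (hπ.norm_gradPolicy_le hLπ θ s a) (norm_nonneg _)
      ((abs_nonneg _).trans (hf a))
  · rw [Finset.card_univ, nsmul_eq_mul]; ring

include hπ in
theorem norm_stateGrad_le (hR : ∀ s a, 0 ≤ M.R s a ∧ M.R s a ≤ Rmax)
    (θ : EuclideanSpace ℝ (Fin d)) (s : S) :
    ‖stateGrad M π θ s‖ ≤ cΘ * (valueBound M Rmax / 2) := by
  rw [stateGrad, ← sum_sub_const_smul_gradPolicy hπ _ (valueBound M Rmax / 2)]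
  exact norm_sum_smul_gradPolicy_le hπ (abs_qValue_sub_le hR _ _) θ s

include hπ in
theorem norm_stateGrad_le_card (hLπ : 0 ≤ Lπ) (hR : ∀ s a, 0 ≤ M.R s a ∧ M.R s a ≤ Rmax)
    (θ : EuclideanSpace ℝ (Fin d)) (s : S) :
    ‖stateGrad M π θ s‖ ≤ Fintype.card A * Lπ * (valueBound M Rmax / 2) := by
  rw [stateGrad, ← sum_sub_const_smul_gradPolicy hπ _ (valueBound M Rmax / 2)]
  exact norm_sum_smul_gradPolicy_le_card hπ hLπ (abs_qValue_sub_le hR _ _) θ s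

include hπ in
theorem abs_inner_stateGrad_le (hR : ∀ s a, 0 ≤ M.R s a ∧ M.R s a ≤ Rmax)
    (θ u : EuclideanSpace ℝ (Fin d)) (s : S) :
    |⟪stateGrad M π θ s, u⟫| ≤ cΘ * (valueBound M Rmax / 2) * ‖u‖ :=
  (abs_real_inner_le_norm _ _).trans
    (mul_le_mul_of_nonneg_right (norm_stateGrad_le hπ hR θ s) (norm_nonneg _))

-- The policy gradient is the visitation mean of `stateGrad`, stated against a test vector u.
-- Summability of the vector series over pairs is what allows summing over the actions first.
include hπ in
theorem inner_policyGradient [Nonempty S] (hR : ∀ s a, 0 ≤ M.R s a ∧ M.R s a ≤ Rmax)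
    (θ u : EuclideanSpace ℝ (Fin d)) :
    ⟪policyGradient M π θ, u⟫ = expect (visitPMF M (π θ)) fun s => ⟪stateGrad M π θ s, u⟫ := by
  set μ := visitPMF M (π θ)
  have hB := valueBound_nonneg π hR
  have hc := hπ.cΘ_nonneg
  have hs0 : Summable fun x : S × A => (μ x.1).toReal * (π θ x.1 x.2).toReal := by
    refine (summable_prod_of_nonneg fun x =>
      mul_nonneg ENNReal.toReal_nonneg ENNReal.toReal_nonneg).2 ⟨fun s => ?_, ?_⟩
    · exact Summable.of_finite
    · simp only [tsum_mul_left, tsum_toReal, mul_one]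
      exact summable_toReal μ
  have hs : Summable fun x : S × A => (visitation M (π θ) x.1 * (π θ x.1 x.2).toReal) •
      (qValue M (π θ) x.1 x.2 • score π θ x.1 x.2) := by
    refine Summable.of_norm_bounded (hs0.mul_right (valueBound M Rmax * cΘ)) fun x => ?_
    rw [norm_smul, norm_smul, ← visitPMF_toReal, Real.norm_eq_abs, Real.norm_eq_abs,
      abs_of_nonneg (mul_nonneg ENNReal.toReal_nonneg ENNReal.toReal_nonneg),
      abs_of_nonneg (qValue_mem hR _ _).1]
    exact mul_le_mul_of_nonneg_left (mul_le_mul (qValue_mem hR _ _).2 (hπ.score_bound _ _ _)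
      (norm_nonneg _) hB) (mul_nonneg ENNReal.toReal_nonneg ENNReal.toReal_nonneg)
  have hi := (innerSL ℝ u).map_tsum hs
  rw [real_inner_comm, policyGradient, ← innerSL_apply_apply (𝕜 := ℝ), hi,
    ((innerSL ℝ u).summable hs).tsum_prod, expect]
  refine tsum_congr fun s => ?_
  rw [tsum_fintype, real_inner_comm, ← innerSL_apply_apply (𝕜 := ℝ), stateGrad, map_sum,
    Finset.mul_sum]
  refine Finset.sum_congr rfl fun a _ => ?_
  simp only [gradPolicy, map_smul, smul_eq_mul, ← visitPMF_toReal]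
  ring

include hπ in
theorem norm_policyGradient_le [Nonempty S] (hR : ∀ s a, 0 ≤ M.R s a ∧ M.R s a ≤ Rmax)
    (θ : EuclideanSpace ℝ (Fin d)) :
    ‖policyGradient M π θ‖ ≤ cΘ * (valueBound M Rmax / 2) := by
  have hB := valueBound_nonneg π hR
  have hc := hπ.cΘ_nonneg
  refine norm_le_of_inner_le (by positivity) fun u => ?_
  rw [inner_policyGradient hπ hR]
  exact (le_abs_self _).trans (abs_expect_le fun s _ => abs_inner_stateGrad_le hπ hR θ u s)

include hπ in
theorem norm_policyGradient_le_card [Nonempty S] (hLπ : 0 ≤ Lπ)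
    (hR : ∀ s a, 0 ≤ M.R s a ∧ M.R s a ≤ Rmax) (θ : EuclideanSpace ℝ (Fin d)) :
    ‖policyGradient M π θ‖ ≤ Fintype.card A * Lπ * (valueBound M Rmax / 2) := by
  have hB := valueBound_nonneg π hR
  refine norm_le_of_inner_le (by positivity) fun u => ?_
  rw [inner_policyGradient hπ hR]
  exact (le_abs_self _).trans (abs_expect_le fun s _ => (abs_real_inner_le_norm _ _).trans
    (mul_le_mul_of_nonneg_right (norm_stateGrad_le_card hπ hLπ hR θ s) (norm_nonneg _)))

/-- The advantage of the policy `π_θ` over `π_θ'`, measured by the value function of `π_θ'`. -/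
def advantage (M : MDP S A) (π : EuclideanSpace ℝ (Fin d) → S → PMF A)
    (θ θ' : EuclideanSpace ℝ (Fin d)) (s : S) : ℝ :=
  ∑ a, ((π θ s a).toReal - (π θ' s a).toReal) * qValue M (π θ') s a

include hπ in
theorem abs_advantage_le (hR : ∀ s a, 0 ≤ M.R s a ∧ M.R s a ≤ Rmax)
    (θ θ' : EuclideanSpace ℝ (Fin d)) (s : S) :
    |advantage M π θ θ' s| ≤ cΘ * (valueBound M Rmax / 2) * ‖θ - θ'‖ := by
  rw [advantage, ← PolicyAssumption.sum_sub_mul_sub_const _ (valueBound M Rmax / 2)]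
  exact hπ.abs_sum_sub_mul_le (abs_qValue_sub_le hR _ _) θ θ' s

include hπ in
theorem abs_advantage_le_card (hR : ∀ s a, 0 ≤ M.R s a ∧ M.R s a ≤ Rmax)
    (θ θ' : EuclideanSpace ℝ (Fin d)) (s : S) :
    |advantage M π θ θ' s|
      ≤ Fintype.card A * Lπ / 2 * ‖θ - θ'‖ * (2 * (valueBound M Rmax / 2)) :=
  hπ.abs_sum_sub_mul_le_osc (oscLE_of_abs_sub_le (abs_qValue_sub_le hR _ _)) θ θ' s

/-- Both Bellman equations are subtracted after inserting the mean of Q^{θ'} under the policy of θ.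
The difference of values solves a linear equation whose source is the advantage. -/
theorem value_sub_value (hR : ∀ s a, 0 ≤ M.R s a ∧ M.R s a ≤ Rmax)
    (θ θ' : EuclideanSpace ℝ (Fin d)) (s : S) :
    value M (π θ) s - value M (π θ') s = advantage M π θ θ' s
      + M.γ * kop M.P (π θ) (fun s => value M (π θ) s - value M (π θ') s) s := by
  have h1 : ∑ a, (π θ s a).toReal * qValue M (π θ') s a
      = M.γ * meanReward M (π θ) s + M.γ * kop M.P (π θ) (value M (π θ')) s := by
    rw [meanReward, kop, expect_fintype, expect_fintype, Finset.mul_sum, Finset.mul_sum,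
      ← Finset.sum_add_distrib]
    refine Finset.sum_congr rfl fun a _ => ?_
    rw [qValue_eq hR]; ring
  have h2 := value_eq_expect_qValue (pol := π θ') hR s
  rw [expect_fintype] at h2
  simp only [advantage, sub_mul, Finset.sum_sub_distrib]
  rw [kop_sub (bdd_value hR) (bdd_value hR), ← h2, h1]
  have := value_eq (pol := π θ) hR s
  linarith

/-- Performance difference identity: the equation for V_θ - V_θ' is averaged over μ_θ, and the flow
equation turns (I - γP) under μ_θ into (1 - γ) times the mean under ζ. -/
theorem objective_sub_objective (hR : ∀ s a, 0 ≤ M.R s a ∧ M.R s a ≤ Rmax)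
    (θ θ' : EuclideanSpace ℝ (Fin d)) :
    objective M π θ - objective M π θ' = expect (visitPMF M (π θ)) (advantage M π θ θ') := by
  have hb := (bdd_value (pol := π θ) hR).sub (bdd_value (pol := π θ') hR)
  have h1 := expect_visitPMF_eq (M := M) (pol := π θ) hb
  rw [objective_eq hR, objective_eq hR, ← mul_sub,
    ← expect_sub ((bdd_value hR).on _) ((bdd_value hR).on _)]
  have h2 : expect (visitPMF M (π θ)) (advantage M π θ θ')
      = expect (visitPMF M (π θ)) (fun s => (value M (π θ) s - value M (π θ') s)
        - M.γ * kop M.P (π θ) (fun s => value M (π θ) s - value M (π θ') s) s) :=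
    expect_congr fun s _ => by
      have := value_sub_value (π := π) hR θ θ' s
      linarith
  rw [h2, expect_sub (hb.on _) ((hb.kop.const_mul _).on _), expect_const_mul]
  linarith

variable [Infinite S] (hmix : MixingAssumption M π σ ρ) (hρ0 : 0 < ρ) (hρ1 : ρ < 1)

-- Under the restart kernel, D = V_θ - V_θ' satisfies D - KD = advantage + constant. The Poisson
-- bound applies and introduces no further factor 1/(1 - γ).
include hπ hmix hρ0 hρ1 in
theorem oscLE_value_sub (hR : ∀ s a, 0 ≤ M.R s a ∧ M.R s a ≤ Rmax)
    (θ θ' : EuclideanSpace ℝ (Fin d)) :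
    OscLE (fun s => value M (π θ) s - value M (π θ') s)
      (2 * (cΘ * (valueBound M Rmax / 2) * ‖θ - θ'‖) * (2 * (mixConst σ ρ - 2))) := by
  have hb := (bdd_value (pol := π θ) hR).sub (bdd_value (pol := π θ') hR)
  refine hmix.oscLE_of_sub_kop (θ := θ) hρ0 hρ1 hb fun x y => ?_
  have hx := value_sub_value (π := π) hR θ θ' x
  have hy := value_sub_value (π := π) hR θ θ' y
  dsimp only
  rw [kop_restart hb, kop_restart hb]
  linarith [oscLE_of_abs_le (abs_advantage_le hπ hR θ θ') x y]

include hπ hmix hρ0 hρ1 in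
theorem abs_expect_visitPMF_sub_le (hLπ : 0 ≤ Lπ) {f : S → ℝ} {c : ℝ} (hf : OscLE f c)
    (θ θ' : EuclideanSpace ℝ (Fin d)) :
    |expect (visitPMF M (π θ)) f - expect (visitPMF M (π θ')) f|
      ≤ Fintype.card A * Lπ / 2 * ‖θ - θ'‖ * c * (2 * (mixConst σ ρ - 2)) :=
  hmix.abs_expect_visitPMF_sub_le hρ0 hρ1 (by positivity)
    (fun _ _ hF s => hπ.abs_kop_sub_kop_le hF θ θ' s) hf

/-- A Lipschitz constant of `stateGrad`. -/
def stateGradLip (M : MDP S A) (Rmax Lπ L cΘ σ ρ : ℝ) : ℝ :=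
  valueBound M Rmax / 2 * (Fintype.card A * Lπ * cΘ * (1 + 2 * (mixConst σ ρ - 2)) + L)

/-- A Lipschitz constant of the policy gradient. -/
def gradLip (M : MDP S A) (Rmax Lπ L cΘ σ ρ : ℝ) : ℝ :=
  valueBound M Rmax / 2 * (Fintype.card A * Lπ * cΘ * (1 + 4 * (mixConst σ ρ - 2)) + L)

include hπ hmix hρ0 hρ1 in
theorem norm_stateGrad_sub_le (hLπ : 0 ≤ Lπ) (hR : ∀ s a, 0 ≤ M.R s a ∧ M.R s a ≤ Rmax)
    (θ θ' : EuclideanSpace ℝ (Fin d)) (s : S) :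
    ‖stateGrad M π θ s - stateGrad M π θ' s‖
      ≤ stateGradLip M Rmax Lπ L cΘ σ ρ * ‖θ - θ'‖ := by
  have hB := valueBound_nonneg π hR
  have hc := hπ.cΘ_nonneg
  set B := valueBound M Rmax
  set W := 2 * (mixConst σ ρ - 2) with hW
  have hne : Nonempty A := ⟨(π θ s).support_nonempty.choose⟩
  have hV := oscLE_value_sub hπ hmix hρ0 hρ1 hR θ θ'
  have hV0 := hV.nonneg
  have hQ : OscLE (fun a => qValue M (π θ) s a - qValue M (π θ') s a)
      (2 * (cΘ * (B / 2) * ‖θ - θ'‖) * W) := fun a a' => by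
    have h1 := hV.expect_sub_expect_le (M.P s a) (M.P s a')
    have h2 := mul_le_mul_of_nonneg_left h1 M.γ_pos.le
    have h3 := mul_le_of_le_one_left hV0 M.γ_lt_one.le
    simp only [expect_sub ((bdd_value hR).on _) ((bdd_value hR).on _)] at h2
    simp only [qValue_eq hR]
    linarith
  obtain ⟨m, hm⟩ := hQ.exists_center
  -- The product rule, with the change of Q centred at m and Q itself centred at B/2. The change of
  -- Q is γ times a mean of V_θ - V_θ', plus nothing from the rewards, so its oscillation over
  -- actions is controlled.
  have hdec : stateGrad M π θ s - stateGrad M π θ' s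
      = ∑ a, (qValue M (π θ) s a - qValue M (π θ') s a - m) • gradPolicy π θ s a
        + ∑ a, (qValue M (π θ') s a - B / 2) • (gradPolicy π θ s a - gradPolicy π θ' s a) := by
    rw [sum_sub_const_smul_gradPolicy hπ]
    simp only [smul_sub, Finset.sum_sub_distrib, sum_sub_const_smul_gradPolicy hπ]
    simp only [sub_smul, Finset.sum_sub_distrib, stateGrad]
    abel
  have h1 := norm_sum_smul_gradPolicy_le_card hπ hLπ hm θ s
  have h2 : ‖∑ a, (qValue M (π θ') s a - B / 2) • (gradPolicy π θ s a - gradPolicy π θ' s a)‖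
      ≤ Fintype.card A * Lπ * ‖θ - θ'‖ * (B / 2) * cΘ + B / 2 * (L * ‖θ - θ'‖) := by
    have hq := abs_qValue_sub_le (M := M) hR (π θ') s
    refine (norm_sum_le _ _).trans ?_
    calc _ ≤ ∑ a, (|(π θ s a).toReal - (π θ' s a).toReal| * |B / 2| * cΘ
            + (π θ' s a).toReal * (B / 2 * (L * ‖θ - θ'‖))) := Finset.sum_le_sum fun a _ => by
            rw [norm_smul, Real.norm_eq_abs, abs_of_nonneg (by positivity : 0 ≤ B / 2)]
            refine (mul_le_mul (hq a) (hπ.norm_gradPolicy_sub_le θ θ' s a) (norm_nonneg _)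
              (by positivity)).trans_eq (by ring)
      _ ≤ _ := by
            rw [Finset.sum_add_distrib, ← Finset.sum_mul,
              ← Finset.sum_mul _ fun a => (π θ' s a).toReal, sum_toReal, one_mul]
            exact add_le_add_left (mul_le_mul_of_nonneg_right (hπ.abs_sum_sub_mul_le_card
              (fun _ => (abs_of_nonneg (by positivity)).le) θ θ' s) hc) _
  rw [hdec]
  refine (norm_add_le _ _).trans ((add_le_add h1 h2).trans_eq ?_)
  rw [stateGradLip, ← hW]
  ring

include hπ hmix hρ0 hρ1 in
theorem norm_policyGradient_sub_le (hLπ : 0 ≤ Lπ) (hL : 0 ≤ L)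
    (hR : ∀ s a, 0 ≤ M.R s a ∧ M.R s a ≤ Rmax)
    (θ θ' : EuclideanSpace ℝ (Fin d)) :
    ‖policyGradient M π θ - policyGradient M π θ'‖
      ≤ gradLip M Rmax Lπ L cΘ σ ρ * ‖θ - θ'‖ := by
  have hB := valueBound_nonneg π hR
  have hc := hπ.cΘ_nonneg
  have hX := four_le_mixConst hρ0 hρ1 hmix.one_le
  have hb : ∀ θ u, Bdd fun s => ⟪stateGrad M π θ s, u⟫ := fun θ u =>
    ⟨_, abs_inner_stateGrad_le hπ hR θ u⟩
  have hg : 0 ≤ gradLip M Rmax Lπ L cΘ σ ρ := by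
    have : 0 ≤ mixConst σ ρ - 2 := by linarith
    unfold gradLip
    positivity
  refine norm_le_of_inner_le (mul_nonneg hg (norm_nonneg _)) fun u => ?_
  rw [inner_sub_left, inner_policyGradient hπ hR, inner_policyGradient hπ hR]
  have h1 := (abs_le.1 (abs_expect_visitPMF_sub_le hπ hmix hρ0 hρ1 hLπ
    (oscLE_of_abs_le (abs_inner_stateGrad_le hπ hR θ u)) θ θ')).2
  have h2 : expect (visitPMF M (π θ')) (fun s => ⟪stateGrad M π θ s, u⟫)
      - expect (visitPMF M (π θ')) (fun s => ⟪stateGrad M π θ' s, u⟫)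
      ≤ stateGradLip M Rmax Lπ L cΘ σ ρ * ‖θ - θ'‖ * ‖u‖ := by
    rw [← expect_sub ((hb θ u).on _) ((hb θ' u).on _)]
    refine expect_le (((hb θ u).sub (hb θ' u)).on _) fun s _ => ?_
    rw [← inner_sub_left]
    exact (real_inner_le_norm _ _).trans (mul_le_mul_of_nonneg_right
      (norm_stateGrad_sub_le hπ hmix hρ0 hρ1 hLπ hR θ θ' s) (norm_nonneg _))
  have h3 : gradLip M Rmax Lπ L cΘ σ ρ * ‖θ - θ'‖ * ‖u‖
      = stateGradLip M Rmax Lπ L cΘ σ ρ * ‖θ - θ'‖ * ‖u‖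
      + Fintype.card A * Lπ / 2 * ‖θ - θ'‖ * (2 * (cΘ * (valueBound M Rmax / 2) * ‖u‖))
        * (2 * (mixConst σ ρ - 2)) := by
    unfold gradLip stateGradLip
    ring
  linarith

include hπ hmix hρ0 hρ1 in
theorem hasGradientAt_objective (hLπ : 0 ≤ Lπ) (hL : 0 ≤ L)
    (hR : ∀ s a, 0 ≤ M.R s a ∧ M.R s a ≤ Rmax) (θ : EuclideanSpace ℝ (Fin d)) :
    HasGradientAt (objective M π) (policyGradient M π θ) θ := by
  have hB := valueBound_nonneg π hR
  set B := valueBound M Rmax with hBdef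
  set C₁ := (Fintype.card A * Lπ / 2) ^ 2 * (4 * (B / 2)) * (2 * (mixConst σ ρ - 2))
  set C₂ := Fintype.card A * ((Lπ * cΘ + L) * B)
  -- Two second-order errors: C₁ from averaging the O(‖θ' - θ‖) advantage over μ_θ instead of μ_θ',
  -- and C₂ from the Taylor remainder of the policy.
  have key : ∀ θ', |objective M π θ' - objective M π θ - ⟪policyGradient M π θ, θ' - θ⟫|
      ≤ (C₁ + C₂) * ‖θ' - θ‖ ^ 2 := fun θ' => by
    rw [objective_sub_objective hR, inner_policyGradient hπ hR]
    have ha := abs_advantage_le_card hπ hR θ' θ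
    have hba : Bdd (advantage M π θ' θ) := ⟨_, ha⟩
    have hbh : Bdd fun s => ⟪stateGrad M π θ s, θ' - θ⟫ :=
      ⟨_, abs_inner_stateGrad_le hπ hR θ (θ' - θ)⟩
    have h1 := abs_expect_visitPMF_sub_le hπ hmix hρ0 hρ1 hLπ (oscLE_of_abs_le ha) θ' θ
    have h2 : |expect (visitPMF M (π θ)) (advantage M π θ' θ)
        - expect (visitPMF M (π θ)) (fun s => ⟪stateGrad M π θ s, θ' - θ⟫)|
        ≤ C₂ * ‖θ' - θ‖ ^ 2 := by
      rw [← expect_sub (hba.on _) (hbh.on _)]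
      refine abs_expect_le fun s _ => ?_
      rw [advantage, stateGrad, sum_inner, ← Finset.sum_sub_distrib]
      refine (Finset.abs_sum_le_sum_abs _ _).trans ((Finset.sum_le_card_nsmul _ _
        ((Lπ * cΘ + L) * ‖θ' - θ‖ ^ 2 * B) fun a _ => ?_).trans_eq ?_)
      · rw [real_inner_smul_left, mul_comm (qValue M (π θ) s a), ← sub_mul, abs_mul]
        have hq := qValue_mem (pol := π θ) hR s a
        rw [abs_of_nonneg hq.1]
        exact mul_le_mul (hπ.abs_taylor_le hLπ hL θ θ' s a) hq.2 hq.1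
          ((abs_nonneg _).trans (hπ.abs_taylor_le hLπ hL θ θ' s a))
      · rw [Finset.card_univ, nsmul_eq_mul]
        ring
    have h3 := abs_sub_le (expect (visitPMF M (π θ')) (advantage M π θ' θ))
      (expect (visitPMF M (π θ)) (advantage M π θ' θ))
      (expect (visitPMF M (π θ)) fun s => ⟪stateGrad M π θ s, θ' - θ⟫)
    refine h3.trans ((add_le_add h1 h2).trans_eq ?_)
    simp only [C₁]
    ring
  rw [hasGradientAt_iff_hasFDerivAt, hasFDerivAt_iff_isLittleO]
  have hO : (fun θ' => objective M π θ' - objective M π θ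
      - (InnerProductSpace.toDual ℝ _ (policyGradient M π θ)) (θ' - θ))
      =O[nhds θ] fun θ' => ‖θ' - θ‖ ^ 2 := by
    refine Asymptotics.IsBigO.of_bound (C₁ + C₂) (Filter.Eventually.of_forall fun θ' => ?_)
    rw [InnerProductSpace.toDual_apply_apply, Real.norm_eq_abs, Real.norm_eq_abs,
      abs_of_nonneg (sq_nonneg ‖θ' - θ‖)]
    exact key θ'
  refine hO.trans_isLittleO ?_
  have ht : Filter.Tendsto (fun θ' : EuclideanSpace ℝ (Fin d) => θ' - θ) (nhds θ) (nhds 0) :=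
    Continuous.tendsto' (by fun_prop) _ _ (sub_self θ)
  exact (Asymptotics.isLittleO_norm_pow_id one_lt_two).comp_tendsto ht

include hπ hmix hρ0 hρ1 in
/-- The descent inequality for the smooth objective. -/
theorem objective_le (hLπ : 0 ≤ Lπ) (hL : 0 ≤ L) (hR : ∀ s a, 0 ≤ M.R s a ∧ M.R s a ≤ Rmax)
    (θ u : EuclideanSpace ℝ (Fin d)) :
    objective M π (θ + u) ≤ objective M π θ + ⟪policyGradient M π θ, u⟫
      + gradLip M Rmax Lπ L cΘ σ ρ / 2 * ‖u‖ ^ 2 := by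
  set β := gradLip M Rmax Lπ L cΘ σ ρ with hβ
  have hline : ∀ t : ℝ, HasDerivAt (fun t : ℝ => θ + t • u) u t := fun t => by
    simpa using ((hasDerivAt_id t).smul_const u).const_add θ
  -- Along the segment, J minus its quadratic upper model has nonpositive derivative on (0, 1), by
  -- the Lipschitz bound on the gradient; comparing t = 0 with t = 1 gives the inequality.
  have hd : ∀ t : ℝ, HasDerivAt (fun t : ℝ => objective M π (θ + t • u)
      - t * ⟪policyGradient M π θ, u⟫ - β / 2 * t ^ 2 * ‖u‖ ^ 2)
      (⟪policyGradient M π (θ + t • u), u⟫ - ⟪policyGradient M π θ, u⟫ - β * t * ‖u‖ ^ 2) t :=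
    fun t => by
    have h1 := (hasGradientAt_objective hπ hmix hρ0 hρ1 hLπ hL hR
      (θ + t • u)).hasFDerivAt.comp_hasDerivAt t (hline t)
    rw [InnerProductSpace.toDual_apply_apply] at h1
    have h2 := (hasDerivAt_id t).mul_const ⟪policyGradient M π θ, u⟫
    have h3 := ((hasDerivAt_pow 2 t).const_mul (β / 2)).mul_const (‖u‖ ^ 2)
    refine ((h1.sub h2).sub h3).congr_deriv ?_
    norm_num only
    ring
  have hanti := antitoneOn_of_deriv_nonpos (convex_Icc (0 : ℝ) 1)
    (fun t _ => (hd t).continuousAt.continuousWithinAt)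
    (fun t _ => (hd t).differentiableAt.differentiableWithinAt) (fun t ht => by
      rw [interior_Icc] at ht
      rw [(hd t).deriv, ← inner_sub_left, sub_nonpos]
      have h1 := norm_policyGradient_sub_le hπ hmix hρ0 hρ1 hLπ hL hR (θ + t • u) θ
      rw [add_sub_cancel_left, norm_smul, Real.norm_eq_abs, abs_of_pos ht.1] at h1
      exact (real_inner_le_norm _ _).trans
        ((mul_le_mul_of_nonneg_right h1 (norm_nonneg u)).trans_eq (by ring)))
  have := hanti (Set.left_mem_Icc.2 zero_le_one) (Set.right_mem_Icc.2 zero_le_one) zero_le_one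
  simp only [one_smul, zero_smul, add_zero] at this
  norm_num at this
  linarith

end Gradient

/-! ### The randomized-horizon estimator of Q: boundedness and unbiasedness. -/

section Estimator

variable {S A : Type*} {M : MDP S A} {pol : S → PMF A} {Rmax : ℝ}

theorem pairLaw_bind (tr : S → A → PMF S) (p : PMF (S × A)) (n : ℕ) :
    pairLaw tr pol p n = p.bind fun x => pairLaw tr pol (PMF.pure x) n := by
  induction n with
  | zero => exact p.bind_pure.symm
  | succ n ih => simp only [pairLaw]; rw [ih, PMF.bind_bind]

theorem MDP.sqrt_lt_one (M : MDP S A) : √M.γ < 1 := by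
  rw [Real.sqrt_lt' one_pos]; simpa using M.γ_lt_one

theorem MDP.one_sub_sqrt_pos (M : MDP S A) : 0 < 1 - √M.γ := _root_.sub_pos.2 M.sqrt_lt_one

theorem rollout_mem (hR : ∀ s a, 0 ≤ M.R s a ∧ M.R s a ≤ Rmax) (hRmax : 0 ≤ Rmax) (k t : ℕ)
    (x : S × A) {q : ℝ} (hq : q ∈ (rollout M pol k t x).support) :
    0 ≤ q ∧ q ≤ Rmax * √M.γ ^ t / (1 - √M.γ) := by
  have h1 := M.one_sub_sqrt_pos
  induction k generalizing t x q with
  | zero =>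
    rw [rollout, PMF.support_pure, Set.mem_singleton_iff] at hq
    subst hq
    exact ⟨le_rfl, by positivity⟩
  | succ k ih =>
    rw [rollout, PMF.mem_support_bind_iff] at hq
    obtain ⟨y, -, hy⟩ := hq
    rw [PMF.mem_support_map_iff] at hy
    obtain ⟨q', hq', rfl⟩ := hy
    obtain ⟨h2, h3⟩ := ih (t + 1) y hq'
    refine ⟨add_nonneg (mul_nonneg (by positivity) (hR _ _).1) h2, ?_⟩
    have h4 : √M.γ ^ t * M.R x.1 x.2 ≤ √M.γ ^ t * Rmax :=
      mul_le_mul_of_nonneg_left (hR _ _).2 (by positivity)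
    calc _ ≤ √M.γ ^ t * Rmax + Rmax * √M.γ ^ (t + 1) / (1 - √M.γ) := add_le_add h4 h3
      _ = _ := by field_simp; ring

theorem expect_rollout (hR : ∀ s a, 0 ≤ M.R s a ∧ M.R s a ≤ Rmax) (hRmax : 0 ≤ Rmax) (k t : ℕ)
    (x : S × A) :
    expect (rollout M pol k t x) (fun q => q) = ∑ i ∈ Finset.range k, √M.γ ^ (t + i) *
      expect (pairLaw M.P pol (PMF.pure x) i) fun x => M.R x.1 x.2 := by
  have hbdd : ∀ k t x, BddOn (rollout M pol k t x) fun q => q := fun k t x =>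
    ⟨_, fun q hq => by
      have := rollout_mem hR hRmax k t x hq
      rw [abs_of_nonneg this.1]
      exact this.2⟩
  have hr := MDP.bdd_reward hR
  induction k generalizing t x with
  | zero => rw [rollout, expect_pure, Finset.range_zero, Finset.sum_empty]
  | succ k ih =>
    have h0 := hbdd (k + 1) t x
    rw [rollout] at h0 ⊢
    have he : ∀ i, expect (pairLaw M.P pol (PMF.pure x) (i + 1)) (fun x => M.R x.1 x.2)
        = expect (withAction pol (M.P x.1 x.2)) fun y =>
          expect (pairLaw M.P pol (PMF.pure y) i) fun x => M.R x.1 x.2 := fun i => by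
      rw [pairLaw_succ', PMF.pure_bind, pairLaw_bind, expect_bind (hr.on _)]
    have hb : ∀ i (c : ℝ), Bdd fun y => c *
        expect (pairLaw M.P pol (PMF.pure y) i) fun x => M.R x.1 x.2 :=
      fun i c => (hr.expect _).const_mul c
    rw [expect_bind h0, Finset.sum_range_succ']
    have h2 : ∀ y ∈ (withAction pol (M.P x.1 x.2)).support,
        expect ((rollout M pol k (t + 1) y).map fun q => √M.γ ^ t * M.R x.1 x.2 + q) (fun q => q)
        = √M.γ ^ t * M.R x.1 x.2 + ∑ i ∈ Finset.range k, √M.γ ^ (t + 1 + i) *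
          expect (pairLaw M.P pol (PMF.pure y) i) fun x => M.R x.1 x.2 := fun y hy => by
      rw [expect_map (h0.of_bind hy), expect_add (BddOn.const _ _) (hbdd _ _ _), expect_const, ih]
    rw [expect_congr h2, expect_add (BddOn.const _ _)
      ((Bdd.sum fun i _ => hb i (√M.γ ^ (t + 1 + i))).on _), expect_const,
      expect_finset_sum _ fun i _ => (hb i _).on _, add_comm]
    congr 1
    · refine Finset.sum_congr rfl fun i _ => ?_
      rw [expect_const_mul, he, show t + 1 + i = t + (i + 1) by ring]
    · simp [pairLaw, expect_pure]

theorem horizon_toReal (M : MDP S A) (k : ℕ) :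
    (M.horizon k).toReal = (1 - √M.γ) * √M.γ ^ k :=
  ENNReal.toReal_ofReal (mul_nonneg M.one_sub_sqrt_pos.le (by positivity))

theorem estQ_mem (hR : ∀ s a, 0 ≤ M.R s a ∧ M.R s a ≤ Rmax) (hRmax : 0 ≤ Rmax) (s : S) (a : A)
    {q : ℝ} (hq : q ∈ (estQ M pol s a).support) : 0 ≤ q ∧ q ≤ 2 * (Rmax / (1 - M.γ)) := by
  rw [estQ, PMF.mem_support_bind_iff] at hq
  obtain ⟨k, -, hk⟩ := hq
  obtain ⟨h0, h1⟩ := rollout_mem hR hRmax k 1 (s, a) hk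
  refine ⟨h0, h1.trans ?_⟩
  have h2 := M.one_sub_sqrt_pos
  have h3 := Real.sqrt_nonneg M.γ
  have h4 := Real.mul_self_sqrt M.γ_pos.le
  have h5 := M.sub_pos
  rw [pow_one, ← mul_div_assoc, div_le_div_iff₀ h2 h5]
  -- With 1 - γ = (1 - √γ)(1 + √γ) this is √γ(1 + √γ) ≤ 2.
  have h6 : √M.γ * (1 - M.γ) ≤ 2 * (1 - √M.γ) := by nlinarith
  calc Rmax * √M.γ * (1 - M.γ) = Rmax * (√M.γ * (1 - M.γ)) := by ring
    _ ≤ Rmax * (2 * (1 - √M.γ)) := mul_le_mul_of_nonneg_left h6 hRmax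
    _ = _ := by ring

theorem bddOn_estQ (hR : ∀ s a, 0 ≤ M.R s a ∧ M.R s a ≤ Rmax) (hRmax : 0 ≤ Rmax) (s : S)
    (a : A) : BddOn (estQ M pol s a) fun q => q :=
  ⟨_, fun q hq => by
    have := estQ_mem hR hRmax s a hq
    rw [abs_of_nonneg this.1]
    exact this.2⟩

/-- The estimator of the state-action value function is unbiased. -/
theorem expect_estQ (hR : ∀ s a, 0 ≤ M.R s a ∧ M.R s a ≤ Rmax) (hRmax : 0 ≤ Rmax) (s : S)
    (a : A) : expect (estQ M pol s a) (fun q => q) = qValue M pol s a := by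
  have hb := bddOn_estQ (pol := pol) hR hRmax s a
  rw [estQ] at hb ⊢
  have hs := hb.expect.summable
  rw [expect_bind hb, expect]
  simp only [expect_rollout hR hRmax, horizon_toReal] at hs ⊢
  set e := fun i => expect (pairLaw M.P pol (PMF.pure (s, a)) i) fun x => M.R x.1 x.2
  have he : ∀ i, |e i| ≤ Rmax := fun i => abs_expect_le fun x _ =>
    abs_le.2 ⟨by linarith [hR x.1 x.2], (hR x.1 x.2).2⟩
  have hq0 := Real.sqrt_nonneg M.γ
  have hq2 := Real.sq_sqrt M.γ_pos.le
  set q := √M.γ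
  have hq1 : 0 < 1 - q := M.one_sub_sqrt_pos
  -- With q² = γ, the expectation over the horizon is (1 - q)γ times the Cauchy product of ∑ γ^k e_k
  -- and ∑ q^j; the second factor is 1/(1 - q).
  have hc := tsum_mul_tsum_eq_tsum_sum_range_of_summable_norm
    (M.summable_geometric_mul he).norm (summable_geometric_of_lt_one hq0 M.sqrt_lt_one).norm
  rw [hs.tsum_eq_zero_add, Finset.range_zero, Finset.sum_empty, mul_zero, zero_add]
  have h1 : ∀ n, (1 - q) * q ^ (n + 1) * ∑ i ∈ Finset.range (n + 1), q ^ (1 + i) * e i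
      = (1 - q) * M.γ * ∑ k ∈ Finset.range (n + 1), M.γ ^ k * e k * q ^ (n - k) := fun n => by
    rw [Finset.mul_sum, Finset.mul_sum]
    refine Finset.sum_congr rfl fun k hk => ?_
    have hkn : n - k + k = n := Nat.sub_add_cancel (Nat.lt_succ_iff.1 (Finset.mem_range.1 hk))
    rw [← hq2]
    nth_rewrite 1 [← hkn]
    ring
  rw [tsum_congr h1, tsum_mul_left, ← hc, tsum_geometric_of_lt_one hq0 M.sqrt_lt_one, qValue]
  have h2 : ∀ n, M.γ ^ (n + 1) * e n = M.γ * (M.γ ^ n * e n) := fun n => by ring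
  rw [tsum_congr h2, tsum_mul_left]
  field_simp

end Estimator

/-! ### PG-SGD as a chain on (parameter, state), and its comparison with a frozen chain. -/

section Chain

variable {S A : Type*} {d : ℕ}

/-- One step of PG-SGD as a transition kernel on pairs of a parameter and a state. -/
def sgdStep (M : MDP S A) (π : EuclideanSpace ℝ (Fin d) → S → PMF A) (η : ℝ)
    (z : EuclideanSpace ℝ (Fin d) × S) : PMF (EuclideanSpace ℝ (Fin d) × S) :=
  (π z.1 z.2).bind fun a => (estQ M (π z.1) z.2 a).bind fun q =>
    (M.restart z.2 a).map (Prod.mk (z.1 - η • (q • score π z.1 z.2 a)))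

/-- The joint law of `(θ_{n+1}, s_{n+1})` along PG-SGD. -/
def sgdLaw (M : MDP S A) (π : EuclideanSpace ℝ (Fin d) → S → PMF A) (α : ℕ → ℝ)
    (θ₁ : EuclideanSpace ℝ (Fin d)) : ℕ → PMF (EuclideanSpace ℝ (Fin d) × S)
  | 0 => M.ζ.map (Prod.mk θ₁)
  | n + 1 => (sgdLaw M π α θ₁ n).bind (sgdStep M π (α (n + 1)))

/-- The law after `k` steps of PG-SGD, when `(θ_{n+1}, s_{n+1})` is given. -/
def sgdFrom (M : MDP S A) (π : EuclideanSpace ℝ (Fin d) → S → PMF A) (α : ℕ → ℝ) (n : ℕ)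
    (z : EuclideanSpace ℝ (Fin d) × S) : ℕ → PMF (EuclideanSpace ℝ (Fin d) × S)
  | 0 => PMF.pure z
  | k + 1 => (sgdFrom M π α n z k).bind (sgdStep M π (α (n + k + 1)))

variable {M : MDP S A} {π : EuclideanSpace ℝ (Fin d) → S → PMF A} {α : ℕ → ℝ}
  {θ₁ : EuclideanSpace ℝ (Fin d)} {Rmax Lπ L cΘ σ ρ η : ℝ}

/-- Given (θ_t, s_t), the action is a fresh draw from the current policy, so (θ_t, s_t) is already
Markov and the action can be moved inside the step. -/
theorem pgsgdLaw_eq (n : ℕ) :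
    pgsgdLaw M π α θ₁ n
      = (sgdLaw M π α θ₁ n).bind fun z => (π z.1 z.2).map fun a => (z.1, z.2, a) := by
  have h : ∀ (θ : EuclideanSpace ℝ (Fin d)) (ν : PMF S), (withAction (π θ) ν).map (Prod.mk θ)
      = (ν.map (Prod.mk θ)).bind fun z => (π z.1 z.2).map fun a => (z.1, z.2, a) := fun θ ν => by
    rw [withAction, PMF.map_bind, PMF.bind_map]
    refine congrArg _ (funext fun s => ?_)
    rw [PMF.map_comp]
    rfl
  induction n with
  | zero => rw [pgsgdLaw, sgdLaw, h]
  | succ n ih =>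
    rw [pgsgdLaw, sgdLaw, ih]
    simp only [PMF.bind_bind, h]
    refine congrArg _ (funext fun z => ?_)
    rw [PMF.bind_map, sgdStep]
    simp only [PMF.bind_bind]
    rfl

theorem sgdLaw_add (n k : ℕ) :
    sgdLaw M π α θ₁ (n + k) = (sgdLaw M π α θ₁ n).bind fun z => sgdFrom M π α n z k := by
  induction k with
  | zero => simp only [sgdFrom, PMF.bind_pure, Nat.add_zero]
  | succ k ih =>
    rw [← Nat.add_assoc, sgdLaw, ih, PMF.bind_bind]
    rfl

theorem gradSq_eq {t : ℕ} (hb : Bdd fun θ => ‖gradient (objective M π) θ‖ ^ 2) :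
    gradSq M π α θ₁ t
      = expect (sgdLaw M π α θ₁ (t - 1)) fun z => ‖gradient (objective M π) z.1‖ ^ 2 := by
  have h1 : Bdd fun z : EuclideanSpace ℝ (Fin d) × S × A => ‖gradient (objective M π) z.1‖ ^ 2 :=
    hb.imp fun _ hC z => hC z.1
  rw [gradSq, pgsgdLaw_eq, expect_bind (h1.on _)]
  refine expect_congr fun z _ => ?_
  rw [expect_map (h1.on _)]
  exact expect_const _ (‖gradient (objective M π) z.1‖ ^ 2)

theorem expect_sgdStep_snd {f : S → ℝ} (h : Bdd f) (z : EuclideanSpace ℝ (Fin d) × S) :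
    expect (sgdStep M π η z) (fun w => f w.2) = kop M.restart (π z.1) f z.2 := by
  have h1 : Bdd fun w : EuclideanSpace ℝ (Fin d) × S => f w.2 := h.imp fun _ hC w => hC w.2
  rw [sgdStep, expect_bind (h1.on _), kop]
  refine expect_congr fun a _ => ?_
  rw [expect_bind (h1.on _)]
  simp only [expect_map (h1.on _), expect_const]

theorem expect_sgdStep_fst {f : EuclideanSpace ℝ (Fin d) → ℝ}
    {z : EuclideanSpace ℝ (Fin d) × S} (h : BddOn (sgdStep M π η z) fun w => f w.1) :
    expect (sgdStep M π η z) (fun w => f w.1) = expect (π z.1 z.2) fun a =>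
      expect (estQ M (π z.1) z.2 a) fun q => f (z.1 - η • (q • score π z.1 z.2 a)) := by
  rw [sgdStep] at h ⊢
  rw [expect_bind h]
  refine expect_congr fun a ha => ?_
  have h1 := h.of_bind ha
  rw [expect_bind h1]
  refine expect_congr fun q hq => ?_
  rw [expect_map (h1.of_bind hq)]
  exact expect_const _ (f (z.1 - η • (q • score π z.1 z.2 a)))

variable (hπ : PolicyAssumption π Lπ L cΘ) (hR : ∀ s a, 0 ≤ M.R s a ∧ M.R s a ≤ Rmax)

include hπ hR in
theorem norm_sub_le_of_mem_sgdStep [Nonempty S] (hη : 0 ≤ η)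
    {z w : EuclideanSpace ℝ (Fin d) × S} (hw : w ∈ (sgdStep M π η z).support) :
    ‖w.1 - z.1‖ ≤ η * (2 * (Rmax / (1 - M.γ)) * cΘ) := by
  have hRmax := reward_bound_nonneg π hR
  rw [sgdStep, PMF.mem_support_bind_iff] at hw
  obtain ⟨a, -, hw⟩ := hw
  rw [PMF.mem_support_bind_iff] at hw
  obtain ⟨q, hq, hw⟩ := hw
  rw [PMF.mem_support_map_iff] at hw
  obtain ⟨s', -, rfl⟩ := hw
  obtain ⟨h0, h1⟩ := estQ_mem hR hRmax _ _ hq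
  rw [sub_sub_cancel_left, norm_neg, norm_smul, norm_smul, Real.norm_eq_abs, Real.norm_eq_abs,
    abs_of_nonneg hη, abs_of_nonneg h0]
  exact mul_le_mul_of_nonneg_left (mul_le_mul h1 (hπ.score_bound _ _ _) (norm_nonneg _)
    (h0.trans h1)) hη

-- On the support a step may have length 2ηG, but in mean it is at most ηG, because the estimator is
-- nonnegative with mean Q ≤ Rmax/(1 - γ).
include hπ hR in
theorem expect_sgdStep_norm_sub_le [Nonempty S] (hη : 0 ≤ η)
    (z : EuclideanSpace ℝ (Fin d) × S) (θ₀ : EuclideanSpace ℝ (Fin d)) :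
    expect (sgdStep M π η z) (fun w => ‖w.1 - θ₀‖)
      ≤ ‖z.1 - θ₀‖ + Ginf M.γ Rmax cΘ * η := by
  have hRmax := reward_bound_nonneg π hR
  have hc := hπ.cΘ_nonneg
  have hM := M.sub_pos
  have hb : BddOn (sgdStep M π η z) fun w => ‖w.1 - θ₀‖ :=
    ⟨η * (2 * (Rmax / (1 - M.γ)) * cΘ) + ‖z.1 - θ₀‖, fun w hw => by
      rw [abs_norm]
      have := norm_sub_le_of_mem_sgdStep hπ hR hη hw
      have h2 := norm_sub_le_norm_sub_add_norm_sub w.1 z.1 θ₀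
      linarith⟩
  rw [expect_sgdStep_fst (f := fun θ => ‖θ - θ₀‖) hb]
  have hin : ∀ a, expect (estQ M (π z.1) z.2 a)
      (fun q => ‖z.1 - η • (q • score π z.1 z.2 a) - θ₀‖)
      ≤ ‖z.1 - θ₀‖ + Ginf M.γ Rmax cΘ * η := fun a => by
    have hq := bddOn_estQ (pol := π z.1) hR hRmax z.2 a
    have hle : ∀ q ∈ (estQ M (π z.1) z.2 a).support,
        ‖z.1 - η • (q • score π z.1 z.2 a) - θ₀‖ ≤ ‖z.1 - θ₀‖ + η * cΘ * q := fun q hq => by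
      have h0 := (estQ_mem hR hRmax _ _ hq).1
      rw [sub_right_comm]
      refine (norm_sub_le _ _).trans (add_le_add_right ?_ _)
      rw [norm_smul, norm_smul, Real.norm_eq_abs, Real.norm_eq_abs, abs_of_nonneg hη,
        abs_of_nonneg h0, mul_assoc, mul_comm cΘ]
      exact mul_le_mul_of_nonneg_left (mul_le_mul_of_nonneg_left (hπ.score_bound _ _ _) h0) hη
    have hbq := hq.const_mul (η * cΘ)
    have hb2 := (BddOn.const _ ‖z.1 - θ₀‖).add hbq
    have hb1 := hb2.of_abs_le (f := fun q => ‖z.1 - η • (q • score π z.1 z.2 a) - θ₀‖)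
      fun q hq => (abs_norm _).trans_le (hle q hq)
    refine (expect_mono hb1 hb2 hle).trans ?_
    rw [expect_add (BddOn.const _ _) hbq, expect_const, expect_const_mul, expect_estQ hR hRmax]
    refine add_le_add_right ?_ _
    have hQ := (qValue_mem (pol := π z.1) hR z.2 a).2
    have hQ2 : M.γ * Rmax / (1 - M.γ) ≤ Rmax / (1 - M.γ) :=
      div_le_div_of_nonneg_right (mul_le_of_le_one_left hRmax M.γ_lt_one.le) hM.le
    calc η * cΘ * qValue M (π z.1) z.2 a ≤ η * cΘ * (Rmax / (1 - M.γ)) :=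
          mul_le_mul_of_nonneg_left (hQ.trans hQ2) (by positivity)
      _ = _ := by rw [Ginf]; ring
  refine (le_abs_self _).trans (abs_expect_le fun a _ => ?_)
  rw [abs_of_nonneg (expect_nonneg fun _ => norm_nonneg _)]
  exact hin a

include hπ hR in
theorem bddOn_sgdFrom_norm_sub [Nonempty S] (hα : ∀ n, 0 ≤ α n) (n k : ℕ)
    (z : EuclideanSpace ℝ (Fin d) × S) : BddOn (sgdFrom M π α n z k) fun w => ‖w.1 - z.1‖ := by
  induction k with
  | zero =>
    refine ⟨0, fun w hw => ?_⟩
    rw [sgdFrom, PMF.support_pure, Set.mem_singleton_iff] at hw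
    simp [hw]
  | succ k ih =>
    obtain ⟨C, hC⟩ := ih
    refine ⟨α (n + k + 1) * (2 * (Rmax / (1 - M.γ)) * cΘ) + C, fun w hw => ?_⟩
    rw [sgdFrom, PMF.mem_support_bind_iff] at hw
    obtain ⟨v, hv, hw⟩ := hw
    have h1 := norm_sub_le_of_mem_sgdStep hπ hR (hα _) hw
    have h2 := hC v hv
    have h3 := norm_sub_le_norm_sub_add_norm_sub w.1 v.1 z.1
    rw [abs_norm] at h2 ⊢
    linarith

include hπ hR in
/-- The expected drift of the parameter over `k` steps. -/
theorem expect_sgdFrom_norm_sub_le [Nonempty S] (hα : ∀ n, 0 ≤ α n) (n k : ℕ)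
    (z : EuclideanSpace ℝ (Fin d) × S) :
    expect (sgdFrom M π α n z k) (fun w => ‖w.1 - z.1‖)
      ≤ Ginf M.γ Rmax cΘ * ∑ j ∈ Finset.range k, α (n + j + 1) := by
  induction k with
  | zero => rw [sgdFrom, expect_pure]; simp
  | succ k ih =>
    have hb := bddOn_sgdFrom_norm_sub hπ hR hα n (k + 1) z
    have hb0 := bddOn_sgdFrom_norm_sub hπ hR hα n k z
    rw [sgdFrom] at hb ⊢
    have hb1 := hb0.add (BddOn.const _ (Ginf M.γ Rmax cΘ * α (n + k + 1)))
    rw [expect_bind hb, Finset.sum_range_succ, mul_add]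
    refine (expect_mono hb.expect hb1
      fun v _ => expect_sgdStep_norm_sub_le hπ hR (hα _) v z.1).trans ?_
    rw [expect_add hb0 (BddOn.const _ _), expect_const]
    exact add_le_add_left ih _

variable [Fintype A]

include hπ hR in
/-- Freezing the parameter along `k` steps changes expectations of functions of the state by a
multiple of the drift of the parameter. -/
theorem abs_expect_sgdFrom_sub_le [Infinite S] (hmix : MixingAssumption M π σ ρ) (hLπ : 0 ≤ Lπ)
    (hα : ∀ n, 0 ≤ α n)
    {f : S → ℝ} {c D : ℝ} (hf : OscLE f c) (n : ℕ) (z : EuclideanSpace ℝ (Fin d) × S) (k j : ℕ)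
    (hD : ∀ i < k, expect (sgdFrom M π α n z i) (fun w => ‖w.1 - z.1‖) ≤ D) :
    |expect (sgdFrom M π α n z k) (fun w => (kop M.restart (π z.1))^[j] f w.2)
      - (kop M.restart (π z.1))^[j + k] f z.2|
      ≤ Fintype.card A * Lπ / 2 * D * c * ∑ i ∈ Finset.range k, mixCoeff σ ρ (j + i) := by
  have hfb := hf.bdd
  induction k generalizing j with
  | zero => rw [sgdFrom, expect_pure]; simp
  | succ k ih =>
    have hK : Bdd ((kop M.restart (π z.1))^[j] f) := hfb.kop_iterate j
    have ho := hmix.oscLE_iterate hf z.1 j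
    have hb : ∀ f : S → ℝ, Bdd f → Bdd fun w : EuclideanSpace ℝ (Fin d) × S => f w.2 :=
      fun f h => h.imp fun _ hC w => hC w.2
    have h1 := ih (j + 1) fun i hi => hD i (hi.trans k.lt_succ_self)
    -- Only the last adaptive step is replaced by a frozen one. It acts on K^j f, which has already
    -- contracted by `mixCoeff σ ρ j`, so the errors sum to a bound that does not grow with the
    -- number of steps apart from the drift D.
    have h2 : |expect (sgdFrom M π α n z (k + 1)) (fun w => (kop M.restart (π z.1))^[j] f w.2)
        - expect (sgdFrom M π α n z k) (fun w => (kop M.restart (π z.1))^[j + 1] f w.2)|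
        ≤ Fintype.card A * Lπ / 2 * D * c * mixCoeff σ ρ j := by
      have hbk : Bdd fun w : EuclideanSpace ℝ (Fin d) × S =>
          kop M.restart (π w.1) ((kop M.restart (π z.1))^[j] f) w.2 :=
        hK.imp fun _ hC w => kop_abs_le hC w.2
      have hb0 := bddOn_sgdFrom_norm_sub hπ hR hα n k z
      have hN : 0 ≤ Fintype.card A * Lπ / 2 := by positivity
      have hc0 := ho.nonneg
      have hpt : ∀ w : EuclideanSpace ℝ (Fin d) × S,
          |kop M.restart (π w.1) ((kop M.restart (π z.1))^[j] f) w.2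
            - (kop M.restart (π z.1))^[j + 1] f w.2|
          ≤ Fintype.card A * Lπ / 2 * (c * mixCoeff σ ρ j) * ‖w.1 - z.1‖ := fun w => by
        rw [Function.iterate_succ_apply']
        exact (hπ.abs_kop_sub_kop_le ho w.1 z.1 w.2).trans_eq (by ring)
      have hb3 := hb0.const_mul (Fintype.card A * Lπ / 2 * (c * mixCoeff σ ρ j))
      have hb2 := hb _ (hfb.kop_iterate (tr := M.restart) (pol := π z.1) (j + 1))
      have hle : Fintype.card A * Lπ / 2 * (c * mixCoeff σ ρ j)
          * expect (sgdFrom M π α n z k) (fun w => ‖w.1 - z.1‖)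
          ≤ Fintype.card A * Lπ / 2 * D * c * mixCoeff σ ρ j :=
        (mul_le_mul_of_nonneg_left (hD k k.lt_succ_self) (mul_nonneg hN hc0)).trans_eq (by ring)
      rw [sgdFrom, expect_bind ((hb _ hK).on _)]
      simp only [expect_sgdStep_snd hK]
      rw [← expect_sub (hbk.on _) (hb2.on _)]
      rw [← expect_const_mul] at hle
      exact (abs_expect_le_expect hb3 fun w _ => hpt w).trans hle
    have h3 := abs_sub_le
      (expect (sgdFrom M π α n z (k + 1)) fun w => (kop M.restart (π z.1))^[j] f w.2)
      (expect (sgdFrom M π α n z k) fun w => (kop M.restart (π z.1))^[j + 1] f w.2)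
      ((kop M.restart (π z.1))^[j + (k + 1)] f z.2)
    rw [show j + 1 + k = j + (k + 1) by ring] at h1
    refine h3.trans ((add_le_add h2 h1).trans_eq ?_)
    rw [Finset.sum_range_succ', add_zero, mul_add, add_comm]
    congr 2
    exact Finset.sum_congr rfl fun i _ => by rw [show j + 1 + i = j + (i + 1) by ring]

end Chain

/-! ### One-step descent and bias of the stochastic gradient. -/

section Recursion

variable {S A : Type*} [Fintype A] {d : ℕ} {M : MDP S A}
  {π : EuclideanSpace ℝ (Fin d) → S → PMF A} {α : ℕ → ℝ}
  {θ₁ : EuclideanSpace ℝ (Fin d)} {Rmax Lπ L cΘ σ ρ η : ℝ}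

/-- The inner product of the policy gradient with the conditional mean of its estimator. -/
def gradCorr (M : MDP S A) (π : EuclideanSpace ℝ (Fin d) → S → PMF A)
    (z : EuclideanSpace ℝ (Fin d) × S) : ℝ :=
  ⟪policyGradient M π z.1, stateGrad M π z.1 z.2⟫

/-- A bound for the norm of the policy gradient. -/
def gradBound (M : MDP S A) (Rmax cΘ : ℝ) : ℝ := cΘ * (valueBound M Rmax / 2)

variable (hπ : PolicyAssumption π Lπ L cΘ) (hR : ∀ s a, 0 ≤ M.R s a ∧ M.R s a ≤ Rmax)

include hπ hR in
omit [Fintype A] in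
theorem gradBound_nonneg [Nonempty S] : 0 ≤ gradBound M Rmax cΘ := by
  have := hπ.cΘ_nonneg
  have := valueBound_nonneg π hR
  unfold gradBound
  positivity

include hπ hR in
theorem abs_inner_policyGradient_stateGrad_le [Nonempty S] (θ θ' : EuclideanSpace ℝ (Fin d))
    (s : S) :
    |⟪policyGradient M π θ, stateGrad M π θ' s⟫| ≤ gradBound M Rmax cΘ ^ 2 := by
  rw [sq]
  exact (abs_real_inner_le_norm _ _).trans (mul_le_mul (norm_policyGradient_le hπ hR θ)
    (norm_stateGrad_le hπ hR θ' s) (norm_nonneg _) (gradBound_nonneg hπ hR))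

include hπ hR in
theorem norm_sq_policyGradient_le [Nonempty S] (θ : EuclideanSpace ℝ (Fin d)) :
    ‖policyGradient M π θ‖ ^ 2 ≤ gradBound M Rmax cΘ ^ 2 :=
  pow_le_pow_left₀ (norm_nonneg _) (norm_policyGradient_le hπ hR θ) 2

variable [Infinite S] (hmix : MixingAssumption M π σ ρ) (hρ0 : 0 < ρ) (hρ1 : ρ < 1)
  (hLπ : 0 ≤ Lπ) (hL : 0 ≤ L)

include hπ hR hmix hρ0 hρ1 hLπ hL

omit hπ hR hLπ hL in
theorem gradLip_nonneg (hπ : PolicyAssumption π Lπ L cΘ)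
    (hR : ∀ s a, 0 ≤ M.R s a ∧ M.R s a ≤ Rmax) (hLπ : 0 ≤ Lπ) (hL : 0 ≤ L) :
    0 ≤ gradLip M Rmax Lπ L cΘ σ ρ := by
  have hX := four_le_mixConst hρ0 hρ1 hmix.one_le
  have := hπ.cΘ_nonneg
  have := valueBound_nonneg π hR
  have : 0 ≤ mixConst σ ρ - 2 := by linarith
  unfold gradLip
  positivity

omit hπ hR hLπ hL in
theorem stateGradLip_nonneg (hπ : PolicyAssumption π Lπ L cΘ)
    (hR : ∀ s a, 0 ≤ M.R s a ∧ M.R s a ≤ Rmax) (hLπ : 0 ≤ Lπ) (hL : 0 ≤ L) :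
    0 ≤ stateGradLip M Rmax Lπ L cΘ σ ρ := by
  have hX := four_le_mixConst hρ0 hρ1 hmix.one_le
  have := hπ.cΘ_nonneg
  have := valueBound_nonneg π hR
  have : 0 ≤ mixConst σ ρ - 2 := by linarith
  unfold stateGradLip
  positivity

/-- The expected decrease of the objective in one step. -/
theorem expect_sgdStep_objective_le (hη : 0 ≤ η) (z : EuclideanSpace ℝ (Fin d) × S) :
    expect (sgdStep M π η z) (fun w => objective M π w.1)
      ≤ objective M π z.1 - η * gradCorr M π z
        + η ^ 2 * (Ginf M.γ Rmax cΘ ^ 2 * gradLip M Rmax Lπ L cΘ σ ρ) := by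
  have hRmax := reward_bound_nonneg π hR
  have hc := hπ.cΘ_nonneg
  have hM := M.sub_pos
  have hβ := gradLip_nonneg hmix hρ0 hρ1 hπ hR hLπ hL
  set β := gradLip M Rmax Lπ L cΘ σ ρ with hβdef
  have hJ : Bdd (objective M π) := bdd_of_mem_Icc fun θ => objective_mem hR θ
  have hJ1 : Bdd fun w : EuclideanSpace ℝ (Fin d) × S => objective M π w.1 :=
    hJ.imp fun _ hC w => hC w.1
  set B := Rmax / (1 - M.γ) with hB
  have hB0 : 0 ≤ B := div_nonneg hRmax hM.le
  rw [expect_sgdStep_fst (hJ1.on _)]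
  have hin : ∀ a, expect (estQ M (π z.1) z.2 a)
      (fun q => objective M π (z.1 - η • (q • score π z.1 z.2 a)))
      ≤ objective M π z.1
        - η * (qValue M (π z.1) z.2 a * ⟪policyGradient M π z.1, score π z.1 z.2 a⟫)
        + η ^ 2 * (Ginf M.γ Rmax cΘ ^ 2 * β) := fun a => by
    set u := score π z.1 z.2 a
    have hq := bddOn_estQ (pol := π z.1) hR hRmax z.2 a
    set κ := -(η * ⟪policyGradient M π z.1, u⟫) + β * η ^ 2 * cΘ ^ 2 * B with hκ
    have hle : ∀ q ∈ (estQ M (π z.1) z.2 a).support,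
        objective M π (z.1 - η • (q • u)) ≤ objective M π z.1 + κ * q := fun q hq => by
      obtain ⟨h0, h1⟩ := estQ_mem hR hRmax _ _ hq
      have h2 := objective_le hπ hmix hρ0 hρ1 hLπ hL hR z.1 (-(η • (q • u)))
      rw [← sub_eq_add_neg, inner_neg_right, real_inner_smul_right, real_inner_smul_right,
        norm_neg, norm_smul, norm_smul, Real.norm_eq_abs, Real.norm_eq_abs, abs_of_nonneg hη,
        abs_of_nonneg h0, ← hβdef] at h2
      -- Using q² ≤ 2Bq keeps the bound affine in q, so unbiasedness applies: E q² ≤ 2B·Q ≤ 2B², and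
      -- the factor β/2 of the descent inequality leaves β G² η².
      have h3 : (η * (q * ‖u‖)) ^ 2 ≤ η ^ 2 * (2 * B * q * cΘ ^ 2) := by
        rw [mul_pow, mul_pow]
        refine mul_le_mul_of_nonneg_left (mul_le_mul ?_ ?_ (by positivity) (by positivity))
          (sq_nonneg η)
        · rw [sq]; exact mul_le_mul_of_nonneg_right h1 h0
        · exact pow_le_pow_left₀ (norm_nonneg _) (hπ.score_bound _ _ _) 2
      have h4 := mul_le_mul_of_nonneg_left h3 (div_nonneg hβ zero_le_two)
      rw [hκ]
      linarith
    refine (expect_mono ((hJ.imp fun _ hC q _ => hC _ : BddOn _ _))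
      ((BddOn.const _ _).add (hq.const_mul κ)) hle).trans ?_
    rw [expect_add (BddOn.const _ _) (hq.const_mul κ), expect_const, expect_const_mul,
      expect_estQ hR hRmax, hκ]
    have hQ := qValue_mem (pol := π z.1) hR z.2 a
    have hQ2 : qValue M (π z.1) z.2 a ≤ B := hQ.2.trans
      (div_le_div_of_nonneg_right (mul_le_of_le_one_left hRmax M.γ_lt_one.le) hM.le)
    have h5 := mul_le_mul_of_nonneg_left hQ2
      (by positivity : 0 ≤ β * η ^ 2 * cΘ ^ 2 * B)
    have h6 : Ginf M.γ Rmax cΘ = cΘ * B := by rw [Ginf, hB]; ring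
    rw [h6]
    linarith
  rw [expect_fintype]
  refine (Finset.sum_le_sum fun a _ =>
    mul_le_mul_of_nonneg_left (hin a) ENNReal.toReal_nonneg).trans_eq ?_
  rw [gradCorr, stateGrad, inner_sum, Finset.mul_sum]
  simp only [mul_add, mul_sub, Finset.sum_add_distrib, Finset.sum_sub_distrib,
    ← Finset.sum_mul, sum_toReal, one_mul, gradPolicy, real_inner_smul_right]
  congr 2
  exact Finset.sum_congr rfl fun a _ => by ring

/-- The multiple of the parameter drift that bounds the bias of the gradient estimator. -/
def biasCoeff (M : MDP S A) (Rmax Lπ L cΘ σ ρ : ℝ) : ℝ :=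
  gradBound M Rmax cΘ * (gradLip M Rmax Lπ L cΘ σ ρ + stateGradLip M Rmax Lπ L cΘ σ ρ)
    + Fintype.card A * Lπ * gradBound M Rmax cΘ ^ 2 * (2 * (mixConst σ ρ - 2))

theorem biasCoeff_nonneg : 0 ≤ biasCoeff M Rmax Lπ L cΘ σ ρ := by
  have hβ := gradLip_nonneg hmix hρ0 hρ1 hπ hR hLπ hL
  have hLh := stateGradLip_nonneg hmix hρ0 hρ1 hπ hR hLπ hL
  have hm := gradBound_nonneg hπ hR
  have hX := four_le_mixConst hρ0 hρ1 hmix.one_le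
  have hX2 : 0 ≤ mixConst σ ρ - 2 := by linarith
  unfold biasCoeff
  positivity

/-- The bias of the gradient estimator, `τ` steps after the parameter `z.1` was current. -/
theorem le_expect_sgdFrom_gradCorr (hα : ∀ n, 0 ≤ α n) (n τ : ℕ)
    (z : EuclideanSpace ℝ (Fin d) × S) :
    ‖policyGradient M π z.1‖ ^ 2
      - biasCoeff M Rmax Lπ L cΘ σ ρ
        * (Ginf M.γ Rmax cΘ * ∑ j ∈ Finset.range τ, α (n + j + 1))
      - 2 * gradBound M Rmax cΘ ^ 2 * (σ * ρ ^ (τ + 1))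
      ≤ expect (sgdFrom M π α n z τ) (gradCorr M π) := by
  have hm := gradBound_nonneg hπ hR
  have hβ := gradLip_nonneg hmix hρ0 hρ1 hπ hR hLπ hL
  have hLh := stateGradLip_nonneg hmix hρ0 hρ1 hπ hR hLπ hL
  set m := gradBound M Rmax cΘ with hmdef
  set β := gradLip M Rmax Lπ L cΘ σ ρ with hβdef
  set l := stateGradLip M Rmax Lπ L cΘ σ ρ with hl
  set D := Ginf M.γ Rmax cΘ * ∑ j ∈ Finset.range τ, α (n + j + 1) with hD
  have hG : 0 ≤ Ginf M.γ Rmax cΘ := by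
    have := hπ.cΘ_nonneg
    have := reward_bound_nonneg π hR
    have := M.sub_pos
    unfold Ginf
    positivity
  set f : S → ℝ := fun s => ⟪policyGradient M π z.1, stateGrad M π z.1 s⟫ with hfdef
  have hfb : ∀ s, |f s| ≤ m ^ 2 := abs_inner_policyGradient_stateGrad_le hπ hR z.1 z.1
  have hfo := oscLE_of_abs_le hfb
  have hfw : Bdd fun w : EuclideanSpace ℝ (Fin d) × S => f w.2 := ⟨_, fun w => hfb w.2⟩
  have hcb : Bdd (gradCorr M π) :=
    ⟨_, fun w => abs_inner_policyGradient_stateGrad_le hπ hR w.1 w.1 w.2⟩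
  have hdrift : ∀ i ≤ τ, expect (sgdFrom M π α n z i) (fun w => ‖w.1 - z.1‖) ≤ D := fun i hi =>
    (expect_sgdFrom_norm_sub_le hπ hR hα n i z).trans (mul_le_mul_of_nonneg_left
      (Finset.sum_le_sum_of_subset_of_nonneg (Finset.range_mono hi) fun _ _ _ => hα _) hG)
  -- Three errors are added: freezing the chain (`h1`), mixing of the frozen chain towards
  -- ‖∇J(z.1)‖² (`h2`), and replacing the frozen by the current parameter in the integrand (`h3`).
  have h1 := (abs_le.1 (abs_expect_sgdFrom_sub_le hπ hR hmix hLπ hα hfo n z τ 0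
    fun i hi => hdrift i hi.le)).1
  simp only [zero_add, Function.iterate_zero, id_eq] at h1
  have hmean : expect (visitPMF M (π z.1)) f = ‖policyGradient M π z.1‖ ^ 2 := by
    rw [← real_inner_self_eq_norm_sq, inner_policyGradient hπ hR]
    exact expect_congr fun s _ => real_inner_comm _ _
  have h2 := (abs_le.1 (hmix.abs_iterate_sub_le hfo z.1 τ z.2)).1
  rw [hmean] at h2
  have hb0 := bddOn_sgdFrom_norm_sub hπ hR hα n τ z
  have hpt : ∀ w : EuclideanSpace ℝ (Fin d) × S,
      |f w.2 - gradCorr M π w| ≤ m * (β + l) * ‖w.1 - z.1‖ := fun w => by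
    have e : f w.2 - gradCorr M π w
        = ⟪policyGradient M π z.1 - policyGradient M π w.1, stateGrad M π z.1 w.2⟫
          + ⟪policyGradient M π w.1, stateGrad M π z.1 w.2 - stateGrad M π w.1 w.2⟫ := by
      rw [hfdef, gradCorr, inner_sub_left, inner_sub_right]; ring
    rw [e]
    have e1 := norm_policyGradient_sub_le hπ hmix hρ0 hρ1 hLπ hL hR z.1 w.1
    have e2 := norm_stateGrad_sub_le hπ hmix hρ0 hρ1 hLπ hR z.1 w.1 w.2
    rw [norm_sub_rev z.1] at e1 e2
    calc _ ≤ β * ‖w.1 - z.1‖ * m + m * (l * ‖w.1 - z.1‖) :=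
          (abs_add_le _ _).trans (add_le_add
            ((abs_real_inner_le_norm _ _).trans (mul_le_mul e1 (norm_stateGrad_le hπ hR _ _)
              (norm_nonneg _) (mul_nonneg hβ (norm_nonneg _))))
            ((abs_real_inner_le_norm _ _).trans (mul_le_mul (norm_policyGradient_le hπ hR _) e2
              (norm_nonneg _) hm)))
      _ = _ := by ring
  have h3 := (le_abs_self _).trans (abs_expect_le_expect (hb0.const_mul (m * (β + l)))
    fun w _ => hpt w)
  rw [expect_sub (hfw.on _) (hcb.on _), expect_const_mul] at h3
  have h4 := mul_le_mul_of_nonneg_left (hdrift τ le_rfl) (mul_nonneg hm (add_nonneg hβ hLh))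
  have hD0 : 0 ≤ D := mul_nonneg hG (Finset.sum_nonneg fun _ _ => hα _)
  have h5 := mul_le_mul_of_nonneg_left (sum_mixCoeff_le hρ0 hρ1 hmix.one_le τ)
    (by positivity : 0 ≤ Fintype.card A * Lπ / 2 * D * (2 * m ^ 2))
  have h6 : biasCoeff M Rmax Lπ L cΘ σ ρ * D = m * (β + l) * D
      + Fintype.card A * Lπ / 2 * D * (2 * m ^ 2) * (2 * (mixConst σ ρ - 2)) := by
    rw [biasCoeff]; ring
  rw [h6]
  linarith

theorem expect_sgdLaw_objective_succ_le (hα : ∀ n, 0 ≤ α n) (n : ℕ) :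
    expect (sgdLaw M π α θ₁ (n + 1)) (fun w => objective M π w.1)
      ≤ expect (sgdLaw M π α θ₁ n) (fun w => objective M π w.1)
        - α (n + 1) * expect (sgdLaw M π α θ₁ n) (gradCorr M π)
        + α (n + 1) ^ 2 * (Ginf M.γ Rmax cΘ ^ 2 * gradLip M Rmax Lπ L cΘ σ ρ) := by
  have hJ : Bdd fun w : EuclideanSpace ℝ (Fin d) × S => objective M π w.1 :=
    bdd_of_mem_Icc fun w => objective_mem hR w.1
  have hcb : Bdd (gradCorr M π) :=
    ⟨_, fun w => abs_inner_policyGradient_stateGrad_le hπ hR w.1 w.1 w.2⟩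
  have hc := hcb.const_mul (α (n + 1))
  rw [sgdLaw, expect_bind (hJ.on _)]
  refine (expect_mono ((hJ.expect _).on _) (((hJ.sub hc).add (bdd_const _)).on _)
    fun z _ => expect_sgdStep_objective_le hπ hR hmix hρ0 hρ1 hLπ hL (hα _) z).trans_eq ?_
  rw [expect_add ((hJ.sub hc).on _) (BddOn.const _ _), expect_const,
    expect_sub (hJ.on _) (hc.on _), expect_const_mul]

theorem le_expect_sgdLaw_gradCorr (hα : ∀ n, 0 ≤ α n) (n τ : ℕ) :
    expect (sgdLaw M π α θ₁ n) (fun w => ‖policyGradient M π w.1‖ ^ 2)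
      - biasCoeff M Rmax Lπ L cΘ σ ρ
        * (Ginf M.γ Rmax cΘ * ∑ j ∈ Finset.range τ, α (n + j + 1))
      - 2 * gradBound M Rmax cΘ ^ 2 * (σ * ρ ^ (τ + 1))
      ≤ expect (sgdLaw M π α θ₁ (n + τ)) (gradCorr M π) := by
  have hcb : Bdd (gradCorr M π) :=
    ⟨_, fun w => abs_inner_policyGradient_stateGrad_le hπ hR w.1 w.1 w.2⟩
  have hg : Bdd fun w : EuclideanSpace ℝ (Fin d) × S => ‖policyGradient M π w.1‖ ^ 2 :=
    bdd_of_mem_Icc fun w => ⟨sq_nonneg _, norm_sq_policyGradient_le hπ hR w.1⟩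
  rw [sgdLaw_add, expect_bind (hcb.on _)]
  refine Eq.trans_le ?_ (expect_mono (((hg.sub (bdd_const _)).sub (bdd_const _)).on _)
    ((hcb.expect _).on _)
    fun z _ => le_expect_sgdFrom_gradCorr hπ hR hmix hρ0 hρ1 hLπ hL hα n τ z)
  rw [expect_sub ((hg.sub (bdd_const _)).on _) (BddOn.const _ _), expect_const,
    expect_sub (hg.on _) (BddOn.const _ _), expect_const]

end Recursion

/-! ### Deterministic summation lemmas. -/

/-- Here j is the objective, a the descent term, g the squared gradient norm, s the stepsizes. The
bias bound matches g n with a (n + τ); the last τ values of g and the first τ values of a stay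
unmatched and each cost τm. -/
theorem sum_le_of_descent_of_bias {j a g s : ℕ → ℝ} {b κ m e : ℝ} {τ : ℕ} (hs : ∀ n, 0 < s n)
    (hκ : 0 ≤ κ) (he : 0 ≤ e)
    (hj : ∀ n, j (n + 1) ≤ j n - s n * a n + s n ^ 2 * b)
    (ha : ∀ n, g n - κ * ∑ i ∈ Finset.range τ, s (n + i) - e ≤ a (n + τ))
    (ha0 : ∀ n, -m ≤ a n) (hg : ∀ n, g n ≤ m) (hg0 : ∀ n, 0 ≤ g n) (T : ℕ) :
    ∑ n ∈ Finset.range T, g n ≤ ∑ n ∈ Finset.range T, (j n - j (n + 1)) / s n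
      + (b + τ * κ) * ∑ n ∈ Finset.range T, s n + T * e + 2 * (τ * m) := by
  have hm : 0 ≤ m := (hg0 0).trans (hg 0)
  have hs0 : ∀ T, 0 ≤ ∑ n ∈ Finset.range T, s n := fun T => Finset.sum_nonneg fun n _ => (hs n).le
  have h1 : ∑ n ∈ Finset.range T, a n ≤ ∑ n ∈ Finset.range T, (j n - j (n + 1)) / s n
      + b * ∑ n ∈ Finset.range T, s n := by
    rw [Finset.mul_sum, ← Finset.sum_add_distrib]
    refine Finset.sum_le_sum fun n _ => ?_
    have := hs n
    rw [← sub_le_iff_le_add, le_div_iff₀ (hs n)]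
    linarith [hj n]
  have h2 : ∑ n ∈ Finset.range T, g n ≤ ∑ n ∈ Finset.range T, a n
      + τ * κ * ∑ n ∈ Finset.range T, s n + T * e + 2 * (τ * m) := by
    -- For T ≤ τ nothing can be matched, and the crude g - a ≤ 2m suffices.
    rcases le_total T τ with hT | hT
    · have h3 : ∑ n ∈ Finset.range T, (g n - a n) ≤ T * (2 * m) := by
        refine (Finset.sum_le_card_nsmul _ _ (2 * m) fun n _ => ?_).trans_eq ?_
        · linarith [hg n, ha0 n]
        · rw [Finset.card_range, nsmul_eq_mul]
      rw [Finset.sum_sub_distrib] at h3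
      have h4 : (T : ℝ) * (2 * m) ≤ τ * (2 * m) :=
        mul_le_mul_of_nonneg_right (by exact_mod_cast hT) (by positivity)
      have h5 : 0 ≤ τ * κ * ∑ n ∈ Finset.range T, s n := mul_nonneg (by positivity) (hs0 T)
      have h6 : 0 ≤ T * e := by positivity
      linarith
    · obtain ⟨r, rfl⟩ := Nat.exists_eq_add_of_le' hT
      have h3 : ∑ n ∈ Finset.range τ, g (r + n) ≤ τ * m := by
        refine (Finset.sum_le_card_nsmul _ _ m fun n _ => hg _).trans_eq ?_
        rw [Finset.card_range, nsmul_eq_mul]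
      have h4 : -(τ * m) ≤ ∑ n ∈ Finset.range τ, a n := by
        refine Eq.trans_le ?_ (Finset.card_nsmul_le_sum _ _ (-m) fun n _ => ha0 n)
        rw [Finset.card_range, nsmul_eq_mul, mul_neg]
      have h5 : ∑ n ∈ Finset.range r, ∑ i ∈ Finset.range τ, s (n + i)
          ≤ τ * ∑ n ∈ Finset.range (r + τ), s n := by
        rw [Finset.sum_comm]
        refine (Finset.sum_le_card_nsmul _ _ (∑ n ∈ Finset.range (r + τ), s n)
          fun i hi => ?_).trans_eq (by rw [Finset.card_range, nsmul_eq_mul])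
        have h6 := Finset.sum_range_add s i r
        simp only [add_comm _ i]
        have h7 : ∑ n ∈ Finset.range (i + r), s n ≤ ∑ n ∈ Finset.range (r + τ), s n :=
          Finset.sum_le_sum_of_subset_of_nonneg (Finset.range_mono (by
            have := Finset.mem_range.1 hi; omega)) fun n _ _ => (hs n).le
        linarith [hs0 i]
      have h6 : ∑ n ∈ Finset.range r, g n ≤ ∑ n ∈ Finset.range r, a (τ + n)
          + κ * ∑ n ∈ Finset.range r, ∑ i ∈ Finset.range τ, s (n + i) + r * e := by
        have : (r : ℝ) * e = ∑ n ∈ Finset.range r, e := by simp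
        rw [this, Finset.mul_sum, ← Finset.sum_add_distrib, ← Finset.sum_add_distrib]
        refine Finset.sum_le_sum fun n _ => ?_
        rw [add_comm τ n]
        linarith [ha n]
      have h7 := mul_le_mul_of_nonneg_left h5 hκ
      have h8 := Finset.sum_range_add a τ r
      rw [add_comm τ r] at h8
      have h9 : 0 ≤ τ * e := by positivity
      rw [Finset.sum_range_add, h8]
      push_cast
      linarith
  linarith

theorem sum_one_div_sqrt_le (T : ℕ) :
    ∑ n ∈ Finset.range T, 1 / √((n : ℝ) + 1) ≤ 2 * √(T : ℝ) := by
  induction T with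
  | zero => simp
  | succ n ih =>
    rw [Finset.sum_range_succ]
    push_cast
    have h0 := Real.sqrt_nonneg (n : ℝ)
    have h1 : 0 < √((n : ℝ) + 1) := Real.sqrt_pos.2 (by positivity)
    have h2 := Real.sq_sqrt (Nat.cast_nonneg (α := ℝ) n)
    have h3 := Real.sq_sqrt (by positivity : (0 : ℝ) ≤ n + 1)
    have h4 : 1 / √((n : ℝ) + 1) ≤ 2 * √((n : ℝ) + 1) - 2 * √(n : ℝ) := by
      rw [div_le_iff₀ h1]
      nlinarith [sq_nonneg (√((n : ℝ) + 1) - √(n : ℝ))]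
    linarith

/-- Summation by parts. The discarded term -√T · j T is what makes the induction close. -/
theorem sum_sub_mul_sqrt_le {j : ℕ → ℝ} {C : ℝ} (h0 : ∀ n, 0 ≤ j n) (hC : ∀ n, j n ≤ C) {T : ℕ}
    (hT : 1 ≤ T) :
    ∑ n ∈ Finset.range T, (j n - j (n + 1)) * √((n : ℝ) + 1) ≤ j 0 + C * (√(T : ℝ) - 1) := by
  suffices h : ∑ n ∈ Finset.range T, (j n - j (n + 1)) * √((n : ℝ) + 1)
      ≤ j 0 + C * (√(T : ℝ) - 1) - √(T : ℝ) * j T by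
    linarith [mul_nonneg (Real.sqrt_nonneg (T : ℝ)) (h0 T)]
  induction T, hT using Nat.le_induction with
  | base => simp
  | succ n _ ih =>
    rw [Finset.sum_range_succ]
    push_cast
    have h1 : √(n : ℝ) ≤ √((n : ℝ) + 1) := Real.sqrt_le_sqrt (by linarith)
    nlinarith [mul_nonneg (sub_nonneg.2 (hC n)) (sub_nonneg.2 h1)]

theorem exists_le_div_of_sum_range_le {g : ℕ → ℝ} {C : ℝ} {T : ℕ} (hT : 1 ≤ T)
    (h : ∑ n ∈ Finset.range T, g (n + 1) ≤ C) : ∃ t ∈ Finset.Icc 1 T, g t ≤ C / T := by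
  have hT0 : (0 : ℝ) < T := by exact_mod_cast hT
  obtain ⟨n, hn, hle⟩ := Finset.exists_le_of_sum_le (s := Finset.range T)
    (f := fun n => g (n + 1)) (g := fun _ => C / T)
    (Finset.nonempty_range_iff.2 (by omega)) (by
      rw [Finset.sum_const, Finset.card_range, nsmul_eq_mul, mul_div_cancel₀ _ hT0.ne']
      exact h)
  exact ⟨n + 1, Finset.mem_Icc.2 ⟨by omega, Finset.mem_range.1 hn⟩, hle⟩

/-! ### Lower and upper bounds for the mixing time. -/

section MixTime

variable {σ ρ ε : ℝ}

theorem mixTime_spec (hσ : 0 < σ) (hρ1 : ρ < 1) (hε : 0 < ε) :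
    σ * ρ ^ mixTime σ ρ ε ≤ ε := by
  refine Nat.sInf_mem (s := {τ : ℕ | σ * ρ ^ τ ≤ ε}) ?_
  obtain ⟨n, hn⟩ := exists_pow_lt_of_lt_one (div_pos hε hσ) hρ1
  refine ⟨n, ?_⟩
  have := (lt_div_iff₀ hσ).1 hn
  change σ * ρ ^ n ≤ ε
  linarith

/-- Both σ and σρ are at least 1 > ε, which rules out 0 and 1. -/
theorem two_le_mixTime (hρ0 : 0 < ρ) (hρ1 : ρ < 1) (hσρ : 1 ≤ σ * ρ) (hε : 0 < ε)
    (hε1 : ε < 1) : 2 ≤ mixTime σ ρ ε := by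
  have hσ : 0 < σ := pos_of_mul_pos_left (one_pos.trans_le hσρ) hρ0.le
  have h := mixTime_spec hσ hρ1 hε
  by_contra! hlt
  interval_cases mixTime σ ρ ε
  · nlinarith
  · rw [pow_one] at h; linarith

/-- By minimality the defining inequality fails one step earlier; logarithms of that failure give
the bound. -/
theorem mixTime_le (hσ : 0 < σ) (hρ0 : 0 < ρ) (hρ1 : ρ < 1) (hε : 0 < ε) (hε1 : ε ≤ 1) :
    (mixTime σ ρ ε : ℝ) ≤ 1 + (|Real.log σ| + Real.log (1 / ε)) / Real.log (1 / ρ) := by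
  have hl : 0 < Real.log (1 / ρ) := Real.log_pos (by rw [lt_div_iff₀ hρ0]; linarith)
  have hl2 : 0 ≤ Real.log (1 / ε) := Real.log_nonneg (by rw [le_div_iff₀ hε]; linarith)
  rcases Nat.eq_zero_or_pos (mixTime σ ρ ε) with h0 | h0
  · rw [h0, Nat.cast_zero]
    have := abs_nonneg (Real.log σ)
    positivity
  · obtain ⟨n, hn⟩ : ∃ n, mixTime σ ρ ε = n + 1 := ⟨_, (Nat.succ_pred_eq_of_pos h0).symm⟩
    have h1 : ¬ σ * ρ ^ n ≤ ε := fun h =>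
      absurd (Nat.sInf_le (s := {τ : ℕ | σ * ρ ^ τ ≤ ε}) h) (by
        change ¬ mixTime σ ρ ε ≤ n
        omega)
    have h2 := Real.log_lt_log hε (not_le.1 h1)
    rw [Real.log_mul hσ.ne' (pow_pos hρ0 n).ne', Real.log_pow] at h2
    rw [hn, Nat.cast_add, Nat.cast_one, add_comm, add_le_add_iff_left, le_div_iff₀ hl, one_div,
      one_div, Real.log_inv, Real.log_inv]
    linarith [le_abs_self (Real.log σ)]

end MixTime

/-! ### Comparison with the stated constants, and the rate for a constant stepsize. -/

section Rates

variable {S A : Type*} [Fintype A] [Infinite S] {d : ℕ} {M : MDP S A}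
  {π : EuclideanSpace ℝ (Fin d) → S → PMF A} {α : ℕ → ℝ}
  {θ₁ : EuclideanSpace ℝ (Fin d)} {Rmax Lπ L cΘ σ ρ : ℝ}

theorem cJ_nonneg {γ : ℝ} {nA : ℕ} (hγ : γ < 1) (hR : 0 ≤ Rmax) (hLπ : 0 ≤ Lπ) (hL : 0 ≤ L)
    (hc : 0 ≤ cΘ) (hX : 0 ≤ mixConst σ ρ) : 0 ≤ cJ γ Rmax Lπ L cΘ σ ρ nA := by
  have := sub_pos.2 hγ
  unfold cJ
  positivity

theorem cJtilde_nonneg {γ : ℝ} {nA : ℕ} (hγ : γ < 1) (hR : 0 ≤ Rmax) (hLπ : 0 ≤ Lπ) (hL : 0 ≤ L)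
    (hc : 0 ≤ cΘ) (hX : 0 ≤ mixConst σ ρ) : 0 ≤ cJtilde γ Rmax Lπ L cΘ σ ρ nA := by
  have := sub_pos.2 hγ
  unfold cJtilde
  positivity

omit [Fintype A] [Infinite S] in
theorem valueBound_le (hRmax : 0 ≤ Rmax) : valueBound M Rmax ≤ Rmax / (1 - M.γ) :=
  div_le_div_of_nonneg_right (mul_le_of_le_one_left hRmax M.γ_lt_one.le) M.sub_pos.le

variable (hπ : PolicyAssumption π Lπ L cΘ) (hR : ∀ s a, 0 ≤ M.R s a ∧ M.R s a ≤ Rmax)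

include hπ hR in
omit [Fintype A] in
theorem gradBound_le : gradBound M Rmax cΘ ≤ Ginf M.γ Rmax cΘ / 2 := by
  have hRmax := reward_bound_nonneg π hR
  have h := mul_le_mul_of_nonneg_left (valueBound_le (M := M) hRmax) hπ.cΘ_nonneg
  have : Ginf M.γ Rmax cΘ = cΘ * (Rmax / (1 - M.γ)) := by rw [Ginf]; ring
  rw [gradBound, this]
  linarith

include hπ hR in
omit [Fintype A] in
theorem gradBound_sq_le : gradBound M Rmax cΘ ^ 2 ≤ Ginf M.γ Rmax cΘ ^ 2 / 4 := by
  have := pow_le_pow_left₀ (gradBound_nonneg hπ hR) (gradBound_le hπ hR) 2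
  linarith

variable (hmix : MixingAssumption M π σ ρ) (hρ0 : 0 < ρ) (hρ1 : ρ < 1) (hLπ : 0 ≤ Lπ)
  (hL : 0 ≤ L)

include hπ hR hmix hρ0 hρ1 hLπ hL

theorem gradLip_le : gradLip M Rmax Lπ L cΘ σ ρ
    ≤ 2 * cJ M.γ Rmax Lπ L cΘ σ ρ (Fintype.card A) := by
  have hRmax := reward_bound_nonneg π hR
  have hc := hπ.cΘ_nonneg
  have hX := four_le_mixConst hρ0 hρ1 hmix.one_le
  have hX2 : 0 ≤ mixConst σ ρ - 2 := by linarith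
  have hB := valueBound_le (M := M) hRmax
  have hB0 : 0 ≤ Rmax / (1 - M.γ) := div_nonneg hRmax M.sub_pos.le
  set B := Rmax / (1 - M.γ) with hBdef
  have e : cJ M.γ Rmax Lπ L cΘ σ ρ (Fintype.card A)
      = B * L + (1 + cΘ) * B * (Fintype.card A * Lπ * mixConst σ ρ) := by
    rw [cJ, hBdef]; ring
  have h1 : gradLip M Rmax Lπ L cΘ σ ρ
      ≤ B / 2 * (Fintype.card A * Lπ * cΘ * (1 + 4 * (mixConst σ ρ - 2)) + L) := by
    unfold gradLip
    gcongr
  have h2 : 0 ≤ B * (Fintype.card A * Lπ * mixConst σ ρ) := by positivity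
  have h3 : 0 ≤ B * (Fintype.card A * Lπ * cΘ) := by positivity
  have h4 : 0 ≤ B * L := by positivity
  rw [e]
  linarith

theorem biasCoeff_le : biasCoeff M Rmax Lπ L cΘ σ ρ
    ≤ 2 * Ginf M.γ Rmax cΘ * cJ M.γ Rmax Lπ L cΘ σ ρ (Fintype.card A) := by
  have hRmax := reward_bound_nonneg π hR
  have hc := hπ.cΘ_nonneg
  have hX := four_le_mixConst hρ0 hρ1 hmix.one_le
  have hX2 : 0 ≤ mixConst σ ρ - 2 := by linarith
  have hB := valueBound_le (M := M) hRmax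
  have hV0 := valueBound_nonneg π hR
  have hB0 : 0 ≤ Rmax / (1 - M.γ) := div_nonneg hRmax M.sub_pos.le
  set B := Rmax / (1 - M.γ) with hBdef
  have e : cJ M.γ Rmax Lπ L cΘ σ ρ (Fintype.card A)
      = B * L + (1 + cΘ) * B * (Fintype.card A * Lπ * mixConst σ ρ) := by
    rw [cJ, hBdef]; ring
  have eG : Ginf M.γ Rmax cΘ = cΘ * B := by rw [Ginf, hBdef]; ring
  have h1 : biasCoeff M Rmax Lπ L cΘ σ ρ
      ≤ cΘ * (B / 2) *
        (B / 2 * (Fintype.card A * Lπ * cΘ * (1 + 4 * (mixConst σ ρ - 2)) + L)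
        + B / 2 * (Fintype.card A * Lπ * cΘ * (1 + 2 * (mixConst σ ρ - 2)) + L))
        + Fintype.card A * Lπ * (cΘ * (B / 2)) ^ 2 * (2 * (mixConst σ ρ - 2)) := by
    unfold biasCoeff gradLip stateGradLip gradBound
    gcongr
  have h2 : 0 ≤ cΘ * B * (B * (Fintype.card A * Lπ * mixConst σ ρ)) := by positivity
  have h3 : 0 ≤ cΘ * B * (B * (Fintype.card A * Lπ * cΘ)) := by positivity
  have h4 : 0 ≤ cΘ * B * (B * L) := by positivity
  rw [e, eG]
  linarith

omit hπ hR hLπ hL in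
theorem gradSq_eq_expect (hπ : PolicyAssumption π Lπ L cΘ)
    (hR : ∀ s a, 0 ≤ M.R s a ∧ M.R s a ≤ Rmax) (hLπ : 0 ≤ Lπ) (hL : 0 ≤ L) (t : ℕ) :
    gradSq M π α θ₁ t
      = expect (sgdLaw M π α θ₁ (t - 1)) fun z => ‖policyGradient M π z.1‖ ^ 2 := by
  have h : gradient (objective M π) = policyGradient M π := funext fun θ =>
    (hasGradientAt_objective hπ hmix hρ0 hρ1 hLπ hL hR θ).gradient
  rw [gradSq_eq, h]
  rw [h]
  exact bdd_of_mem_Icc fun θ => ⟨sq_nonneg _, norm_sq_policyGradient_le hπ hR θ⟩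

/-- The general bound for the sum of the squared gradient norms along PG-SGD. -/
theorem sum_gradSq_le (hα0 : 0 ≤ α 0) (hα : ∀ n, 0 < α (n + 1)) {m ε : ℝ} {τ : ℕ}
    (hτ : σ * ρ ^ τ ≤ ε) (hm0 : 0 ≤ m) (hmg : ∀ θ, ‖policyGradient M π θ‖ ≤ m)
    (hms : ∀ θ s, ‖stateGrad M π θ s‖ ≤ m) (T : ℕ) :
    ∑ n ∈ Finset.range T, gradSq M π α θ₁ (n + 1)
      ≤ ∑ n ∈ Finset.range T,
          (expect (sgdLaw M π α θ₁ n) (fun w => objective M π w.1)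
            - expect (sgdLaw M π α θ₁ (n + 1)) fun w => objective M π w.1) / α (n + 1)
        + 2 * (1 + τ) * Ginf M.γ Rmax cΘ ^ 2 * cJ M.γ Rmax Lπ L cΘ σ ρ (Fintype.card A)
          * ∑ n ∈ Finset.range T, α (n + 1)
        + T * (Ginf M.γ Rmax cΘ ^ 2 * ε / 2) + 2 * (τ * m ^ 2) := by
  have hσρ := hmix.one_le
  have hσ : 0 < σ := pos_of_mul_pos_left (one_pos.trans_le hσρ) hρ0.le
  have hRmax := reward_bound_nonneg π hR
  have hc := hπ.cΘ_nonneg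
  have hG : 0 ≤ Ginf M.γ Rmax cΘ := div_nonneg (mul_nonneg hc hRmax) M.sub_pos.le
  have hα' : ∀ n, 0 ≤ α n := fun n => by
    rcases n with _ | n
    · exact hα0
    · exact (hα n).le
  have hcb : ∀ w, |gradCorr M π w| ≤ m ^ 2 := fun w => by
    rw [sq]
    exact (abs_real_inner_le_norm _ _).trans
      (mul_le_mul (hmg _) (hms _ _) (norm_nonneg _) hm0)
  have hgb : ∀ θ, ‖policyGradient M π θ‖ ^ 2 ≤ m ^ 2 := fun θ =>
    pow_le_pow_left₀ (norm_nonneg _) (hmg θ) 2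
  have hκ := biasCoeff_nonneg hπ hR hmix hρ0 hρ1 hLπ hL
  have hmain := sum_le_of_descent_of_bias
    (j := fun n => expect (sgdLaw M π α θ₁ n) fun w => objective M π w.1)
    (a := fun n => expect (sgdLaw M π α θ₁ n) (gradCorr M π))
    (g := fun n => gradSq M π α θ₁ (n + 1)) (s := fun n => α (n + 1))
    (b := Ginf M.γ Rmax cΘ ^ 2 * gradLip M Rmax Lπ L cΘ σ ρ)
    (κ := biasCoeff M Rmax Lπ L cΘ σ ρ * Ginf M.γ Rmax cΘ) (m := m ^ 2)
    (e := 2 * gradBound M Rmax cΘ ^ 2 * (σ * ρ ^ (τ + 1))) (τ := τ)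
    hα (mul_nonneg hκ hG) (by positivity)
    (expect_sgdLaw_objective_succ_le hπ hR hmix hρ0 hρ1 hLπ hL hα')
    (fun n => by
      rw [gradSq_eq_expect hmix hρ0 hρ1 hπ hR hLπ hL, Nat.add_sub_cancel, mul_assoc]
      exact le_expect_sgdLaw_gradCorr hπ hR hmix hρ0 hρ1 hLπ hL hα' n τ)
    (fun n => (abs_le.1 (abs_expect_le fun w _ => hcb w)).1)
    (fun n => by
      rw [gradSq_eq_expect hmix hρ0 hρ1 hπ hR hLπ hL]
      exact (le_abs_self _).trans (abs_expect_le fun w _ => by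
        rw [abs_of_nonneg (sq_nonneg _)]; exact hgb w.1))
    (fun n => expect_nonneg fun _ => sq_nonneg _) T
  refine hmain.trans ?_
  have h1 := mul_le_mul_of_nonneg_left (gradLip_le hπ hR hmix hρ0 hρ1 hLπ hL)
    (sq_nonneg (Ginf M.γ Rmax cΘ))
  have h2 := mul_le_mul_of_nonneg_left (mul_le_mul_of_nonneg_right
    (biasCoeff_le hπ hR hmix hρ0 hρ1 hLπ hL) hG) τ.cast_nonneg (α := ℝ)
  have h3 : 2 * gradBound M Rmax cΘ ^ 2 * (σ * ρ ^ (τ + 1)) ≤ Ginf M.γ Rmax cΘ ^ 2 * ε / 2 := by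
    have h4 : σ * ρ ^ (τ + 1) ≤ ε := by
      refine le_trans (mul_le_mul_of_nonneg_left ?_ hσ.le) hτ
      exact pow_le_pow_of_le_one hρ0.le hρ1.le τ.le_succ
    have h5 := gradBound_sq_le hπ hR
    calc _ ≤ 2 * (Ginf M.γ Rmax cΘ ^ 2 / 4) * ε :=
          mul_le_mul (mul_le_mul_of_nonneg_left h5 zero_le_two) h4 (by positivity) (by positivity)
      _ = _ := by ring
  gcongr
  · exact Finset.sum_nonneg fun n _ => (hα n).le
  · linarith

omit hπ hR hmix hρ0 hρ1 hLπ hL [Fintype A] [Infinite S] in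
theorem expect_sgdLaw_objective_mem (hR : ∀ s a, 0 ≤ M.R s a ∧ M.R s a ≤ Rmax) (n : ℕ) :
    0 ≤ expect (sgdLaw M π α θ₁ n) (fun w => objective M π w.1) ∧
      expect (sgdLaw M π α θ₁ n) (fun w => objective M π w.1) ≤ M.γ * Rmax :=
  ⟨expect_nonneg fun w => (objective_mem hR w.1).1,
    expect_le ((bdd_of_mem_Icc fun w => objective_mem hR w.1).on _)
      fun w _ => (objective_mem hR w.1).2⟩

omit hπ hR hmix hρ0 hρ1 hLπ hL [Fintype A] [Infinite S] in
theorem expect_sgdLaw_zero (hR : ∀ s a, 0 ≤ M.R s a ∧ M.R s a ≤ Rmax) :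
    expect (sgdLaw M π α θ₁ 0) (fun w => objective M π w.1) = objective M π θ₁ := by
  rw [sgdLaw, expect_map ((bdd_of_mem_Icc fun w => objective_mem hR w.1).on _)]
  exact expect_const _ (objective M π θ₁)

theorem gradSq_le {m : ℝ} (hmg : ∀ θ, ‖policyGradient M π θ‖ ≤ m) (t : ℕ) :
    gradSq M π α θ₁ t ≤ m ^ 2 := by
  rw [gradSq_eq_expect hmix hρ0 hρ1 hπ hR hLπ hL]
  refine (le_abs_self _).trans (abs_expect_le fun w _ => ?_)
  rw [abs_of_nonneg (sq_nonneg _)]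
  exact pow_le_pow_left₀ (norm_nonneg _) (hmg w.1) 2

theorem exists_gradSq_le_of_const {η : ℝ} (hη : 0 < η) {T : ℕ} (hT : 1 ≤ T) :
    ∃ t ∈ Finset.Icc 1 T, gradSq M π (fun _ => η) θ₁ t ≤
      (objective M π θ₁ / η + 2 * Ginf M.γ Rmax cΘ ^ 2 * (mixTime σ ρ η : ℝ)) / T
        + η * C1 M.γ Rmax Lπ L cΘ σ ρ (Fintype.card A) (mixTime σ ρ η : ℝ) := by
  have hσρ := hmix.one_le
  have hσ : 0 < σ := pos_of_mul_pos_left (one_pos.trans_le hσρ) hρ0.le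
  have hRmax := reward_bound_nonneg π hR
  have hc := hπ.cΘ_nonneg
  have hX := four_le_mixConst hρ0 hρ1 hσρ
  have hG : 0 ≤ Ginf M.γ Rmax cΘ := div_nonneg (mul_nonneg hc hRmax) M.sub_pos.le
  have hcJ : 0 ≤ cJ M.γ Rmax Lπ L cΘ σ ρ (Fintype.card A) :=
    cJ_nonneg M.γ_lt_one hRmax hLπ hL hc (by linarith)
  have hcJt : 0 ≤ cJtilde M.γ Rmax Lπ L cΘ σ ρ (Fintype.card A) :=
    cJtilde_nonneg M.γ_lt_one hRmax hLπ hL hc (by linarith)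
  have hJ := (objective_mem (π := π) hR θ₁).1
  have hT0 : (0 : ℝ) < T := by exact_mod_cast hT
  set G := Ginf M.γ Rmax cΘ
  set c := cJ M.γ Rmax Lπ L cΘ σ ρ (Fintype.card A)
  set c' := cJtilde M.γ Rmax Lπ L cΘ σ ρ (Fintype.card A)
  set τ := mixTime σ ρ η with hτ
  have hC1 : C1 M.γ Rmax Lπ L cΘ σ ρ (Fintype.card A) τ
      = G ^ 2 * (c / 2 + (3 * c + c') * τ + 1 + Lπ * G * (2 * τ + τ ^ 2) / 2) := rfl
  -- For η ≥ 1 the mixing time may be too small, but then the summand 1 in C₁ already dominates the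
  -- trivial bound G²/4 at t = 1.
  rcases le_or_gt 1 η with h1 | h1
  · refine ⟨1, Finset.mem_Icc.2 ⟨le_rfl, hT⟩, ?_⟩
    have h2 := gradSq_le (α := fun _ => η) (θ₁ := θ₁) hπ hR hmix hρ0 hρ1 hLπ hL
      (norm_policyGradient_le hπ hR) 1
    have h3 : gradBound M Rmax cΘ ^ 2 ≤ G ^ 2 / 4 := gradBound_sq_le hπ hR
    have h4 : G ^ 2 / 4 ≤ η * C1 M.γ Rmax Lπ L cΘ σ ρ (Fintype.card A) τ := by
      have h5 : G ^ 2 * 1 ≤ C1 M.γ Rmax Lπ L cΘ σ ρ (Fintype.card A) τ := by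
        rw [hC1]
        refine mul_le_mul_of_nonneg_left ?_ (sq_nonneg G)
        have : 0 ≤ c / 2 + (3 * c + c') * τ + Lπ * G * (2 * τ + τ ^ 2) / 2 := by positivity
        linarith
      nlinarith [sq_nonneg G]
    have h6 : 0 ≤ (objective M π θ₁ / η + 2 * G ^ 2 * τ) / T := by positivity
    exact (h2.trans h3).trans (by linarith)
  · have hτ2 : (2 : ℝ) ≤ τ := by exact_mod_cast two_le_mixTime hρ0 hρ1 hσρ hη h1
    have hsum := sum_gradSq_le (α := fun _ => η) (θ₁ := θ₁) hπ hR hmix hρ0 hρ1 hLπ hL hη.le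
      (fun _ => hη) (mixTime_spec hσ hρ1 hη) (gradBound_nonneg hπ hR)
      (norm_policyGradient_le hπ hR) (norm_stateGrad_le hπ hR) T
    obtain ⟨t, ht, hle⟩ := exists_le_div_of_sum_range_le hT hsum
    refine ⟨t, ht, hle.trans ?_⟩
    rw [← Finset.sum_div, Finset.sum_range_sub' fun n =>
      expect (sgdLaw M π (fun _ => η) θ₁ n) fun w => objective M π w.1, expect_sgdLaw_zero hR,
      Finset.sum_const, Finset.card_range, nsmul_eq_mul, ← hτ]
    have h2 := (expect_sgdLaw_objective_mem (π := π) (α := fun _ => η) (θ₁ := θ₁) hR T).1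
    have h3 : gradBound M Rmax cΘ ^ 2 ≤ G ^ 2 / 4 := gradBound_sq_le hπ hR
    have h4 : (objective M π θ₁
        - expect (sgdLaw M π (fun _ => η) θ₁ T) fun w => objective M π w.1) / η
        ≤ objective M π θ₁ / η := div_le_div_of_nonneg_right (by linarith) hη.le
    have h5 : 2 * (τ * gradBound M Rmax cΘ ^ 2) ≤ 2 * G ^ 2 * τ := by
      have := mul_le_mul_of_nonneg_left h3 τ.cast_nonneg (α := ℝ)
      nlinarith [mul_nonneg τ.cast_nonneg (sq_nonneg G) (α := ℝ)]
    have h6 : 2 * (1 + (τ : ℝ)) * G ^ 2 * c + G ^ 2 / 2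
        ≤ C1 M.γ Rmax Lπ L cΘ σ ρ (Fintype.card A) τ := by
      rw [hC1]
      -- The comparison 2(1 + τ) ≤ 1/2 + 3τ is where τ ≥ 2 is used.
      have h7 : 2 * (1 + (τ : ℝ)) * c + 1 / 2
          ≤ c / 2 + (3 * c + c') * τ + 1 + Lπ * G * (2 * τ + τ ^ 2) / 2 := by
        have h8 : 0 ≤ c' * τ + Lπ * G * (2 * τ + τ ^ 2) / 2 := by positivity
        have h9 := mul_le_mul_of_nonneg_left hτ2 hcJ
        linarith
      have := mul_le_mul_of_nonneg_left h7 (sq_nonneg G)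
      linarith
    have h7 := mul_le_mul_of_nonneg_left h6 (mul_nonneg hT0.le hη.le)
    rw [div_le_iff₀ hT0, add_mul, div_mul_cancel₀ _ hT0.ne']
    linarith

-- Used with v = √τ, r = √T and wY/4 ≥ m². The left alternative absorbs the end cost 2τm²/T into a
-- 1/√T term; the right one bounds m² itself. The split is at τ = 16T, and on each side AM-GM in vw
-- finishes.
omit hπ hR hmix hρ0 hρ1 hLπ hL in
theorem amgm_initial_cost {Y w v r : ℝ} (hY : 0 ≤ Y) (hw : 0 ≤ w) (hv : 0 ≤ v) (hr : 0 < r) :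
    2 * (v ^ 2 * (w * Y / 4)) / r ^ 2 ≤ Y * (3 / 4 + 2 * w ^ 2 * v ^ 2) / r ∨
      w * Y / 4 ≤ Y * (3 / 4 + 2 * w ^ 2 * v ^ 2) / r := by
  have hx : v * w / 16 ≤ 3 / 4 + 2 * w ^ 2 * v ^ 2 := by nlinarith [sq_nonneg (v * w - 1 / 64)]
  have hx2 : 2 * (v * w) ≤ 3 / 4 + 2 * w ^ 2 * v ^ 2 := by nlinarith [sq_nonneg (v * w - 1 / 2)]
  rcases le_total v (4 * r) with h | h
  · left
    rw [div_le_div_iff₀ (by positivity) hr]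
    have h1 : v * (v * w) ≤ 4 * r * (v * w) := mul_le_mul_of_nonneg_right h (mul_nonneg hv hw)
    have h2 := mul_le_mul_of_nonneg_left hx2 hr.le
    have h3 : v ^ 2 * w / 2 ≤ r * (3 / 4 + 2 * w ^ 2 * v ^ 2) := by linarith
    have h4 := mul_le_mul_of_nonneg_left h3 (mul_nonneg hY hr.le)
    linarith
  · right
    rw [le_div_iff₀ hr]
    have h1 : r * w / 4 ≤ v * w / 16 := by nlinarith
    have h2 := mul_le_mul_of_nonneg_left (h1.trans hx) hY
    linarith

end Rates

/-! ### Diminishing stepsizes: explicit bound and asymptotic rate. -/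

section DiminishingRates

variable {S A : Type*} [Fintype A] [Infinite S] {d : ℕ} {M : MDP S A}
  {π : EuclideanSpace ℝ (Fin d) → S → PMF A}
  {θ₁ : EuclideanSpace ℝ (Fin d)} {Rmax Lπ L cΘ σ ρ : ℝ}
  (hπ : PolicyAssumption π Lπ L cΘ) (hR : ∀ s a, 0 ≤ M.R s a ∧ M.R s a ≤ Rmax)
  (hmix : MixingAssumption M π σ ρ) (hρ0 : 0 < ρ) (hρ1 : ρ < 1) (hLπ : 0 ≤ Lπ) (hL : 0 ≤ L)

include hπ hR hmix hρ0 hρ1 hLπ hL in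
theorem exists_gradSq_le_of_sqrt {T : ℕ} (hT : 1 ≤ T) :
    ∃ t ∈ Finset.Icc 1 T, gradSq M π (fun k => (1 - M.γ) / √(k : ℝ)) θ₁ t ≤
      (objective M π θ₁ + 2 * (1 - M.γ) ^ 2 * Ginf M.γ Rmax cΘ ^ 2
          * (mixTime σ ρ ((1 - M.γ) / √(T : ℝ)) : ℝ)) / ((1 - M.γ) * T)
        + C2 M.γ Rmax Lπ L cΘ σ ρ (Fintype.card A) (mixTime σ ρ ((1 - M.γ) / √(T : ℝ)) : ℝ)
          / ((1 - M.γ) ^ 2 * √(T : ℝ)) := by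
  have hσρ := hmix.one_le
  have hσ : 0 < σ := pos_of_mul_pos_left (one_pos.trans_le hσρ) hρ0.le
  have hRmax := reward_bound_nonneg π hR
  have hc := hπ.cΘ_nonneg
  have hX := four_le_mixConst hρ0 hρ1 hσρ
  have hcJ : 0 ≤ cJ M.γ Rmax Lπ L cΘ σ ρ (Fintype.card A) :=
    cJ_nonneg M.γ_lt_one hRmax hLπ hL hc (by linarith)
  have hcJt : 0 ≤ cJtilde M.γ Rmax Lπ L cΘ σ ρ (Fintype.card A) :=
    cJtilde_nonneg M.γ_lt_one hRmax hLπ hL hc (by linarith)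
  have hJ := (objective_mem (π := π) hR θ₁).1
  have hT1 : (1 : ℝ) ≤ T := by exact_mod_cast hT
  have hδ := M.sub_pos
  have hδ1 : 1 - M.γ < 1 := by linarith [M.γ_pos]
  have hr1 : 1 ≤ √(T : ℝ) := Real.one_le_sqrt.2 hT1
  have hrT := Real.sq_sqrt (Nat.cast_nonneg (α := ℝ) T)
  have hj := expect_sgdLaw_objective_mem (π := π) (α := fun k => (1 - M.γ) / √(k : ℝ))
    (θ₁ := θ₁) hR
  have hj0 := expect_sgdLaw_zero (π := π) (α := fun k => (1 - M.γ) / √(k : ℝ)) (θ₁ := θ₁) hR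
  have hvB := valueBound_le (M := M) hRmax
  have hvB0 := valueBound_nonneg π hR
  have hγ1 : M.γ * (1 - M.γ) ≤ 1 / 4 := by nlinarith [sq_nonneg (M.γ - 1 / 2)]
  set δ := 1 - M.γ with hδdef
  set r := √(T : ℝ) with hr
  have hr0 : 0 < r := one_pos.trans_le hr1
  have hε : 0 < δ / r := div_pos hδ hr0
  have hε1 : δ / r < 1 := (div_lt_one hr0).2 (hδ1.trans_le hr1)
  set τ := mixTime σ ρ (δ / r) with hτ
  have hτ2 : (2 : ℝ) ≤ τ := by exact_mod_cast two_le_mixTime hρ0 hρ1 hσρ hε hε1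
  have hτ0 : (0 : ℝ) ≤ τ := τ.cast_nonneg
  -- Y/√T is the budget that the summand Rmax of C₂ provides. The telescoping sum uses a quarter of
  -- it, as γ(1 - γ) ≤ 1/4; the other three quarters go to the end cost through `amgm_initial_cost`.
  set Y := Rmax / δ ^ 2 with hYdef
  have hY : 0 ≤ Y := by positivity
  have hBY : Rmax / δ = δ * Y := by rw [hYdef]; field_simp
  have hRY : Rmax = δ ^ 2 * Y := by rw [hYdef]; field_simp
  set c := cJ M.γ Rmax Lπ L cΘ σ ρ (Fintype.card A) with hcdef
  set c' := cJtilde M.γ Rmax Lπ L cΘ σ ρ (Fintype.card A)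
  have hGY : Ginf M.γ Rmax cΘ = cΘ * (δ * Y) := by rw [Ginf, ← hBY, mul_div_assoc]
  set G := Ginf M.γ Rmax cΘ
  have hG0 : 0 ≤ G := by rw [hGY]; positivity
  -- Both gradient bounds are needed at once: m² has to be absorbed by c, whose relevant part
  -- contains |A|Lπ, and p⁴ ≤ cΘ³|A|Lπ provides that factor.
  set p := min cΘ (Fintype.card A * Lπ) with hp
  have hp0 : 0 ≤ p := le_min hc (by positivity)
  set m := p * (valueBound M Rmax / 2) with hm
  have hm0 : 0 ≤ m := by positivity
  have hmin : m = min (cΘ * (valueBound M Rmax / 2))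
      (Fintype.card A * Lπ * (valueBound M Rmax / 2)) :=
    min_mul_of_nonneg _ _ (by positivity)
  have hmg : ∀ θ, ‖policyGradient M π θ‖ ≤ m := fun θ => by
    rw [hmin]
    exact le_min (norm_policyGradient_le hπ hR θ) (norm_policyGradient_le_card hπ hLπ hR θ)
  have hms : ∀ θ s, ‖stateGrad M π θ s‖ ≤ m := fun θ s => by
    rw [hmin]
    exact le_min (norm_stateGrad_le hπ hR θ s) (norm_stateGrad_le_card hπ hLπ hR θ s)
  set w := p ^ 2 * δ ^ 2 * Y with hw
  have hw0 : 0 ≤ w := by positivity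
  have hm2 : m ^ 2 ≤ w * Y / 4 := by
    have h1 : m ≤ p * (δ * Y / 2) := by
      rw [← hBY]
      exact mul_le_mul_of_nonneg_left (div_le_div_of_nonneg_right hvB zero_le_two) hp0
    refine (pow_le_pow_left₀ hm0 h1 2).trans_eq ?_
    rw [hw]; ring
  have hleft : 2 * w ^ 2 * Y ≤ δ * G ^ 2 * c / 2 := by
    have h1 : cΘ * (δ * Y) * (Fintype.card A * Lπ * 4) ≤ c := by
      have h2 : c = Rmax * L / δ + (1 + cΘ) * (Rmax / δ) * (Fintype.card A * Lπ * mixConst σ ρ) := by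
        rw [hcdef, cJ, mul_div_assoc (1 + cΘ)]
      rw [h2, hBY]
      have h3 : 0 ≤ Rmax * L / δ := by positivity
      have h4 : cΘ * (δ * Y) * (Fintype.card A * Lπ * 4)
          ≤ (1 + cΘ) * (δ * Y) * (Fintype.card A * Lπ * mixConst σ ρ) := by
        gcongr
        linarith
      linarith
    have h5 : p ^ 4 ≤ cΘ ^ 3 * (Fintype.card A * Lπ) := by
      calc p ^ 4 = p ^ 3 * p := by ring
        _ ≤ cΘ ^ 3 * (Fintype.card A * Lπ) := mul_le_mul
          (pow_le_pow_left₀ hp0 (min_le_left _ _) 3) (min_le_right _ _) hp0 (by positivity)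
    calc 2 * w ^ 2 * Y = 2 * (δ ^ 4 * Y ^ 3) * p ^ 4 := by rw [hw]; ring
      _ ≤ 2 * (δ ^ 4 * Y ^ 3) * (cΘ ^ 3 * (Fintype.card A * Lπ)) :=
        mul_le_mul_of_nonneg_left h5 (by positivity)
      _ = δ * G ^ 2 / 2 * (cΘ * (δ * Y) * (Fintype.card A * Lπ * 4)) := by rw [hGY]; ring
      _ ≤ δ * G ^ 2 / 2 * c := mul_le_mul_of_nonneg_left h1 (by positivity)
      _ = _ := by ring
  have hvτ : √(τ : ℝ) ^ 2 = τ := Real.sq_sqrt hτ0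
  have hlow : objective M π θ₁ / (δ * T)
      + (Y + δ * G ^ 2 * (c * (1 + 6 * τ) + 1)) / r
      ≤ (objective M π θ₁ + 2 * δ ^ 2 * G ^ 2 * τ) / (δ * T)
        + C2 M.γ Rmax Lπ L cΘ σ ρ (Fintype.card A) τ / (δ ^ 2 * r) := by
    have h1 : C2 M.γ Rmax Lπ L cΘ σ ρ (Fintype.card A) τ = Rmax + δ ^ 3 * G ^ 2
      * (c + 2 * (3 * c + c') * τ + 1 + Lπ * G * (τ + τ ^ 2)) := rfl
    refine add_le_add (div_le_div_of_nonneg_right ?_ (by positivity)) ?_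
    · have : 0 ≤ 2 * δ ^ 2 * G ^ 2 * τ := by positivity
      linarith
    · rw [div_le_div_iff₀ hr0 (by positivity), h1]
      nth_rewrite 1 [hRY]
      have h2 : 0 ≤ δ ^ 3 * G ^ 2 * (2 * c' * τ + Lπ * G * (τ + τ ^ 2)) * r := by positivity
      linarith
  have hmid : Y * (3 / 4 + 2 * w ^ 2 * √(τ : ℝ) ^ 2) ≤ 3 / 4 * Y + δ * G ^ 2 * c / 2 * τ := by
    rw [hvτ]
    have := mul_le_mul_of_nonneg_right hleft hτ0
    linarith
  rcases amgm_initial_cost hY hw0 (Real.sqrt_nonneg (τ : ℝ)) hr0 with hcase | hcase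
  -- The algorithm never uses the stepsize with index 0; its value here is δ/√0 = 0.
  · have hsum := sum_gradSq_le (α := fun k => δ / √(k : ℝ)) (θ₁ := θ₁) hπ hR hmix hρ0 hρ1 hLπ hL
      (by simp) (fun n => by positivity) (mixTime_spec hσ hρ1 hε) hm0 hmg hms T
    obtain ⟨t, ht, hle⟩ := exists_le_div_of_sum_range_le hT hsum
    refine ⟨t, ht, (hle.trans ?_).trans hlow⟩
    rw [← hτ]
    have h1 := sum_sub_mul_sqrt_le (fun n => (hj n).1) (fun n => (hj n).2) hT
    rw [hj0] at h1
    have h2 : ∑ n ∈ Finset.range T,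
        (expect (sgdLaw M π (fun k => δ / √(k : ℝ)) θ₁ n) (fun w => objective M π w.1)
          - expect (sgdLaw M π (fun k => δ / √(k : ℝ)) θ₁ (n + 1)) fun w => objective M π w.1)
          / (δ / √((n + 1 : ℕ) : ℝ)) ≤ (objective M π θ₁ + M.γ * Rmax * (r - 1)) / δ := by
      refine Eq.trans_le ?_ (div_le_div_of_nonneg_right h1 hδ.le)
      rw [Finset.sum_div]
      refine Finset.sum_congr rfl fun n _ => ?_
      rw [div_div_eq_mul_div, Nat.cast_succ]
    have h3 : ∑ n ∈ Finset.range T, δ / √((n + 1 : ℕ) : ℝ) ≤ 2 * δ * r := by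
      have := mul_le_mul_of_nonneg_left (sum_one_div_sqrt_le T) hδ.le
      rw [Finset.mul_sum] at this
      refine (Eq.trans_le (Finset.sum_congr rfl fun n _ => ?_) this).trans_eq (by ring)
      rw [Nat.cast_succ]; ring
    have h4 := mul_le_mul_of_nonneg_left h3 (by positivity : 0 ≤ 2 * (1 + τ) * G ^ 2 * c)
    have h5 : 2 * (τ * m ^ 2) ≤ (3 / 4 * Y + δ * G ^ 2 * c / 2 * τ) * r := by
      have h6 := hcase.trans (div_le_div_of_nonneg_right hmid hr0.le)
      rw [div_le_div_iff₀ (by positivity) hr0, hvτ] at h6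
      have h7 : 2 * (τ * (w * Y / 4)) ≤ (3 / 4 * Y + δ * G ^ 2 * c / 2 * τ) * r :=
        le_of_mul_le_mul_right (h6.trans_eq (by ring)) hr0
      have h8 := mul_le_mul_of_nonneg_left hm2 hτ0
      linarith
    have h6 : (objective M π θ₁ + M.γ * Rmax * (r - 1)) / δ
        ≤ objective M π θ₁ / δ + Y / 4 * r := by
      have h7 : M.γ * Rmax * (r - 1) / δ = M.γ * δ * Y * (r - 1) := by
        nth_rewrite 1 [hRY]; field_simp
      have h8 : M.γ * δ * Y * (r - 1) ≤ 1 / 4 * Y * r :=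
        mul_le_mul (mul_le_mul_of_nonneg_right hγ1 hY) (by linarith) (by linarith) (by positivity)
      rw [add_div, h7]
      linarith
    have h7 : (T : ℝ) * (G ^ 2 * (δ / r) / 2) = G ^ 2 * δ / 2 * r := by
      rw [← hrT]; field_simp
    have h8 : objective M π θ₁ / (δ * T) + (Y + δ * G ^ 2 * (c * (1 + 6 * τ) + 1)) / r
        = (objective M π θ₁ / δ + (Y + δ * G ^ 2 * (c * (1 + 6 * τ) + 1)) * r) / T := by
      rw [← hrT]; field_simp
    rw [h8]
    refine div_le_div_of_nonneg_right ?_ (by positivity)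
    rw [h7]
    -- The coefficients of δG²c add up to 4(1 + τ) + τ/2, which is at most 1 + 6τ exactly when τ ≥
    -- 2.
    have h9 := mul_le_mul_of_nonneg_right hτ2 (by positivity : 0 ≤ δ * G ^ 2 * c * r)
    have h10 : 0 ≤ δ * G ^ 2 * r := by positivity
    linarith
  -- In the other case the mixing time is so large compared with T that t = 1 with the trivial bound
  -- m² works.
  · refine ⟨1, Finset.mem_Icc.2 ⟨le_rfl, hT⟩, (gradSq_le hπ hR hmix hρ0 hρ1 hLπ hL hmg 1).trans
      ((hm2.trans hcase).trans (le_trans ?_ hlow))⟩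
    have h1 : 0 ≤ objective M π θ₁ / (δ * T) := by positivity
    have h2 : Y * (3 / 4 + 2 * w ^ 2 * √(τ : ℝ) ^ 2) / r
        ≤ (Y + δ * G ^ 2 * (c * (1 + 6 * τ) + 1)) / r := by
      refine div_le_div_of_nonneg_right (hmid.trans ?_) hr0.le
      have h3 : 0 ≤ δ * G ^ 2 * c := by positivity
      have h4 : 0 ≤ δ * G ^ 2 * c * τ := by positivity
      have h5 : 0 ≤ δ * G ^ 2 := by positivity
      linarith
    linarith

/-- A bound of `mixTime` in units of `log (1 / ε)`. -/
def mixRate (σ ρ : ℝ) : ℝ :=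
  (2 + |Real.log σ| / Real.log (1 / ρ)) / Real.log √2 + 1 / Real.log (1 / ρ)

/-- The constant of the asymptotic rate for diminishing stepsizes. -/
def rateConst (Rmax Lπ L cΘ σ ρ : ℝ) (nA : ℕ) : ℝ :=
  mixRate σ ρ ^ 2 * (2 * Rmax + 2 * (cΘ * Rmax) ^ 2 + (cΘ * Rmax) ^ 2 *
    (7 * (Rmax * L + (1 + cΘ) * Rmax * (nA * Lπ * mixConst σ ρ))
      + 2 * (Rmax * L + cΘ * nA * Lπ * mixConst σ ρ) + 1 + 2 * (Lπ * (cΘ * Rmax))))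

/-- The mixing time is at most q = `mixRate σ ρ` · log(√T/(1 - γ)), and q ≥ 1 because T ≥ 2 keeps
the logarithm above log √2; so 1, τ and τ² are all at most q². The prefactor (1 - γ)³G² cancels the
poles of G², c_J, c_J̃ and G at γ = 1, leaving a constant free of γ. -/
theorem rate_le {γ J : ℝ} {T nA : ℕ} (hγ0 : 0 < γ) (hγ1 : γ < 1) (hRmax : 0 ≤ Rmax)
    (hJ : J ≤ γ * Rmax) (hσ : 0 < σ) (hρ0 : 0 < ρ) (hρ1 : ρ < 1) (hLπ : 0 ≤ Lπ)
    (hL : 0 ≤ L) (hc : 0 ≤ cΘ) (hX : 0 ≤ mixConst σ ρ) (hT : 2 ≤ T) :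
    (J + 2 * (1 - γ) ^ 2 * Ginf γ Rmax cΘ ^ 2
          * (mixTime σ ρ ((1 - γ) / √(T : ℝ)) : ℝ)) / ((1 - γ) * T)
        + C2 γ Rmax Lπ L cΘ σ ρ nA (mixTime σ ρ ((1 - γ) / √(T : ℝ)) : ℝ)
          / ((1 - γ) ^ 2 * √(T : ℝ))
      ≤ rateConst Rmax Lπ L cΘ σ ρ nA
        * (Real.log (√(T : ℝ) / (1 - γ)) ^ 2 / ((1 - γ) ^ 2 * √(T : ℝ))) := by
  have hT2 : (2 : ℝ) ≤ T := by exact_mod_cast hT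
  have hδ := sub_pos.2 hγ1
  have hδ1 : 1 - γ < 1 := by linarith
  have hs2 : 1 < √2 := Real.lt_sqrt_of_sq_lt (by norm_num)
  have hr2 : √2 ≤ √(T : ℝ) := Real.sqrt_le_sqrt hT2
  have hrT := Real.sq_sqrt (Nat.cast_nonneg (α := ℝ) T)
  have hℓ0 : 0 < Real.log √2 := Real.log_pos hs2
  set δ := 1 - γ with hδdef
  set r := √(T : ℝ) with hr
  have hr1 : 1 < r := hs2.trans_le hr2
  have hr0 : 0 < r := one_pos.trans hr1
  have hℓ : Real.log √2 ≤ Real.log (r / δ) := by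
    refine Real.log_le_log (by positivity) (hr2.trans ?_)
    rw [le_div_iff₀ hδ]
    exact mul_le_of_le_one_right hr0.le hδ1.le
  have hε : 0 < δ / r := div_pos hδ hr0
  have hε1 : δ / r ≤ 1 := (div_le_one hr0).2 (hδ1.le.trans hr1.le)
  have hτ := mixTime_le hσ hρ0 hρ1 hε hε1
  rw [one_div_div] at hτ
  set ℓ := Real.log (r / δ) with hℓdef
  set τ : ℝ := (mixTime σ ρ (δ / r) : ℝ) with hτdef
  have hτ0 : 0 ≤ τ := Nat.cast_nonneg _
  have hlρ : 0 < Real.log (1 / ρ) := Real.log_pos (by rw [lt_div_iff₀ hρ0]; linarith)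
  set q := mixRate σ ρ * ℓ with hq
  have h1ℓ : 1 ≤ ℓ / Real.log √2 := (one_le_div hℓ0).2 hℓ
  have hqe : q = (2 + |Real.log σ| / Real.log (1 / ρ)) * (ℓ / Real.log √2)
      + ℓ / Real.log (1 / ρ) := by rw [hq, mixRate]; ring
  have hab : 0 ≤ |Real.log σ| / Real.log (1 / ρ) := by positivity
  have hℓρ : 0 ≤ ℓ / Real.log (1 / ρ) := div_nonneg (hℓ0.le.trans hℓ) hlρ.le
  have hq' : 2 + |Real.log σ| / Real.log (1 / ρ) + ℓ / Real.log (1 / ρ) ≤ q := by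
    rw [hqe]
    have := le_mul_of_one_le_right (by linarith : 0 ≤ 2 + |Real.log σ| / Real.log (1 / ρ)) h1ℓ
    linarith
  have hq1 : 1 ≤ q := by linarith
  have hτq : τ ≤ q := by rw [add_div] at hτ; linarith
  have h1q : 1 ≤ q ^ 2 := one_le_pow₀ hq1
  have hτq2 : τ ≤ q ^ 2 := by nlinarith
  have hτ2q : τ ^ 2 ≤ q ^ 2 := pow_le_pow_left₀ hτ0 hτq 2
  set k₁ := Rmax * L + (1 + cΘ) * Rmax * (nA * Lπ * mixConst σ ρ) with hk₁
  set k₂ := Rmax * L + cΘ * nA * Lπ * mixConst σ ρ with hk₂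
  have hk₁0 : 0 ≤ k₁ := by positivity
  have hk₂0 : 0 ≤ k₂ := by positivity
  have hG : δ * Ginf γ Rmax cΘ = cΘ * Rmax := by rw [Ginf, ← hδdef]; field_simp
  have hcJ : δ * cJ γ Rmax Lπ L cΘ σ ρ nA = k₁ := by
    rw [cJ, ← hδdef, hk₁]; field_simp
  have hcJt : δ * cJtilde γ Rmax Lπ L cΘ σ ρ nA ≤ k₂ := by
    have h1 : δ * cJtilde γ Rmax Lπ L cΘ σ ρ nA
        = Rmax * L + δ * (cΘ * nA * Lπ * mixConst σ ρ) := by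
      rw [cJtilde, ← hδdef]; field_simp
    rw [h1, hk₂]
    have := mul_le_of_le_one_left (by positivity : 0 ≤ cΘ * nA * Lπ * mixConst σ ρ) hδ1.le
    linarith
  have hrate : rateConst Rmax Lπ L cΘ σ ρ nA * (ℓ ^ 2 / (δ ^ 2 * r))
      = q ^ 2 * (2 * Rmax + 2 * (cΘ * Rmax) ^ 2 + (cΘ * Rmax) ^ 2 *
        (7 * k₁ + 2 * k₂ + 1 + 2 * (Lπ * (cΘ * Rmax)))) / (δ ^ 2 * r) := by
    rw [rateConst, hq]; ring
  have hC2 : C2 γ Rmax Lπ L cΘ σ ρ nA τ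
      ≤ q ^ 2 * (Rmax + (cΘ * Rmax) ^ 2 * (7 * k₁ + 2 * k₂ + 1 + 2 * (Lπ * (cΘ * Rmax)))) := by
    have e : C2 γ Rmax Lπ L cΘ σ ρ nA τ = Rmax + (δ * Ginf γ Rmax cΘ) ^ 2
        * (δ * cJ γ Rmax Lπ L cΘ σ ρ nA + 2 * (3 * (δ * cJ γ Rmax Lπ L cΘ σ ρ nA)
          + δ * cJtilde γ Rmax Lπ L cΘ σ ρ nA) * τ + δ
          + Lπ * (δ * Ginf γ Rmax cΘ) * (τ + τ ^ 2)) := by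
      rw [C2, ← hδdef]; ring
    rw [e, hG, hcJ]
    have h1 : k₁ + 2 * (3 * k₁ + δ * cJtilde γ Rmax Lπ L cΘ σ ρ nA) * τ + δ
          + Lπ * (cΘ * Rmax) * (τ + τ ^ 2)
        ≤ q ^ 2 * (7 * k₁ + 2 * k₂ + 1 + 2 * (Lπ * (cΘ * Rmax))) := by
      have h2 := mul_le_mul_of_nonneg_left h1q hk₁0
      have h3 := mul_le_mul_of_nonneg_left hτq2 hk₁0
      have h4 := mul_le_mul_of_nonneg_right hcJt hτ0
      have h5 := mul_le_mul_of_nonneg_left hτq2 hk₂0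
      have h6 := mul_le_mul_of_nonneg_left (add_le_add hτq2 hτ2q)
        (by positivity : 0 ≤ Lπ * (cΘ * Rmax))
      linarith
    have h7 := mul_le_mul_of_nonneg_left h1 (sq_nonneg (cΘ * Rmax))
    have h8 := mul_le_mul_of_nonneg_left h1q hRmax
    linarith
  have hfirst : (J + 2 * δ ^ 2 * Ginf γ Rmax cΘ ^ 2 * τ) / (δ * T)
      ≤ q ^ 2 * (Rmax + 2 * (cΘ * Rmax) ^ 2) / (δ ^ 2 * r) := by
    rw [← hrT, div_le_div_iff₀ (by positivity) (by positivity)]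
    have h1 : J + 2 * δ ^ 2 * Ginf γ Rmax cΘ ^ 2 * τ
        ≤ q ^ 2 * (Rmax + 2 * (cΘ * Rmax) ^ 2) := by
      have h2 : 2 * δ ^ 2 * Ginf γ Rmax cΘ ^ 2 * τ = 2 * (cΘ * Rmax) ^ 2 * τ := by
        rw [← hG]; ring
      rw [h2]
      have h3 := mul_le_mul_of_nonneg_left hτq2 (by positivity : 0 ≤ 2 * (cΘ * Rmax) ^ 2)
      have h4 := mul_le_mul_of_nonneg_left h1q hRmax
      have h5 := mul_le_of_le_one_left hRmax hγ1.le
      linarith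
    refine mul_le_mul h1 ?_ (by positivity) (by positivity)
    calc δ ^ 2 * r = δ * r * δ := by ring
      _ ≤ δ * r * r := mul_le_mul_of_nonneg_left (hδ1.le.trans hr1.le) (by positivity)
      _ = δ * r ^ 2 := by ring
  rw [hrate]
  refine (add_le_add hfirst (div_le_div_of_nonneg_right hC2 (by positivity))).trans_eq ?_
  ring

end DiminishingRates

end PGSGD

end

/-! ### The theorem, with each minimum over t stated as the existence of a good index. -/

theorem proposition1 (Rmax Lπ L cΘ σ ρ : ℝ) (nA : ℕ)
    (hLπ : 0 ≤ Lπ) (hL : 0 ≤ L) (hσ : 0 < σ) (hρ0 : 0 < ρ) (hρ1 : ρ < 1) :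
    ∃ C : ℝ, ∀ (d : ℕ) (S A : Type*) [Countable S] [Infinite S] [Fintype A]
      (M : PGSGD.MDP S A) (π : EuclideanSpace ℝ (Fin d) → S → PMF A)
      (θ₁ : EuclideanSpace ℝ (Fin d)),
      Fintype.card A = nA →
      (∀ s a, 0 ≤ M.R s a ∧ M.R s a ≤ Rmax) →
      PGSGD.PolicyAssumption π Lπ L cΘ →
      PGSGD.MixingAssumption M π σ ρ →
      -- the objective is differentiable, with the policy gradient as its gradient
      (∀ θ, HasGradientAt (PGSGD.objective M π) (PGSGD.policyGradient M π θ) θ) ∧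
      -- constant stepsize
      (∀ α : ℝ, 0 < α → ∀ T : ℕ, 1 ≤ T → ∃ t ∈ Finset.Icc 1 T,
        PGSGD.gradSq M π (fun _ => α) θ₁ t ≤
          (PGSGD.objective M π θ₁ / α
              + 2 * PGSGD.Ginf M.γ Rmax cΘ ^ 2 * (PGSGD.mixTime σ ρ α : ℝ)) / T
            + α * PGSGD.C1 M.γ Rmax Lπ L cΘ σ ρ nA (PGSGD.mixTime σ ρ α : ℝ)) ∧
      -- diminishing stepsize: explicit bound and rate
      (∀ T : ℕ, 1 ≤ T → ∃ t ∈ Finset.Icc 1 T,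
        PGSGD.gradSq M π (fun k => (1 - M.γ) / √(k : ℝ)) θ₁ t ≤
          (PGSGD.objective M π θ₁ + 2 * (1 - M.γ) ^ 2 * PGSGD.Ginf M.γ Rmax cΘ ^ 2
              * (PGSGD.mixTime σ ρ ((1 - M.γ) / √(T : ℝ)) : ℝ)) / ((1 - M.γ) * T)
            + PGSGD.C2 M.γ Rmax Lπ L cΘ σ ρ nA
                (PGSGD.mixTime σ ρ ((1 - M.γ) / √(T : ℝ)) : ℝ)
              / ((1 - M.γ) ^ 2 * √(T : ℝ))) ∧
      (∀ T : ℕ, 2 ≤ T → ∃ t ∈ Finset.Icc 1 T,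
        PGSGD.gradSq M π (fun k => (1 - M.γ) / √(k : ℝ)) θ₁ t ≤
          C * (Real.log (√(T : ℝ) / (1 - M.γ)) ^ 2 / ((1 - M.γ) ^ 2 * √(T : ℝ)))) := by
  refine ⟨PGSGD.rateConst Rmax Lπ L cΘ σ ρ nA, ?_⟩
  intro d S A _ _ _ M π θ₁ hA hR hπ hmix
  subst hA
  refine ⟨PGSGD.hasGradientAt_objective hπ hmix hρ0 hρ1 hLπ hL hR,
    fun α hα T hT => PGSGD.exists_gradSq_le_of_const hπ hR hmix hρ0 hρ1 hLπ hL hα hT,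
    fun T hT => PGSGD.exists_gradSq_le_of_sqrt hπ hR hmix hρ0 hρ1 hLπ hL hT, fun T hT => ?_⟩
  obtain ⟨t, ht, hle⟩ := PGSGD.exists_gradSq_le_of_sqrt (θ₁ := θ₁) hπ hR hmix hρ0 hρ1 hLπ hL
    (one_le_two.trans hT)
  have hX := PGSGD.four_le_mixConst hρ0 hρ1 hmix.one_le
  exact ⟨t, ht, hle.trans (PGSGD.rate_le M.γ_pos M.γ_lt_one (PGSGD.reward_bound_nonneg π hR)
    (PGSGD.objective_mem hR θ₁).2 hσ hρ0 hρ1 hLπ hL hπ.cΘ_nonneg (by linarith) hT)⟩
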